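/- Let $p\ge 3$ be a prime. **Frames and windows.** A frame is $\mathscr F=(S,I,R,\sigma,\sigma_1)$ with a commutative ring $S$, an ideal $I$ of $S$, $R=S/I$, a ring endomorphism $\sigma$ of $S$ and a $\sigma$-linear map $\sigma_1:I\to S$ such that $I+pS$ lies in the Jacobson radical of $S$, $\sigma(a)\equiv a^p$ mod $pS$ for $a\in S$, and $\sigma_1(I)$ generates $S$ as an $S$-module. A window over $\mathscr F$ is $(P,Q,F,F_1)$ with a finitely generated projective $S$-module $P$, a submodule $Q\subseteq P$ such that $P=L\oplus T$ and $Q=L\oplus IT$ for suitable $L$, $T$, and $\sigma$-linear maps $F:P\to P$, $F_1:Q\to P$ with $F_1(ax)=\sigma_1(a)F(x)$ for $a\in I$, $x\in P$, such that $F_1(Q)$ generates $P$ as an $S$-module. For a unit $u\in S'$, a $u$-homomorphism of frames $\alpha:\mathscr F\to\mathscr F'$ is a ring homomorphism $\alpha:S\to S'$ with $\alpha(I)\subseteq I'$, $\sigma'\alpha=\alpha\sigma$ and $\sigma_1'\alpha=u\cdot\alpha\sigma_1$. An $\alpha$-homomorphism $g$ from a window $\mathscr P$ over $\mathscr F$ to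 a window $\mathscr P'$ over $\mathscr F'$ is an $S$-linear map $g:P\to P'$ with $g(Q)\subseteq Q'$, $F'g=gF$, $F_1'g=u\cdot gF_1$; for $\alpha=\mathrm{id}$, $u=1$ this is a homomorphism of windows over $\mathscr F$. The base change functor $\alpha_*$ from windows over $\mathscr F$ to windows over $\mathscr F'$ is characterised by natural bijections $\mathrm{Hom}(\alpha_*\mathscr P,\mathscr P')=\mathrm{Hom}_\alpha(\mathscr P,\mathscr P')$, induced by a natural $\alpha$-homomorphism $\mathscr P\to\alpha_*\mathscr P$. One calls $\alpha$ crystalline if $\alpha_*$ is an equivalence of categories. **The frames.** Let $R$ be a complete regular local ring with maximal ideal $\mathfrak m$, of dimension $r$, with perfect residue field $k$ of characteristic $p$. Let $\mathfrak S=W(k)[[x_1,\dots,x_r]]$, let $\sigma$ be the endomorphism of $\mathfrak S$ which is the Frobenius on the coefficients in $W(k)$ and satisfies $\sigma(x_i)=x_i^p$, and put $J=(x_1,\dots,x_r)$. Let $\pi:\mathfrak S\to R$ be a ring homomorphism such that $\pi(x_1),\dots,\pi(x_r)$ is a regular system of parameters of $R$ and such that $\mathfrak S\to R\to k$ is surjective.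 For $E\in\mathfrak S$ with constant term $p$ let $\mathscr B=(\mathfrak S,E\mathfrak S,\mathfrak S/E\mathfrak S,\sigma,\sigma_1)$ with $\sigma_1(Ey)=\sigma(y)$; for $a\ge 1$ put $\mathfrak S_a=\mathfrak S/J^a$ and let $\mathscr B_a=(\mathfrak S_a,E\mathfrak S_a,\mathfrak S_a/E\mathfrak S_a,\sigma_a,\sigma_{1a})$ be defined in the same way, with $\sigma_a$ induced by $\sigma$. For a complete local ring $A$ with maximal ideal $\mathfrak m_A$ and perfect residue field $k_A$ of characteristic $p$, let $\mathbb W(A)$ be the unique subring of $W(A)$, stable under the Frobenius $f$, whose projection to $W(k_A)$ is surjective with kernel $\hat W(\mathfrak m_A)$, the set of Witt vectors whose components lie in $\mathfrak m_A$ and converge to $0$ in the $\mathfrak m_A$-adic topology; let $\mathbb I_A$ be the kernel of $\mathbb W(A)\to A$. The Dieudonné frame is $\mathscr D_A=(\mathbb W(A),\mathbb I_A,A,f,f_1)$, where $f_1$ is the inverse of the Verschiebung; windows over $\mathscr D_A$ are the Dieudonné displays over $A$. Put $R_a=R/\mathfrak m^a$. Let $\delta:\mathfrak S\to W(\mathfrak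 S)$ be the ring homomorphism with $w_n\circ\delta=\sigma^n$ for all $n\ge 0$, where $w_n$ are the ghost components. **Theorem.** The homomorphism $\pi$ is surjective, there is an $E\in\mathfrak S$ with constant term $p$ and $\pi(E)=0$, and for each such $E$ the following holds. 1. $\ker\pi=E\mathfrak S$, so that $R=\mathfrak S/E\mathfrak S$. 2. The ring homomorphism $\varkappa=W(\pi)\circ\delta:\mathfrak S\to W(R)$ has image in $\mathbb W(R)$ and is a $u$-homomorphism of frames $\varkappa:\mathscr B\to\mathscr D_R$ for a unit $u\in\mathbb W(R)$ with $pu=\varkappa(\sigma(E))$. 3. $\varkappa$ is crystalline, i.e. it induces an equivalence between windows over $\mathscr B$ and Dieudonné displays over $R$. 4. For each integer $a\ge 1$, $\varkappa$ induces a $\bar u$-homomorphism of frames $\varkappa_a:\mathscr B_a\to\mathscr D_{R_a}$, where $\bar u$ is the image of $u$ in $\mathbb W(R_a)$, and $\varkappa_a$ is crystalline. -/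

import Mathlib

universe u

open CategoryTheory

namespace LauFrames

/-! ### Frames and windows -/

/-- A frame `(S, I, R, σ, σ₁)`; the quotient `R = S / I` is `Frame.R`. -/
structure Frame (p : ℕ) where
  S : Type u
  [commRing : CommRing S]
  I : Ideal S
  σ : S →+* S
  σ₁ : I →ₛₗ[σ] S
  le_jacobson : I ⊔ Ideal.span {(p : S)} ≤ Ideal.jacobson ⊥
  frobenius_lift : ∀ a : S, (p : S) ∣ σ a - a ^ p
  span_range_σ₁ : Submodule.span S (Set.range σ₁) = ⊤

attribute [instance] Frame.commRing

/-- The ring `R = S / I` of a frame. -/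
abbrev Frame.R {p : ℕ} (𝓕 : Frame.{u} p) : Type u := 𝓕.S ⧸ 𝓕.I

/-- A window `(P, Q, F, F₁)` over a frame. -/
structure Window {p : ℕ} (𝓕 : Frame.{u} p) where
  P : Type u
  [addCommGroup : AddCommGroup P]
  [module : Module 𝓕.S P]
  [finite : Module.Finite 𝓕.S P]
  [projective : Module.Projective 𝓕.S P]
  Q : Submodule 𝓕.S P
  F : P →ₛₗ[𝓕.σ] P
  F₁ : Q →ₛₗ[𝓕.σ] P
  exists_normal_decomposition :
    ∃ L T : Submodule 𝓕.S P, IsCompl L T ∧ Q = L ⊔ 𝓕.I • T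
  F₁_smul : ∀ (a : 𝓕.I) (x : P) (hax : (a : 𝓕.S) • x ∈ Q), F₁ ⟨(a : 𝓕.S) • x, hax⟩ = 𝓕.σ₁ a • F x
  span_range_F₁ : Submodule.span 𝓕.S (Set.range F₁) = ⊤

attribute [instance] Window.addCommGroup Window.module Window.finite Window.projective

/-- The products `a x` with `a ∈ I` and `x ∈ P` lie in `Q`, so that the condition `F₁_smul`
applies to all of them. -/
theorem Window.smul_mem_Q {p : ℕ} {𝓕 : Frame.{u} p} (𝓟 : Window 𝓕) (a : 𝓕.I) (x : 𝓟.P) :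
    (a : 𝓕.S) • x ∈ 𝓟.Q := by
  obtain ⟨L, T, hLT, hQ⟩ := 𝓟.exists_normal_decomposition
  obtain ⟨l, hl, t, ht, rfl⟩ :=
    Submodule.mem_sup.1 (hLT.sup_eq_top ▸ Submodule.mem_top : x ∈ L ⊔ T)
  rw [hQ, smul_add]
  exact Submodule.add_mem_sup (L.smul_mem _ hl) (Submodule.smul_mem_smul a.2 ht)

/-- A homomorphism of windows over a frame. -/
@[ext]
structure Window.Hom {p : ℕ} {𝓕 : Frame.{u} p} (𝓟 𝓟' : Window 𝓕) where
  g : 𝓟.P →ₗ[𝓕.S] 𝓟'.P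
  map_Q : ∀ x ∈ 𝓟.Q, g x ∈ 𝓟'.Q
  map_F : ∀ x, 𝓟'.F (g x) = g (𝓟.F x)
  map_F₁ : ∀ x : 𝓟.Q, 𝓟'.F₁ ⟨g x, map_Q x x.2⟩ = g (𝓟.F₁ x)

/-- The category of windows over a frame. -/
instance {p : ℕ} (𝓕 : Frame.{u} p) : Category (Window 𝓕) where
  Hom := Window.Hom
  id 𝓟 := ⟨LinearMap.id, fun _ h => h, fun _ => rfl, fun _ => rfl⟩
  comp a b := ⟨b.g ∘ₗ a.g, fun x h => b.map_Q _ (a.map_Q x h),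
    fun x => by simp [a.map_F, b.map_F],
    fun x => by
      have h1 := b.map_F₁ ⟨a.g x, a.map_Q x x.2⟩
      rw [a.map_F₁] at h1
      exact h1⟩

/-- A homomorphism of frames, more precisely a `u`-homomorphism: the unit `u` is part of the
data (it is determined by the ring homomorphism). -/
structure FrameHom {p : ℕ} (𝓕 𝓕' : Frame.{u} p) where
  toRingHom : 𝓕.S →+* 𝓕'.S
  u : 𝓕'.Sˣ
  map_I : ∀ a ∈ 𝓕.I, toRingHom a ∈ 𝓕'.I
  map_σ : ∀ a, 𝓕'.σ (toRingHom a) = toRingHom (𝓕.σ a)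
  map_σ₁ : ∀ a : 𝓕.I, 𝓕'.σ₁ ⟨toRingHom a, map_I a a.2⟩ = u * toRingHom (𝓕.σ₁ a)

/-- An `α`-homomorphism of windows `𝓟 → 𝓟'`, for a `u`-homomorphism of frames `α`. -/
@[ext]
structure AlphaHom {p : ℕ} {𝓕 𝓕' : Frame.{u} p} (α : FrameHom 𝓕 𝓕')
    (𝓟 : Window 𝓕) (𝓟' : Window 𝓕') where
  g : 𝓟.P →ₛₗ[α.toRingHom] 𝓟'.P
  map_Q : ∀ x ∈ 𝓟.Q, g x ∈ 𝓟'.Q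
  map_F : ∀ x, 𝓟'.F (g x) = g (𝓟.F x)
  map_F₁ : ∀ x : 𝓟.Q, 𝓟'.F₁ ⟨g x, map_Q x x.2⟩ = (α.u : 𝓕'.S) • g (𝓟.F₁ x)

/-- The composite of an `α`-homomorphism with a homomorphism of windows over the target. -/
def AlphaHom.postcomp {p : ℕ} {𝓕 𝓕' : Frame.{u} p} {α : FrameHom 𝓕 𝓕'}
    {𝓟 : Window 𝓕} {𝓟' 𝓟'' : Window 𝓕'} (g : AlphaHom α 𝓟 𝓟') (h : 𝓟' ⟶ 𝓟'') :
    AlphaHom α 𝓟 𝓟'' where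
  g := (Window.Hom.g h).comp g.g
  map_Q x hx := Window.Hom.map_Q h _ (g.map_Q x hx)
  map_F x := by simp [Window.Hom.map_F h, g.map_F]
  map_F₁ x := by
    have h1 := Window.Hom.map_F₁ h ⟨g.g x, g.map_Q x x.2⟩
    rw [g.map_F₁, map_smul] at h1
    exact h1

/-- The composite of a homomorphism of windows over the source with an `α`-homomorphism. -/
def AlphaHom.precomp {p : ℕ} {𝓕 𝓕' : Frame.{u} p} {α : FrameHom 𝓕 𝓕'}
    {𝓟₀ 𝓟 : Window 𝓕} {𝓟' : Window 𝓕'} (h : 𝓟₀ ⟶ 𝓟) (g : AlphaHom α 𝓟 𝓟') :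
    AlphaHom α 𝓟₀ 𝓟' where
  g := g.g.comp (Window.Hom.g h)
  map_Q x hx := g.map_Q _ (Window.Hom.map_Q h x hx)
  map_F x := by simp [Window.Hom.map_F h, g.map_F]
  map_F₁ x := by
    have h1 := g.map_F₁ ⟨Window.Hom.g h x, Window.Hom.map_Q h x x.2⟩
    rw [Window.Hom.map_F₁ h] at h1
    exact h1

/-- The base change functor `α_*` of a homomorphism of frames `α`, with its universal property:
for each window `𝓟` over the source a window `α_* 𝓟` over the target and an `α`-homomorphism
`𝓟 → α_* 𝓟`, natural in `𝓟`, which induces bijections `Hom(α_* 𝓟, 𝓟') = Hom_α(𝓟, 𝓟')`.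
This determines the functor up to a unique natural isomorphism. -/
structure BaseChange {p : ℕ} {𝓕 𝓕' : Frame.{u} p} (α : FrameHom 𝓕 𝓕') where
  functor : Window 𝓕 ⥤ Window 𝓕'
  unit : ∀ 𝓟 : Window 𝓕, AlphaHom α 𝓟 (functor.obj 𝓟)
  naturality : ∀ {𝓟₁ 𝓟₂ : Window 𝓕} (h : 𝓟₁ ⟶ 𝓟₂),
    (unit 𝓟₁).postcomp (functor.map h) = AlphaHom.precomp h (unit 𝓟₂)
  bijective : ∀ (𝓟 : Window 𝓕) (𝓟' : Window 𝓕'),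
    Function.Bijective fun h : functor.obj 𝓟 ⟶ 𝓟' => (unit 𝓟).postcomp h

/-- A homomorphism of frames is crystalline if the base change functor exists and is an
equivalence of categories. -/
def IsCrystalline {p : ℕ} {𝓕 𝓕' : Frame.{u} p} (α : FrameHom 𝓕 𝓕') : Prop :=
  ∃ T : BaseChange α, T.functor.IsEquivalence

end LauFrames

namespace LauFrames


/-! ### The frames `𝓑` and `𝓑_a` -/

/-- The frame `(S, ES, S/ES, σ, σ₁)` with `σ₁(Ey) = σ(y)`, where `E` is a regular element of
a local ring `S`, and `E` and `p` lie in the maximal ideal. -/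
noncomputable def principalFrame (p : ℕ) (S : Type u) [CommRing S] [IsLocalRing S] (σ : S →+* S)
    (hσ : ∀ a : S, (p : S) ∣ σ a - a ^ p) (E : S) (hreg : ∀ y : S, E * y = 0 → y = 0)
    (hE : E ∈ IsLocalRing.maximalIdeal S) (hp : (p : S) ∈ IsLocalRing.maximalIdeal S) :
    Frame.{u} p :=
  have hdiv : ∀ a : Ideal.span {E}, ∃ y, (a : S) = E * y :=
    fun a => Ideal.mem_span_singleton.1 a.2
  have hcan : ∀ y z : S, E * y = E * z → y = z := fun y z h =>
    sub_eq_zero.1 (hreg _ (by rw [mul_sub, h, sub_self]))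
  { S := S
    I := Ideal.span {E}
    σ := σ
    σ₁ :=
      { toFun := fun a => σ (hdiv a).choose
        map_add' := fun a b => by
          rw [← map_add]
          congr 1
          refine hcan _ _ ?_
          rw [mul_add, ← (hdiv a).choose_spec, ← (hdiv b).choose_spec, ← (hdiv (a + b)).choose_spec]
          rfl
        map_smul' := fun s a => by
          rw [smul_eq_mul, ← map_mul]
          congr 1
          refine hcan _ _ ?_
          rw [mul_left_comm, ← (hdiv a).choose_spec, ← (hdiv (s • a)).choose_spec]
          rfl }
    le_jacobson := by
      rw [IsLocalRing.jacobson_eq_maximalIdeal ⊥ bot_ne_top, sup_le_iff,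
        Ideal.span_singleton_le_iff_mem, Ideal.span_singleton_le_iff_mem]
      exact ⟨hE, hp⟩
    frobenius_lift := hσ
    span_range_σ₁ := by
      refine (Ideal.eq_top_iff_one _).2 ?_
      refine Submodule.subset_span ⟨⟨E, Ideal.mem_span_singleton_self E⟩, ?_⟩
      change σ (hdiv _).choose = 1
      rw [show (hdiv ⟨E, Ideal.mem_span_singleton_self E⟩).choose = 1 from
        hcan _ _ (by rw [← (hdiv _).choose_spec, mul_one]), map_one] }

theorem principalFrame_σ₁ (p : ℕ) (S : Type u) [CommRing S] [IsLocalRing S] (σ : S →+* S)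
    (hσ : ∀ a : S, (p : S) ∣ σ a - a ^ p) (E : S) (hreg : ∀ y : S, E * y = 0 → y = 0)
    (hE : E ∈ IsLocalRing.maximalIdeal S) (hp : (p : S) ∈ IsLocalRing.maximalIdeal S) (y : S)
    (hy : E * y ∈ Ideal.span {E}) :
    (principalFrame p S σ hσ E hreg hE hp).σ₁ ⟨E * y, hy⟩ = σ y := by
  have hdiv : ∃ z, E * y = E * z := ⟨y, rfl⟩
  change σ hdiv.choose = σ y
  congr 1
  refine (sub_eq_zero.1 (hreg _ ?_)).symm
  rw [mul_sub, ← hdiv.choose_spec, sub_self]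

section Breuil

variable (p : ℕ) [Fact p.Prime] (k : Type u) [Field k] (r : ℕ)

/-- The ring `𝔖 = W(k)[[x₁, …, x_r]]`. -/
abbrev 𝔖 : Type u := MvPowerSeries (Fin r) (WittVector p k)

/-- The endomorphism `σ` of `𝔖`: the Frobenius of `W(k)` on coefficients, and `x_i ↦ x_i ^ p`. -/
noncomputable def frob𝔖 : 𝔖 p k r →+* 𝔖 p k r :=
  (MvPowerSeries.expand p (Fact.out : p.Prime).ne_zero).toRingHom.comp
    (MvPowerSeries.map WittVector.frobenius)

theorem frob𝔖_X (i : Fin r) : frob𝔖 p k r (MvPowerSeries.X i) = MvPowerSeries.X i ^ p := by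
  simp [frob𝔖]

theorem frob𝔖_C (w : WittVector p k) :
    frob𝔖 p k r (MvPowerSeries.C w) = MvPowerSeries.C (WittVector.frobenius w) := by
  simp [frob𝔖, MvPowerSeries.expand_C]

/-- The ideal `J = (x₁, …, x_r)` of `𝔖`. -/
noncomputable def J𝔖 : Ideal (𝔖 p k r) := Ideal.span (Set.range MvPowerSeries.X)

theorem J𝔖_pow_le_comap (a : ℕ) : J𝔖 p k r ^ a ≤ (J𝔖 p k r ^ a).comap (frob𝔖 p k r) := by
  rw [← Ideal.map_le_iff_le_comap, Ideal.map_pow]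
  refine Ideal.pow_right_mono ?_ a
  rw [J𝔖, Ideal.map_span, Ideal.span_le]
  rintro _ ⟨_, ⟨i, rfl⟩, rfl⟩
  rw [SetLike.mem_coe, frob𝔖_X]
  have hX : MvPowerSeries.X i ∈ Ideal.span (Set.range (MvPowerSeries.X (σ := Fin r)
      (R := WittVector p k))) := Ideal.subset_span ⟨i, rfl⟩
  exact Ideal.pow_mem_of_mem _ hX _ (Fact.out : p.Prime).pos

/-- `J ^ a` consists of the power series of order at least `a`. -/
theorem mem_J𝔖_pow (a : ℕ) (f : 𝔖 p k r) : f ∈ J𝔖 p k r ^ a ↔ (a : ℕ∞) ≤ f.order := by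
  classical
  constructor
  · intro hf
    have h1 : ∀ g ∈ J𝔖 p k r, 1 ≤ g.order := by
      intro g hg
      refine Submodule.span_induction (p := fun g _ => 1 ≤ MvPowerSeries.order g) ?_ ?_ ?_ ?_ hg
      · rintro _ ⟨i, rfl⟩
        rw [MvPowerSeries.one_le_order_iff_constCoeff_eq_zero, MvPowerSeries.constantCoeff_X]
      · simp
      · exact fun x y _ _ hx hy => (le_min hx hy).trans MvPowerSeries.min_order_le_add
      · exact fun c x _ hx => (hx.trans le_add_self).trans MvPowerSeries.le_order_mul
    induction a generalizing f with
    | zero => simp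
    | succ a ih =>
      rw [pow_succ] at hf
      refine Submodule.mul_induction_on hf ?_ ?_
      · intro m hm n hn
        rw [Nat.cast_add, Nat.cast_one]
        exact (add_le_add (ih m hm) (h1 n hn)).trans MvPowerSeries.le_order_mul
      · exact fun x y hx hy => (le_min hx hy).trans MvPowerSeries.min_order_le_add
  · induction a generalizing f with
    | zero => simp
    | succ a ih =>
      intro hf
      have h0 : ∀ d : Fin r →₀ ℕ, MvPowerSeries.coeff d f ≠ 0 → ∃ i, d i ≠ 0 := by
        intro d hd
        by_contra! h
        have hd0 : d = 0 := Finsupp.ext h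
        have h2 := hf.trans (MvPowerSeries.order_le hd)
        rw [hd0, map_zero] at h2
        norm_cast at h2
      have h0' : ∃ c : (Fin r →₀ ℕ) → Option (Fin r), ∀ d, MvPowerSeries.coeff d f ≠ 0 →
          ∃ i, c d = some i ∧ d i ≠ 0 := by
        refine ⟨fun d => if h : ∃ i, d i ≠ 0 then some h.choose else none, fun d hd => ?_⟩
        exact ⟨(h0 d hd).choose, dif_pos (h0 d hd), (h0 d hd).choose_spec⟩
      obtain ⟨c, hc⟩ := h0'
      let g : Fin r → 𝔖 p k r := fun i d =>
        if c (d + Finsupp.single i 1) = some i then MvPowerSeries.coeff (d + Finsupp.single i 1) f else 0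
      have hg : ∀ i d, MvPowerSeries.coeff d (g i) =
        if c (d + Finsupp.single i 1) = some i then MvPowerSeries.coeff (d + Finsupp.single i 1) f
          else 0 := fun i d => rfl
      have hfg : f = ∑ i, g i * MvPowerSeries.X i := by
        ext1 d
        rw [map_sum]
        have h3 : ∀ i, MvPowerSeries.coeff d (g i * MvPowerSeries.X i) =
            if c d = some i then MvPowerSeries.coeff d f else 0 := by
          intro i
          rw [MvPowerSeries.X, MvPowerSeries.coeff_mul_monomial]
          by_cases hi : Finsupp.single i 1 ≤ d
          · rw [if_pos hi, hg, tsub_add_cancel_of_le hi, mul_one]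
          · rw [if_neg hi]
            split_ifs with h4
            · by_contra h5
              obtain ⟨j, hj, h6⟩ := hc d (Ne.symm h5)
              obtain rfl : i = j := Option.some_injective _ (h4.symm.trans hj)
              exact hi (Finsupp.single_le_iff.2 (Nat.one_le_iff_ne_zero.2 h6))
            · rfl
        rw [Finset.sum_congr rfl fun i _ => h3 i]
        by_cases hd : MvPowerSeries.coeff d f = 0
        · simp [hd]
        · obtain ⟨j, hj, -⟩ := hc d hd
          simp [hj]
      rw [hfg, pow_succ]
      refine Ideal.sum_mem _ fun i _ => Ideal.mul_mem_mul (ih _ ?_) (Ideal.subset_span ⟨i, rfl⟩)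
      refine MvPowerSeries.nat_le_order fun d hd => ?_
      rw [hg]
      split_ifs
      · refine MvPowerSeries.coeff_of_lt_order (lt_of_lt_of_le ?_ hf)
        rw [map_add, Finsupp.degree_single]
        exact_mod_cast Nat.add_lt_add_right hd 1
      · rfl

variable [CharP k p] [PerfectRing k p]

theorem frob𝔖_lift (a : 𝔖 p k r) : (p : 𝔖 p k r) ∣ frob𝔖 p k r a - a ^ p := by
  have hk : ∀ b : 𝔖 p k r, MvPowerSeries.map WittVector.constantCoeff b = 0 → (p : 𝔖 p k r) ∣ b := by
    intro b hb
    have h : ∀ n, ∃ c : WittVector p k, MvPowerSeries.coeff n b = p * c := by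
      intro n
      have h1 : MvPowerSeries.coeff n b ∈ RingHom.ker (WittVector.constantCoeff (p := p) (R := k)) := by
        rw [RingHom.mem_ker, ← MvPowerSeries.coeff_map, hb, map_zero]
      rwa [WittVector.ker_constantCoeff, Ideal.mem_span_singleton] at h1
    choose c hc using h
    let c' : 𝔖 p k r := c
    refine ⟨c', ?_⟩
    ext1 n
    rw [hc, ← map_natCast (MvPowerSeries.C (σ := Fin r) (R := WittVector p k)),
      MvPowerSeries.coeff_C_mul]
    rfl
  apply hk
  have h2 : (WittVector.constantCoeff (p := p) (R := k)).comp WittVector.frobenius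
      = (frobenius k p).comp WittVector.constantCoeff := by
    ext w
    simp [WittVector.constantCoeff_apply, WittVector.coeff_frobenius_charP, frobenius_def]
  have h3 := MvPowerSeries.map_frobenius_expand p (Fact.out : p.Prime).ne_zero
    (f := MvPowerSeries.map WittVector.constantCoeff a)
  rw [map_sub, map_pow, sub_eq_zero, ← h3]
  simp only [frob𝔖, RingHom.comp_apply, AlgHom.toRingHom_eq_coe, RingHom.coe_coe,
    MvPowerSeries.map_expand]
  congr 1
  rw [← RingHom.comp_apply, ← RingHom.comp_apply, ← MvPowerSeries.map_comp, ← MvPowerSeries.map_comp,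
    h2]

theorem natCast_p_mem_maximalIdeal_𝔖 : (p : 𝔖 p k r) ∈ IsLocalRing.maximalIdeal (𝔖 p k r) := by
  rw [IsLocalRing.mem_maximalIdeal, mem_nonunits_iff, MvPowerSeries.isUnit_iff_constantCoeff,
    map_natCast]
  exact (WittVector.irreducible p).not_isUnit

theorem E_mem_maximalIdeal (E : 𝔖 p k r) (hE : MvPowerSeries.constantCoeff E = p) :
    E ∈ IsLocalRing.maximalIdeal (𝔖 p k r) := by
  rw [IsLocalRing.mem_maximalIdeal, mem_nonunits_iff, MvPowerSeries.isUnit_iff_constantCoeff, hE]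
  exact (WittVector.irreducible p).not_isUnit

theorem E_mul_mem_J𝔖_pow (E : 𝔖 p k r) (hE : MvPowerSeries.constantCoeff E = p) (a : ℕ)
    (y : 𝔖 p k r) (hy : E * y ∈ J𝔖 p k r ^ a) : y ∈ J𝔖 p k r ^ a := by
  rw [mem_J𝔖_pow] at hy ⊢
  rw [MvPowerSeries.order_mul] at hy
  have h0 : E.order = 0 := by
    by_contra h
    rw [← ne_eq, MvPowerSeries.order_ne_zero_iff_constCoeff_eq_zero, hE] at h
    exact (WittVector.irreducible p (k := k)).ne_zero h
  rwa [h0, zero_add] at hy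

theorem E_mul_eq_zero (E : 𝔖 p k r) (hE : MvPowerSeries.constantCoeff E = p) (y : 𝔖 p k r)
    (hy : E * y = 0) : y = 0 := by
  refine (mul_eq_zero.1 hy).resolve_left ?_
  rintro rfl
  exact (WittVector.irreducible p (k := k)).ne_zero (by rw [← hE, map_zero])

/-- The frame `𝓑 = (𝔖, E𝔖, 𝔖 / E𝔖, σ, σ₁)` with `σ₁(Ey) = σ(y)`, for a power series `E` with
constant term `p`. -/
noncomputable def breuilFrame (E : 𝔖 p k r) (hE : MvPowerSeries.constantCoeff E = p) :
    Frame.{u} p :=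
  principalFrame p (𝔖 p k r) (frob𝔖 p k r) (frob𝔖_lift p k r) E (E_mul_eq_zero p k r E hE)
    (E_mem_maximalIdeal p k r E hE) (natCast_p_mem_maximalIdeal_𝔖 p k r)

/-- The ring `𝔖_a = 𝔖 / J ^ a`. -/
abbrev 𝔖trunc (p : ℕ) [Fact p.Prime] (k : Type u) [Field k] (r a : ℕ) : Type u :=
  𝔖 p k r ⧸ J𝔖 p k r ^ a

instance (a : ℕ) [NeZero a] : IsLocalRing (𝔖trunc p k r a) := by
  have hJ : J𝔖 p k r ^ a ≠ ⊤ := by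
    rw [Ne, Ideal.eq_top_iff_one, mem_J𝔖_pow, not_le]
    refine lt_of_le_of_lt (MvPowerSeries.order_le (d := 0) (by simp)) ?_
    simpa using Nat.pos_of_ne_zero (NeZero.ne a)
  have : Nontrivial (𝔖trunc p k r a) := Ideal.Quotient.nontrivial_iff.2 hJ
  exact IsLocalRing.of_surjective' (Ideal.Quotient.mk _) Ideal.Quotient.mk_surjective

theorem mk_mem_maximalIdeal_𝔖trunc (a : ℕ) [NeZero a] (x : 𝔖 p k r)
    (hx : x ∈ IsLocalRing.maximalIdeal (𝔖 p k r)) :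
    Ideal.Quotient.mk (J𝔖 p k r ^ a) x ∈ IsLocalRing.maximalIdeal (𝔖trunc p k r a) := by
  have := IsLocalHom.of_surjective (Ideal.Quotient.mk (J𝔖 p k r ^ a)) Ideal.Quotient.mk_surjective
  exact (IsLocalRing.mem_maximalIdeal _).2 ((map_mem_nonunits_iff _ _).2 hx)

/-- The endomorphism `σ_a` of `𝔖_a` induced by `σ`. -/
noncomputable def frob𝔖trunc (a : ℕ) : 𝔖trunc p k r a →+* 𝔖trunc p k r a :=
  Ideal.quotientMap _ (frob𝔖 p k r) (J𝔖_pow_le_comap p k r a)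

/-- The frame `𝓑_a = (𝔖_a, E𝔖_a, 𝔖_a / E𝔖_a, σ_a, σ_{1a})` with `σ_{1a}(Ey) = σ_a(y)`, for
`a ≥ 1`. -/
noncomputable def breuilFrameTrunc (E : 𝔖 p k r) (hE : MvPowerSeries.constantCoeff E = p)
    (a : ℕ) [NeZero a] : Frame.{u} p :=
  principalFrame p (𝔖trunc p k r a) (frob𝔖trunc p k r a)
    (by
      intro x
      obtain ⟨x, rfl⟩ := Ideal.Quotient.mk_surjective x
      have h := map_dvd (Ideal.Quotient.mk (J𝔖 p k r ^ a)) (frob𝔖_lift p k r x)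
      rwa [map_natCast, map_sub, map_pow] at h)
    (Ideal.Quotient.mk _ E)
    (by
      intro y hy
      obtain ⟨y, rfl⟩ := Ideal.Quotient.mk_surjective y
      rw [← map_mul, Ideal.Quotient.eq_zero_iff_mem] at hy
      exact Ideal.Quotient.eq_zero_iff_mem.2 (E_mul_mem_J𝔖_pow p k r E hE a y hy))
    (mk_mem_maximalIdeal_𝔖trunc p k r a E (E_mem_maximalIdeal p k r E hE))
    (by
      have h := mk_mem_maximalIdeal_𝔖trunc p k r a p (natCast_p_mem_maximalIdeal_𝔖 p k r)
      rwa [map_natCast] at h)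

end Breuil
end LauFrames

namespace LauFrames

/-! ### The homomorphism `δ : S → W(S)` attached to a Frobenius lift -/

section Cartier

variable (p : ℕ) [Fact p.Prime] {S : Type u} [CommRing S]

theorem ghostComponent_eq_sum (n : ℕ) (x : WittVector p S) :
    WittVector.ghostComponent n x =
      ∑ i ∈ Finset.range (n + 1), (p : S) ^ i * x.coeff i ^ p ^ (n - i) := by
  rw [WittVector.ghostComponent_apply, wittPolynomial_eq_sum_C_mul_X_pow]
  simp

theorem pow_mul_cancel (hS : ∀ x : S, (p : S) * x = 0 → x = 0) (n : ℕ) (x y : S)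
    (h : (p : S) ^ n * x = (p : S) ^ n * y) : x = y := by
  induction n with
  | zero => simpa using h
  | succ n ih =>
    refine ih (sub_eq_zero.1 (hS _ ?_))
    rw [mul_sub, ← mul_assoc, ← mul_assoc, ← pow_succ', h, sub_self]

theorem coeff_eq_of_ghost_eq (hS : ∀ x : S, (p : S) * x = 0 → x = 0) (n : ℕ) (x y : WittVector p S)
    (h : ∀ m < n, WittVector.ghostComponent m x = WittVector.ghostComponent m y) :
    ∀ m < n, x.coeff m = y.coeff m := by
  intro m
  induction m using Nat.strong_induction_on with
  | _ m ih =>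
    intro hm
    have h1 := h m hm
    rw [ghostComponent_eq_sum, ghostComponent_eq_sum, Finset.sum_range_succ, Finset.sum_range_succ,
      Finset.sum_congr rfl fun i hi => by
        rw [ih i (Finset.mem_range.1 hi) ((Finset.mem_range.1 hi).trans hm)]] at h1
    have h2 := add_left_cancel h1
    rw [Nat.sub_self, pow_zero, pow_one, pow_one] at h2
    exact pow_mul_cancel p hS m _ _ h2

theorem eq_of_ghost_eq (hS : ∀ x : S, (p : S) * x = 0 → x = 0) (x y : WittVector p S)
    (h : ∀ m, WittVector.ghostComponent m x = WittVector.ghostComponent m y) : x = y :=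
  WittVector.ext fun n => coeff_eq_of_ghost_eq p hS (n + 1) x y (fun m _ => h m) n n.lt_succ_self

theorem exists_ghost_eq (hS : ∀ x : S, (p : S) * x = 0 → x = 0) (σ : S →+* S)
    (hσ : ∀ a : S, (p : S) ∣ σ a - a ^ p) (s : S) :
    ∃ x : WittVector p S, ∀ n, WittVector.ghostComponent n x = σ^[n] s := by
  have key : ∀ n, ∃ x : WittVector p S, ∀ m < n, WittVector.ghostComponent m x = σ^[m] s := by
    intro n
    induction n with
    | zero => exact ⟨0, fun m hm => absurd hm m.not_lt_zero⟩
    | succ n ih =>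
      obtain ⟨x, hx⟩ := ih
      have hdiv : (p : S) ^ n ∣ σ^[n] s -
          ∑ i ∈ Finset.range n, (p : S) ^ i * x.coeff i ^ p ^ (n - i) := by
        cases n with
        | zero => simp
        | succ n =>
          rw [Function.iterate_succ_apply', ← hx n n.lt_succ_self, ghostComponent_eq_sum, map_sum,
            ← Finset.sum_sub_distrib]
          refine Finset.dvd_sum fun i hi => ?_
          have hi' : i ≤ n := Nat.lt_succ_iff.1 (Finset.mem_range.1 hi)
          rw [map_mul, map_pow, map_natCast, map_pow, ← mul_sub,
            show n + 1 = i + (n - i + 1) by omega, pow_add, show i + (n - i + 1) - i = (n - i) + 1 by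
              omega, pow_succ' p (n - i), pow_mul]
          exact mul_dvd_mul_left _ (dvd_sub_pow_of_dvd_sub (hσ _) _)
      obtain ⟨c, hc⟩ := hdiv
      refine ⟨WittVector.mk p fun i => if i = n then c else x.coeff i, fun m hm => ?_⟩
      rw [ghostComponent_eq_sum]
      rcases (Nat.lt_succ_iff.1 hm).lt_or_eq with hm' | rfl
      · rw [← hx m hm', ghostComponent_eq_sum]
        refine Finset.sum_congr rfl fun i hi => ?_
        have : i ≠ n := by have := Finset.mem_range.1 hi; omega
        rw [WittVector.coeff_mk, if_neg this]
      · rw [Finset.sum_range_succ, WittVector.coeff_mk, if_pos rfl, Nat.sub_self, pow_zero, pow_one,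
          ← hc]
        rw [Finset.sum_congr rfl fun i hi => by
          rw [if_neg (Finset.mem_range.1 hi).ne]]
        ring
  choose x hx using key
  refine ⟨WittVector.mk p fun i => (x (i + 1)).coeff i, fun n => ?_⟩
  rw [← hx (n + 1) n n.lt_succ_self, ghostComponent_eq_sum, ghostComponent_eq_sum]
  refine Finset.sum_congr rfl fun i hi => ?_
  have hi' := Finset.mem_range.1 hi
  rw [WittVector.coeff_mk, coeff_eq_of_ghost_eq p hS (i + 1) (x (i + 1)) (x (n + 1))
    (fun m hm => by rw [hx _ m hm, hx _ m (by omega)]) i i.lt_succ_self]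

/-- The ring homomorphism `δ : S → W(S)` with `w_n ∘ δ = σ ^ n` for all `n`, where `S` is a ring
without `p`-torsion and `σ` is a lift of the Frobenius of `S / pS`. -/
noncomputable def cartierHom (hS : ∀ x : S, (p : S) * x = 0 → x = 0) (σ : S →+* S)
    (hσ : ∀ a : S, (p : S) ∣ σ a - a ^ p) : S →+* WittVector p S :=
  have h := fun s => (exists_ghost_eq p hS σ hσ s).choose_spec
  { toFun := fun s => (exists_ghost_eq p hS σ hσ s).choose
    map_one' := eq_of_ghost_eq p hS _ _ fun m => by rw [h, map_one, iterate_map_one]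
    map_mul' := fun x y => eq_of_ghost_eq p hS _ _ fun m => by
      rw [h, map_mul, h, h, iterate_map_mul]
    map_zero' := eq_of_ghost_eq p hS _ _ fun m => by rw [h, map_zero, iterate_map_zero]
    map_add' := fun x y => eq_of_ghost_eq p hS _ _ fun m => by
      rw [h, map_add, h, h, iterate_map_add] }

theorem ghostComponent_cartierHom (hS : ∀ x : S, (p : S) * x = 0 → x = 0) (σ : S →+* S)
    (hσ : ∀ a : S, (p : S) ∣ σ a - a ^ p) (s : S) (n : ℕ) :
    WittVector.ghostComponent n (cartierHom p hS σ hσ s) = σ^[n] s :=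
  (exists_ghost_eq p hS σ hσ s).choose_spec n

end Cartier

end LauFrames

namespace LauFrames

section Breuil

variable (p : ℕ) [Fact p.Prime] (k : Type u) [Field k] [CharP k p] [PerfectRing k p] (r : ℕ)

theorem 𝔖_torsionFree (x : 𝔖 p k r) (hx : (p : 𝔖 p k r) * x = 0) : x = 0 :=
  E_mul_eq_zero p k r p (map_natCast _ _) x hx

/-- The homomorphism `δ : 𝔖 → W(𝔖)` with `w_n ∘ δ = σ ^ n`. -/
noncomputable def δ𝔖 : 𝔖 p k r →+* WittVector p (𝔖 p k r) :=
  cartierHom p (𝔖_torsionFree p k r) (frob𝔖 p k r) (frob𝔖_lift p k r)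

theorem ghostComponent_δ𝔖 (s : 𝔖 p k r) (n : ℕ) :
    WittVector.ghostComponent n (δ𝔖 p k r s) = (frob𝔖 p k r)^[n] s :=
  ghostComponent_cartierHom p _ _ _ s n

end Breuil

end LauFrames

namespace LauFrames

/-! ### Ideals of Witt vectors defined by conditions on the coefficients -/

section Coefficients

theorem coeff_mul_teichmuller (p : ℕ) [Fact p.Prime] {A : Type u} [CommRing A] (x : WittVector p A)
    (a : A) (n : ℕ) : (x * WittVector.teichmuller p a).coeff n = x.coeff n * a ^ p ^ n := by
  let B := MvPolynomial (Option ℕ) ℤ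
  have hB : ∀ b : B, (p : B) * b = 0 → b = 0 := fun b hb =>
    (mul_eq_zero.1 hb).resolve_left (Nat.cast_ne_zero.2 (Fact.out : p.Prime).ne_zero)
  let X : WittVector p B := WittVector.mk p fun n => MvPolynomial.X (some n)
  let Y : WittVector p B :=
    WittVector.mk p fun n => MvPolynomial.X (some n) * MvPolynomial.X none ^ p ^ n
  have hXY : X * WittVector.teichmuller p (MvPolynomial.X none) = Y := by
    refine eq_of_ghost_eq p hB _ _ fun m => ?_
    rw [map_mul, WittVector.ghostComponent_teichmuller, ghostComponent_eq_sum,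
      ghostComponent_eq_sum, Finset.sum_mul]
    refine Finset.sum_congr rfl fun i hi => ?_
    have hi' := Finset.mem_range.1 hi
    simp only [X, Y, WittVector.coeff_mk]
    rw [mul_pow, ← pow_mul, ← pow_add, Nat.add_sub_cancel' (by omega), mul_assoc]
  let φ : B →+* A := (MvPolynomial.aeval fun o : Option ℕ => o.elim a x.coeff).toRingHom
  have hφ : ∀ o, φ (MvPolynomial.X o) = o.elim a x.coeff := fun o => MvPolynomial.aeval_X _ _
  have hX : WittVector.map φ X = x := by
    ext n
    rw [WittVector.map_coeff, WittVector.coeff_mk, hφ]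
    rfl
  have h := congrArg (fun z => (WittVector.map φ z).coeff n) hXY
  simp only [map_mul, hX, WittVector.map_teichmuller, WittVector.map_coeff, hφ, Y,
    WittVector.coeff_mk, map_pow] at h
  exact h

theorem map_frobenius (p : ℕ) [Fact p.Prime] {A B : Type u} [CommRing A] [CommRing B] (φ : A →+* B)
    (x : WittVector p A) :
    WittVector.map φ (WittVector.frobenius x) = WittVector.frobenius (WittVector.map φ x) :=
  WittVector.IsPoly.map (WittVector.frobenius_isPoly p) φ x

theorem frobenius_teichmuller (p : ℕ) [Fact p.Prime] {A : Type u} [CommRing A] (a : A) :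
    WittVector.frobenius (WittVector.teichmuller p a) = WittVector.teichmuller p (a ^ p) := by
  let B := MvPolynomial (ULift.{u} Unit) ℤ
  have hB : ∀ b : B, (p : B) * b = 0 → b = 0 := fun b hb =>
    (mul_eq_zero.1 hb).resolve_left (Nat.cast_ne_zero.2 (Fact.out : p.Prime).ne_zero)
  have h : WittVector.frobenius (WittVector.teichmuller p (MvPolynomial.X ⟨()⟩ : B)) =
      WittVector.teichmuller p (MvPolynomial.X ⟨()⟩ ^ p) := by
    refine eq_of_ghost_eq p hB _ _ fun m => ?_
    rw [WittVector.ghostComponent_frobenius, WittVector.ghostComponent_teichmuller,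
      WittVector.ghostComponent_teichmuller, ← pow_mul, pow_succ']
  let φ : B →+* A := (MvPolynomial.aeval fun _ => a).toRingHom
  have hφ : φ (MvPolynomial.X ⟨()⟩) = a := MvPolynomial.aeval_X _ _
  have h1 := congrArg (WittVector.map φ) h
  rwa [map_frobenius, WittVector.map_teichmuller, WittVector.map_teichmuller, map_pow, hφ] at h1

variable {R : Type u} [CommRing R]

/-- For a multiplicative filtration `K` of `R`, the ring of polynomials with `j`-th coefficient in
`K j` for all `j`. -/
def reesSubring (K : ℕ → Ideal R) (h0 : K 0 = ⊤) (hmul : ∀ i j, K i * K j ≤ K (i + j)) :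
    Subring (Polynomial R) where
  carrier := {f | ∀ j, f.coeff j ∈ K j}
  zero_mem' := by simp
  one_mem' := fun j => by
    rw [Polynomial.coeff_one]
    split_ifs with h
    · rw [h, h0]; trivial
    · exact zero_mem _
  add_mem' := fun hf hg j => by
    rw [Polynomial.coeff_add]; exact add_mem (hf j) (hg j)
  neg_mem' := fun hf j => by
    rw [Polynomial.coeff_neg]; exact neg_mem (hf j)
  mul_mem' := fun {f g} hf hg j => by
    rw [Polynomial.coeff_mul]
    refine Ideal.sum_mem _ fun x hx => ?_
    rw [← Finset.HasAntidiagonal.mem_antidiagonal.1 hx]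
    exact hmul _ _ (Ideal.mul_mem_mul (hf _) (hg _))

variable (p : ℕ) [Fact p.Prime]

theorem mem_range_map_iff {A : Type u} [CommRing A] (B : Subring A) (x : WittVector p A) :
    x ∈ (WittVector.map (p := p) B.subtype).range ↔ ∀ n, x.coeff n ∈ B := by
  constructor
  · rintro ⟨y, rfl⟩ n
    rw [WittVector.map_coeff]
    exact (y.coeff n).2
  · intro h
    refine ⟨WittVector.mk p fun n => ⟨x.coeff n, h n⟩, ?_⟩
    ext n
    simp

/-- The Witt vector `[t] x` over the polynomial ring. -/
noncomputable def reesWitt (x : WittVector p R) : WittVector p (Polynomial R) :=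
  WittVector.map Polynomial.C x * WittVector.teichmuller p Polynomial.X

theorem reesWitt_mem_iff (K : ℕ → Ideal R) (h0 : K 0 = ⊤)
    (hmul : ∀ i j, K i * K j ≤ K (i + j)) (x : WittVector p R) :
    reesWitt p x ∈ (WittVector.map (p := p) (reesSubring K h0 hmul).subtype).range ↔
      ∀ n, x.coeff n ∈ K (p ^ n) := by
  rw [mem_range_map_iff]
  refine forall_congr' fun n => ?_
  rw [reesWitt, coeff_mul_teichmuller, WittVector.map_coeff]
  change (∀ j, _) ↔ _
  simp only [Polynomial.coeff_C_mul_X_pow]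
  constructor
  · intro h
    simpa using h (p ^ n)
  · intro h j
    split_ifs with hj
    · rw [hj]; exact h
    · exact zero_mem _

theorem map_C_mem (K : ℕ → Ideal R) (h0 : K 0 = ⊤)
    (hmul : ∀ i j, K i * K j ≤ K (i + j)) (x : WittVector p R) :
    WittVector.map Polynomial.C x ∈
      (WittVector.map (p := p) (reesSubring K h0 hmul).subtype).range := by
  rw [mem_range_map_iff]
  intro n j
  rw [WittVector.map_coeff, Polynomial.coeff_C]
  split_ifs with hj
  · rw [hj, h0]; trivial
  · exact zero_mem _

theorem coeff_add_mem (K : ℕ → Ideal R) (h0 : K 0 = ⊤)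
    (hmul : ∀ i j, K i * K j ≤ K (i + j)) (x y : WittVector p R) (hx : ∀ n, x.coeff n ∈ K (p ^ n))
    (hy : ∀ n, y.coeff n ∈ K (p ^ n)) (n : ℕ) : (x + y).coeff n ∈ K (p ^ n) := by
  revert n
  rw [← reesWitt_mem_iff p K h0 hmul] at hx hy ⊢
  rw [reesWitt, map_add, add_mul]
  exact add_mem hx hy

theorem coeff_mul_mem (K : ℕ → Ideal R) (h0 : K 0 = ⊤)
    (hmul : ∀ i j, K i * K j ≤ K (i + j)) (c x : WittVector p R) (hx : ∀ n, x.coeff n ∈ K (p ^ n)) (n : ℕ) :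
    (c * x).coeff n ∈ K (p ^ n) := by
  revert n
  rw [← reesWitt_mem_iff p K h0 hmul] at hx ⊢
  rw [reesWitt, map_mul, mul_assoc]
  exact mul_mem (map_C_mem p K h0 hmul c) hx

theorem coeff_frobenius_mem (K : ℕ → Ideal R) (h0 : K 0 = ⊤)
    (hmul : ∀ i j, K i * K j ≤ K (i + j)) (x : WittVector p R) (hx : ∀ n, x.coeff n ∈ K (p ^ n)) (n : ℕ) :
    (WittVector.frobenius x).coeff n ∈ K (p ^ (n + 1)) := by
  rw [← reesWitt_mem_iff p K h0 hmul] at hx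
  obtain ⟨y, hy⟩ := hx
  have h1 : WittVector.frobenius (reesWitt p x) ∈
      (WittVector.map (p := p) (reesSubring K h0 hmul).subtype).range :=
    ⟨WittVector.frobenius y, by rw [← hy, map_frobenius]⟩
  rw [mem_range_map_iff] at h1
  have h2 := h1 n (p ^ (n + 1))
  rw [reesWitt, map_mul, ← map_frobenius, frobenius_teichmuller, coeff_mul_teichmuller,
    WittVector.map_coeff, ← pow_mul, ← pow_succ', Polynomial.coeff_C_mul_X_pow, if_pos rfl] at h2
  exact h2

end Coefficients

end LauFrames

namespace LauFrames

/-! ### The ring `𝕎(R)` -/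

open IsLocalRing

section Zink

variable (p : ℕ) [Fact p.Prime] (R : Type u) [CommRing R] [IsLocalRing R]

/-- The set underlying the ideal `Ŵ(𝔪)`. -/
def nullCoeffs : Set (WittVector p R) :=
  {x | (∀ n, x.coeff n ∈ maximalIdeal R) ∧
    ∀ N, ∃ M, ∀ n, M ≤ n → x.coeff n ∈ maximalIdeal R ^ N}

/-- An auxiliary multiplicative filtration by powers of the maximal ideal. -/
def auxFilt (q N j : ℕ) : Ideal R := maximalIdeal R ^ min N (j ⌈/⌉ q)

theorem auxFilt_zero (q N : ℕ) : auxFilt R q N 0 = ⊤ := by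
  simp [auxFilt]

theorem auxFilt_mul (q N : ℕ) (hq : 0 < q) (i j : ℕ) :
    auxFilt R q N i * auxFilt R q N j ≤ auxFilt R q N (i + j) := by
  rw [auxFilt, auxFilt, auxFilt, ← pow_add]
  refine Ideal.pow_le_pow_right ?_
  have h : (i + j) ⌈/⌉ q ≤ i ⌈/⌉ q + j ⌈/⌉ q := by
    rw [ceilDiv_le_iff_le_mul hq, mul_add]
    exact add_le_add (le_smul_ceilDiv hq) (le_smul_ceilDiv hq)
  omega

theorem auxFilt_anti (q N : ℕ) (hq : 0 < q) (i j : ℕ) (hij : i ≤ j) :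
    auxFilt R q N j ≤ auxFilt R q N i := by
  refine Ideal.pow_le_pow_right ?_
  have h : i ⌈/⌉ q ≤ j ⌈/⌉ q := (gc_mul_ceilDiv hq).monotone_l hij
  omega

theorem mem_nullCoeffs_iff (x : WittVector p R) :
    x ∈ nullCoeffs p R ↔ ∀ N, ∃ M₀, ∀ M, M₀ ≤ M → ∀ n, x.coeff n ∈ auxFilt R (p ^ M) N (p ^ n) := by
  have hp : 0 < p := (Fact.out : p.Prime).pos
  constructor
  · rintro ⟨h1, h2⟩ N
    obtain ⟨M₀, hM₀⟩ := h2 N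
    refine ⟨M₀, fun M hM n => ?_⟩
    by_cases hn : M ≤ n
    · exact Ideal.pow_le_pow_right (min_le_left _ _) (hM₀ n (hM.trans hn))
    · have h3 : p ^ n ⌈/⌉ p ^ M ≤ 1 := by
        rw [ceilDiv_le_iff_le_mul (pow_pos hp M), mul_one]
        exact Nat.pow_le_pow_right hp (by omega)
      have h4 : maximalIdeal R ^ 1 ≤ auxFilt R (p ^ M) N (p ^ n) :=
        Ideal.pow_le_pow_right ((min_le_right _ _).trans h3)
      exact h4 (by rw [pow_one]; exact h1 n)
  · intro h
    have h5 : ∀ M n, 1 ≤ p ^ n ⌈/⌉ p ^ M := by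
      intro M n
      by_contra h6
      have h7 : p ^ n ⌈/⌉ p ^ M ≤ 0 := by omega
      rw [ceilDiv_le_iff_le_mul (pow_pos hp M), mul_zero] at h7
      exact absurd (pow_pos hp n) (by omega)
    constructor
    · intro n
      obtain ⟨M, hM⟩ := h 1
      have h6 := hM M le_rfl n
      rwa [auxFilt, min_eq_left (h5 M n), pow_one] at h6
    · intro N
      obtain ⟨M, hM⟩ := h N
      refine ⟨M + N, fun n hn => ?_⟩
      have h6 := hM M le_rfl n
      have h7 : N ≤ p ^ n ⌈/⌉ p ^ M := by
        by_contra h8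
        have h9 : p ^ n ⌈/⌉ p ^ M ≤ N - 1 := by omega
        rw [ceilDiv_le_iff_le_mul (pow_pos hp M)] at h9
        have h10 : p ^ M * p ^ N ≤ p ^ M * (N - 1) := by
          rw [← pow_add]
          exact (Nat.pow_le_pow_right hp hn).trans h9
        have h11 := Nat.le_of_mul_le_mul_left h10 (pow_pos hp M)
        have h12 : N < p ^ N := Nat.lt_pow_self (Fact.out : p.Prime).one_lt
        omega
      rwa [auxFilt, min_eq_left h7] at h6

/-- The ideal `Ŵ(𝔪)` of `W(R)`: Witt vectors with coefficients in the maximal ideal `𝔪` which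
converge to zero `𝔪`-adically. -/
def hatW : Ideal (WittVector p R) where
  carrier := nullCoeffs p R
  zero_mem' := by
    simp [nullCoeffs]
  add_mem' := by
    intro x y hx hy
    rw [mem_nullCoeffs_iff] at hx hy ⊢
    intro N
    obtain ⟨M₁, h₁⟩ := hx N
    obtain ⟨M₂, h₂⟩ := hy N
    refine ⟨max M₁ M₂, fun M hM n => ?_⟩
    exact coeff_add_mem p _ (auxFilt_zero R _ N)
      (auxFilt_mul R _ N (pow_pos (Fact.out : p.Prime).pos M)) x y
      (h₁ M ((le_max_left _ _).trans hM)) (h₂ M ((le_max_right _ _).trans hM)) n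
  smul_mem' := by
    intro c x hx
    rw [mem_nullCoeffs_iff] at hx ⊢
    intro N
    obtain ⟨M₁, h₁⟩ := hx N
    refine ⟨M₁, fun M hM n => ?_⟩
    exact coeff_mul_mem p _ (auxFilt_zero R _ N)
      (auxFilt_mul R _ N (pow_pos (Fact.out : p.Prime).pos M)) c x (h₁ M hM) n

variable {R}

theorem mem_hatW_iff (x : WittVector p R) :
    x ∈ hatW p R ↔ (∀ n, x.coeff n ∈ maximalIdeal R) ∧
      ∀ N, ∃ M, ∀ n, M ≤ n → x.coeff n ∈ maximalIdeal R ^ N := Iff.rfl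

theorem frobenius_mem_hatW (x : WittVector p R) (hx : x ∈ hatW p R) :
    WittVector.frobenius x ∈ hatW p R := by
  have hp : 0 < p := (Fact.out : p.Prime).pos
  refine (mem_nullCoeffs_iff p R _).2 fun N => ?_
  obtain ⟨M₁, h₁⟩ := (mem_nullCoeffs_iff p R _).1 hx N
  refine ⟨M₁, fun M hM n => ?_⟩
  refine auxFilt_anti R _ N (pow_pos hp M) _ _ (Nat.pow_le_pow_right hp n.le_succ) ?_
  exact coeff_frobenius_mem p _ (auxFilt_zero R _ N) (auxFilt_mul R _ N (pow_pos hp M)) x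
    (h₁ M hM) n

theorem verschiebung_mem_hatW_iff (x : WittVector p R) :
    WittVector.verschiebung x ∈ hatW p R ↔ x ∈ hatW p R := by
  rw [mem_hatW_iff, mem_hatW_iff]
  constructor
  · rintro ⟨h1, h2⟩
    refine ⟨fun n => by simpa using h1 (n + 1), fun N => ?_⟩
    obtain ⟨M, hM⟩ := h2 N
    exact ⟨M, fun n hn => by simpa using hM (n + 1) (by omega)⟩
  · rintro ⟨h1, h2⟩
    refine ⟨fun n => ?_, fun N => ?_⟩
    · cases n with
      | zero => simp
      | succ n => simpa using h1 n
    · obtain ⟨M, hM⟩ := h2 N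
      refine ⟨M + 1, fun n hn => ?_⟩
      cases n with
      | zero => omega
      | succ n => simpa using hM n (by omega)

variable (R)

/-- The subring of `W(R)` of all elements which admit a compatible sequence of iterated preimages
under the Frobenius `f`. When `R` is complete with perfect residue field `k` of characteristic
`p`, the projection to `W(k)` maps it isomorphically onto `W(k)`; thus it is the image of the
unique section of `W(R) → W(k)` which commutes with `f`. -/
def frobPerfect : Subring (WittVector p R) where
  carrier := {z | ∃ c : ℕ → WittVector p R, c 0 = z ∧ ∀ n, WittVector.frobenius (c (n + 1)) = c n}
  zero_mem' := ⟨fun _ => 0, rfl, fun _ => map_zero _⟩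
  one_mem' := ⟨fun _ => 1, rfl, fun _ => map_one _⟩
  add_mem' := by
    rintro _ _ ⟨c, rfl, hc⟩ ⟨d, rfl, hd⟩
    exact ⟨fun n => c n + d n, rfl, fun n => by rw [map_add, hc, hd]⟩
  neg_mem' := by
    rintro _ ⟨c, rfl, hc⟩
    exact ⟨fun n => -c n, rfl, fun n => by rw [map_neg, hc]⟩
  mul_mem' := by
    rintro _ _ ⟨c, rfl, hc⟩ ⟨d, rfl, hd⟩
    exact ⟨fun n => c n * d n, rfl, fun n => by rw [map_mul, hc, hd]⟩

/-- The ring `𝕎(R) ⊆ W(R)`, for a complete local ring `R` with perfect residue field `k` of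
characteristic `p`: the sum of `Ŵ(𝔪)` and of the image of `W(k)` under the section of
`W(R) → W(k)` that commutes with `f`. By `existsUnique_zinkRing` below, it is the unique
`f`-stable subring of `W(R)` whose projection to `W(k)` is surjective with kernel `Ŵ(𝔪)`. -/
def zinkRing : Subring (WittVector p R) where
  carrier := {x | ∃ z ∈ frobPerfect p R, x - z ∈ hatW p R}
  zero_mem' := ⟨0, zero_mem _, by simp⟩
  one_mem' := ⟨1, one_mem _, by simp⟩
  add_mem' := by
    rintro x y ⟨z, hz, hx⟩ ⟨w, hw, hy⟩
    exact ⟨z + w, add_mem hz hw, by rw [add_sub_add_comm]; exact add_mem hx hy⟩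
  neg_mem' := by
    rintro x ⟨z, hz, hx⟩
    exact ⟨-z, neg_mem hz, by rw [neg_sub_neg, ← neg_sub]; exact neg_mem hx⟩
  mul_mem' := by
    rintro x y ⟨z, hz, hx⟩ ⟨w, hw, hy⟩
    refine ⟨z * w, mul_mem hz hw, ?_⟩
    rw [show x * y - z * w = y * (x - z) + z * (y - w) by ring]
    exact add_mem (Ideal.mul_mem_left _ _ hx) (Ideal.mul_mem_left _ _ hy)

variable {R}

theorem frobPerfect_le_zinkRing : frobPerfect p R ≤ zinkRing p R :=
  fun z hz => ⟨z, hz, by simp⟩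

theorem hatW_le_zinkRing (x : WittVector p R) (hx : x ∈ hatW p R) : x ∈ zinkRing p R :=
  ⟨0, zero_mem _, by simpa using hx⟩

theorem frobenius_mem_frobPerfect (x : WittVector p R) (hx : x ∈ frobPerfect p R) :
    WittVector.frobenius x ∈ frobPerfect p R := by
  obtain ⟨c, rfl, hc⟩ := hx
  exact ⟨fun n => WittVector.frobenius (c n), rfl, fun n => congrArg _ (hc n)⟩

theorem frobenius_mem_zinkRing (x : WittVector p R) (hx : x ∈ zinkRing p R) :
    WittVector.frobenius x ∈ zinkRing p R := by
  obtain ⟨z, hz, hx⟩ := hx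
  exact ⟨_, frobenius_mem_frobPerfect p z hz, by
    rw [← map_sub]; exact frobenius_mem_hatW p _ hx⟩

/-- The projection `W(R) → W(k)` to the Witt vectors of the residue field. -/
noncomputable def toResidue : WittVector p R →+* WittVector p (ResidueField R) :=
  WittVector.map (residue R)

theorem toResidue_eq_zero_of_mem_hatW (x : WittVector p R) (hx : x ∈ hatW p R) :
    toResidue p x = 0 := by
  ext n
  rw [toResidue, WittVector.map_coeff, WittVector.zero_coeff, residue_eq_zero_iff]
  exact hx.1 n

/-- The ideal `W(𝔪 ^ n)` of `W(R)`. -/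
noncomputable def powW (n : ℕ) : Ideal (WittVector p R) :=
  RingHom.ker (WittVector.map (p := p) (Ideal.Quotient.mk (maximalIdeal R ^ n)))

theorem mem_powW_iff (n : ℕ) (x : WittVector p R) :
    x ∈ powW p n ↔ ∀ i, x.coeff i ∈ maximalIdeal R ^ n := by
  rw [powW, RingHom.mem_ker, WittVector.ext_iff]
  refine forall_congr' fun i => ?_
  rw [WittVector.map_coeff, WittVector.zero_coeff, Ideal.Quotient.eq_zero_iff_mem]

theorem sub_mem_powW_iff (n : ℕ) (x y : WittVector p R) :
    x - y ∈ powW p n ↔ ∀ i, x.coeff i - y.coeff i ∈ maximalIdeal R ^ n := by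
  rw [powW, RingHom.mem_ker, map_sub, sub_eq_zero, WittVector.ext_iff]
  refine forall_congr' fun i => ?_
  rw [WittVector.map_coeff, WittVector.map_coeff, Ideal.Quotient.eq]

theorem mem_powW_one_iff (x : WittVector p R) : x ∈ powW p 1 ↔ toResidue p x = 0 := by
  rw [mem_powW_iff, WittVector.ext_iff]
  refine forall_congr' fun i => ?_
  rw [toResidue, WittVector.map_coeff, WittVector.zero_coeff, residue_eq_zero_iff, pow_one]

theorem powW_anti (m n : ℕ) (h : m ≤ n) : powW p n ≤ powW p (R := R) m := by
  intro x hx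
  rw [mem_powW_iff] at hx ⊢
  exact fun i => Ideal.pow_le_pow_right h (hx i)

variable [CharP (ResidueField R) p]

theorem natCast_p_mem : (p : R) ∈ maximalIdeal R := by
  rw [← residue_eq_zero_iff, map_natCast, CharP.cast_eq_zero]

theorem frobenius_mem_powW (n : ℕ) (x : WittVector p R) (hx : x ∈ powW p n) (hn : n ≠ 0) :
    WittVector.frobenius x ∈ powW p (n + 1) := by
  rw [mem_powW_iff] at hx ⊢
  intro i
  rw [WittVector.coeff_frobenius, WittVector.frobeniusPoly, map_add, map_pow, map_mul,
    MvPolynomial.aeval_X, MvPolynomial.aeval_C]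
  have hc : MvPolynomial.constantCoeff (WittVector.frobeniusPolyAux p i) = 0 := by
    have h1 : (WittVector.frobenius (0 : WittVector p ℤ)).coeff i = 0 := by
      rw [map_zero, WittVector.zero_coeff]
    rw [WittVector.coeff_frobenius, WittVector.frobeniusPoly, map_add, map_pow, map_mul,
      MvPolynomial.aeval_X, MvPolynomial.aeval_C, WittVector.zero_coeff,
      zero_pow (Fact.out : p.Prime).ne_zero, zero_add] at h1
    have h2 : (0 : WittVector p ℤ).coeff = 0 := funext fun n => WittVector.zero_coeff p ℤ n
    rw [h2, MvPolynomial.aeval_zero] at h1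
    have hp : (p : ℤ) ≠ 0 := Nat.cast_ne_zero.2 (Fact.out : p.Prime).ne_zero
    exact (mul_eq_zero.1 h1).resolve_left (by simpa using hp)
  have ha : MvPolynomial.aeval x.coeff (WittVector.frobeniusPolyAux p i) ∈ maximalIdeal R ^ n := by
    have h3 : (Ideal.Quotient.mkₐ ℤ (maximalIdeal R ^ n)).comp (MvPolynomial.aeval x.coeff) =
        MvPolynomial.aeval 0 := by
      ext j
      simpa using Ideal.Quotient.eq_zero_iff_mem.2 (hx j)
    have h4 := DFunLike.congr_fun h3 (WittVector.frobeniusPolyAux p i)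
    rw [MvPolynomial.aeval_zero, hc, map_zero] at h4
    exact Ideal.Quotient.eq_zero_iff_mem.1 h4
  refine add_mem ?_ ?_
  · obtain ⟨q, hq⟩ : ∃ q, p = q + 2 := ⟨p - 2, by have := (Fact.out : p.Prime).two_le; omega⟩
    have h3 := Ideal.pow_mem_pow (hx i) p
    rw [← pow_mul] at h3
    refine Ideal.pow_le_pow_right ?_ h3
    rw [hq, mul_add]
    have : 1 ≤ n := Nat.one_le_iff_ne_zero.2 hn
    nlinarith
  · rw [pow_succ']
    refine Ideal.mul_mem_mul ?_ ha
    simpa using natCast_p_mem p (R := R)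

theorem iterate_frobenius_mem_powW (n : ℕ) (x : WittVector p R) (hx : x ∈ powW p 1) :
    WittVector.frobenius^[n] x ∈ powW p (n + 1) := by
  induction n with
  | zero => exact hx
  | succ n ih =>
    rw [Function.iterate_succ_apply']
    exact frobenius_mem_powW p _ _ ih n.succ_ne_zero

end Zink

end LauFrames

namespace LauFrames

open IsLocalRing

section ZinkComplete

variable (p : ℕ) [Fact p.Prime] {R : Type u} [CommRing R] [IsLocalRing R]
  [IsAdicComplete (maximalIdeal R) R]

theorem eq_zero_of_forall_mem_powW (x : WittVector p R) (h : ∀ n, x ∈ powW p n) : x = 0 := by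
  ext i
  rw [WittVector.zero_coeff]
  refine IsHausdorff.haus (I := maximalIdeal R) inferInstance _ fun n => ?_
  rw [SModEq.zero, smul_eq_mul, Ideal.mul_top]
  exact (mem_powW_iff p n x).1 (h n) i

theorem exists_limit (a : ℕ → WittVector p R) (ha : ∀ n, a (n + 1) - a n ∈ powW p n) :
    ∃ L : WittVector p R, ∀ n, L - a n ∈ powW p n := by
  have hmono : ∀ m n, m ≤ n → a n - a m ∈ powW p m := by
    intro m n hmn
    induction n, hmn using Nat.le_induction with
    | base => simp
    | succ n hmn ih =>
      rw [← sub_add_sub_cancel (a (n + 1)) (a n) (a m)]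
      exact add_mem (powW_anti p m n hmn (ha n)) ih
  have hL : ∀ i, ∃ l : R, ∀ n, l - (a n).coeff i ∈ maximalIdeal R ^ n := by
    intro i
    obtain ⟨l, hl⟩ := IsPrecomplete.prec (I := maximalIdeal R) inferInstance
      (f := fun n => (a n).coeff i) (by
        intro m n hmn
        rw [SModEq.comm, SModEq.sub_mem, smul_eq_mul, Ideal.mul_top]
        exact (sub_mem_powW_iff p m _ _).1 (hmono m n hmn) i)
    refine ⟨l, fun n => ?_⟩
    have h := hl n
    rwa [SModEq.comm, SModEq.sub_mem, smul_eq_mul, Ideal.mul_top] at h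
  choose l hl using hL
  exact ⟨WittVector.mk p l, fun n => (sub_mem_powW_iff p n _ _).2 fun i => by
    rw [WittVector.coeff_mk]; exact hl i n⟩

variable [CharP (ResidueField R) p]

theorem eq_zero_of_mem_frobPerfect (z : WittVector p R) (hz : z ∈ frobPerfect p R)
    (h : toResidue p z = 0) : z = 0 := by
  obtain ⟨c, rfl, hc⟩ := hz
  have hit : ∀ n, WittVector.frobenius^[n] (c n) = c 0 := by
    intro n
    induction n with
    | zero => rfl
    | succ n ih => rw [Function.iterate_succ_apply, hc, ih]
  have hres : ∀ n, toResidue p (c n) = 0 := by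
    intro n
    induction n with
    | zero => exact h
    | succ n ih =>
      rw [← hc, toResidue, map_frobenius] at ih
      ext i
      have h1 := congrArg (fun w => w.coeff i) ih
      simp only [WittVector.coeff_frobenius_charP, WittVector.zero_coeff] at h1
      rw [WittVector.zero_coeff]
      exact pow_eq_zero_iff (Fact.out : p.Prime).ne_zero |>.1 h1
  refine eq_zero_of_forall_mem_powW p _ fun n => ?_
  rw [← hit n]
  exact powW_anti p _ _ n.le_succ
    (iterate_frobenius_mem_powW p n _ ((mem_powW_one_iff p _).2 (hres n)))

theorem mem_zinkRing_toResidue_eq_zero_iff (x : WittVector p R) :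
    x ∈ zinkRing p R ∧ toResidue p x = 0 ↔ x ∈ hatW p R := by
  constructor
  · rintro ⟨⟨z, hz, hx⟩, h⟩
    have h1 := toResidue_eq_zero_of_mem_hatW p _ hx
    rw [map_sub, h, zero_sub, neg_eq_zero] at h1
    rwa [eq_zero_of_mem_frobPerfect p z hz h1, sub_zero] at hx
  · exact fun h => ⟨hatW_le_zinkRing p x h, toResidue_eq_zero_of_mem_hatW p x h⟩

variable [PerfectRing (ResidueField R) p]

theorem exists_frobPerfect_lift (y : WittVector p (ResidueField R)) :
    ∃ z ∈ frobPerfect p R, toResidue p z = y := by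
  let φ := WittVector.frobeniusEquiv p (ResidueField R)
  have hφ : ∀ w, WittVector.frobenius (φ.symm w) = w := fun w => φ.apply_symm_apply w
  have hsurj : Function.Surjective (toResidue p (R := R)) :=
    WittVector.map_surjective _ residue_surjective
  choose c hc using fun n => hsurj (φ.symm^[n] y)
  have hstep : ∀ n, WittVector.frobenius (c (n + 1)) - c n ∈ powW p 1 := by
    intro n
    rw [mem_powW_one_iff, map_sub, hc, sub_eq_zero, toResidue, map_frobenius, ← toResidue, hc,
      Function.iterate_succ_apply', hφ]
  have hit : ∀ (n : ℕ) (u v : WittVector p R), WittVector.frobenius^[n] (u - v) =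
      WittVector.frobenius^[n] u - WittVector.frobenius^[n] v := fun n u v => iterate_map_sub _ n u v
  choose L hL using fun j => exists_limit p (fun n => WittVector.frobenius^[n] (c (n + j))) (by
    intro n
    rw [Function.iterate_succ_apply, ← hit]
    refine powW_anti p _ _ n.le_succ (iterate_frobenius_mem_powW p n _ ?_)
    rw [Nat.add_right_comm]
    exact hstep (n + j))
  refine ⟨L 0, ⟨L, rfl, fun j => ?_⟩, ?_⟩
  · refine sub_eq_zero.1 (eq_zero_of_forall_mem_powW p _ fun n => ?_)
    have h1 : WittVector.frobenius (L (j + 1)) -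
        WittVector.frobenius (WittVector.frobenius^[n] (c (n + (j + 1)))) ∈ powW p n := by
      rw [← map_sub]
      cases n with
      | zero => simp [mem_powW_iff]
      | succ n =>
        exact powW_anti p _ _ (Nat.le_succ _)
          (frobenius_mem_powW p _ _ (hL (j + 1) (n + 1)) n.succ_ne_zero)
    have h2 := powW_anti p _ _ n.le_succ (hL j (n + 1))
    rw [← Function.iterate_succ_apply' (⇑WittVector.frobenius), ← add_assoc] at h1
    rw [Nat.add_right_comm] at h2
    have h3 := sub_mem h1 h2
    rwa [sub_sub_sub_cancel_right] at h3
  · have h1 := hL 0 1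
    rw [mem_powW_one_iff, map_sub, sub_eq_zero] at h1
    rw [h1, Function.iterate_one, toResidue, map_frobenius, ← toResidue, hc, Function.iterate_one, hφ]

theorem zinkRing_toResidue_surjective (y : WittVector p (ResidueField R)) :
    ∃ x ∈ zinkRing p R, toResidue p x = y := by
  obtain ⟨z, hz, h⟩ := exists_frobPerfect_lift p y
  exact ⟨z, frobPerfect_le_zinkRing p hz, h⟩

variable (R) in
/-- `𝕎(R)` is the unique subring of `W(R)` that is stable under the Frobenius and for which the
projection `𝕎(R) → W(k)` is surjective with kernel `Ŵ(𝔪)`. -/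
theorem existsUnique_zinkRing (A : Subring (WittVector p R)) :
    ((∀ x ∈ A, WittVector.frobenius x ∈ A) ∧ (∀ y, ∃ x ∈ A, toResidue p x = y) ∧
      ∀ x, x ∈ A ∧ toResidue p x = 0 ↔ x ∈ hatW p R) ↔ A = zinkRing p R := by
  constructor
  swap
  · rintro rfl
    exact ⟨frobenius_mem_zinkRing p, zinkRing_toResidue_surjective p,
      mem_zinkRing_toResidue_eq_zero_iff p⟩
  rintro ⟨hf, hsurj, hker⟩
  have hA : ∀ x ∈ A, ∀ w ∈ A, toResidue p x = toResidue p w → x - w ∈ hatW p R :=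
    fun x hx w hw h => (hker _).1 ⟨sub_mem hx hw, by rw [map_sub, h, sub_self]⟩
  have hfn : ∀ (n : ℕ), ∀ x ∈ A, WittVector.frobenius^[n] x ∈ A := by
    intro n x hx
    induction n with
    | zero => exact hx
    | succ n ih => rw [Function.iterate_succ_apply']; exact hf _ ih
  have key : ∀ x ∈ A, ∀ z ∈ frobPerfect p R, toResidue p x = toResidue p z →
      x - z ∈ hatW p R := by
    rintro x hx _ ⟨c, rfl, hc⟩ hxz
    have hit : ∀ n, WittVector.frobenius^[n] (c n) = c 0 := by
      intro n
      induction n with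
      | zero => rfl
      | succ n ih => rw [Function.iterate_succ_apply, hc, ih]
    have hd : ∀ n, ∃ d ∈ hatW p R, x - c 0 - d ∈ powW p (n + 1) := by
      intro n
      obtain ⟨w, hw, hwc⟩ := hsurj (toResidue p (c n))
      have h1 : WittVector.frobenius^[n] w - c 0 ∈ powW p (n + 1) := by
        rw [← hit n, ← iterate_map_sub]
        exact iterate_frobenius_mem_powW p n _
          ((mem_powW_one_iff p _).2 (by rw [map_sub, hwc, sub_self]))
      refine ⟨x - WittVector.frobenius^[n] w, hA _ hx _ (hfn n w hw) ?_, ?_⟩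
      · have h2 := (mem_powW_one_iff p _).1 (powW_anti p 1 (n + 1) (by omega) h1)
        rw [map_sub, sub_eq_zero] at h2
        rw [hxz, h2]
      · rwa [sub_sub_sub_cancel_left]
    constructor
    · have h1 : x - c 0 ∈ powW p 1 := (mem_powW_one_iff p _).2 (by rw [map_sub, hxz, sub_self])
      simpa using (mem_powW_iff p 1 _).1 h1
    · intro N
      obtain ⟨d, hd1, hd2⟩ := hd N
      obtain ⟨M, hM⟩ := hd1.2 N
      refine ⟨M, fun n hn => ?_⟩
      have h1 := (sub_mem_powW_iff p _ _ _).1 (powW_anti p _ _ N.le_succ hd2) n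
      have h2 := add_mem h1 (hM n hn)
      rwa [sub_add_cancel] at h2
  ext x
  constructor
  · intro hx
    obtain ⟨z, hz, hzx⟩ := exists_frobPerfect_lift p (toResidue p x)
    exact ⟨z, hz, key x hx z hz hzx.symm⟩
  · rintro ⟨z, hz, hx⟩
    obtain ⟨w, hw, hwx⟩ := hsurj (toResidue p x)
    have h1 := key w hw z hz (by
      have h2 := toResidue_eq_zero_of_mem_hatW p _ hx
      rw [map_sub, sub_eq_zero] at h2
      rw [hwx, h2])
    have h3 := ((hker _).2 (sub_mem hx h1)).1
    rw [sub_sub_sub_cancel_right] at h3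
    simpa using add_mem h3 hw

end ZinkComplete

end LauFrames

namespace LauFrames

/-! ### The Dieudonné frame -/

open IsLocalRing

section DieudonneFrame

variable (p : ℕ) [Fact p.Prime]

theorem pow_dvd_coeff_p_sub_V_one (hp2 : p ≠ 2) (n : ℕ) :
    (p : ℤ) ^ (n + 1) ∣ ((p : WittVector p ℤ) - WittVector.verschiebung 1).coeff n := by
  have hp3 : 3 ≤ p := by
    have := (Fact.out : p.Prime).two_le
    omega
  induction n using Nat.strong_induction_on with
  | _ n ih =>
    set e : WittVector p ℤ := (p : WittVector p ℤ) - WittVector.verschiebung 1 with he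
    cases n with
    | zero =>
      have h : WittVector.ghostComponent 0 e = p := by
        rw [he, map_sub, map_natCast, WittVector.ghostComponent_zero_verschiebung, sub_zero]
      rw [ghostComponent_eq_sum] at h
      simp at h
      simp [h]
    | succ n =>
      have h : WittVector.ghostComponent (n + 1) e = 0 := by
        rw [he, map_sub, map_natCast, WittVector.ghostComponent_verschiebung, map_one, mul_one,
          sub_self]
      rw [ghostComponent_eq_sum, Finset.sum_range_succ, Nat.sub_self, pow_zero, pow_one] at h
      have h1 : (p : ℤ) ^ (2 * (n + 1) + 1) ∣
          ∑ i ∈ Finset.range (n + 1), (p : ℤ) ^ i * e.coeff i ^ p ^ (n + 1 - i) := by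
        refine Finset.dvd_sum fun i hi => ?_
        have hi' := Finset.mem_range.1 hi
        have h2 := pow_dvd_pow_of_dvd (ih i hi') (p ^ (n + 1 - i))
        have h3 := mul_dvd_mul_left ((p : ℤ) ^ i) h2
        rw [← pow_mul, ← pow_add] at h3
        refine (pow_dvd_pow _ ?_).trans h3
        obtain ⟨d, hd⟩ : ∃ d, n + 1 - i = d + 1 := ⟨n - i, by omega⟩
        have hn : n = i + d := by omega
        have h4 : 2 * (d + 1) + 1 ≤ p ^ (d + 1) := by
          clear hd hn h3 h2 hi' hi h he ih
          induction d with
          | zero => simpa using hp3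
          | succ d ihd =>
            rw [pow_succ]
            nlinarith
        rw [hd, hn]
        nlinarith
      have h5 : (p : ℤ) ^ (2 * (n + 1) + 1) ∣ (p : ℤ) ^ (n + 1) * e.coeff (n + 1) := by
        rw [eq_neg_of_add_eq_zero_right h]
        exact h1.neg_right
      rw [show 2 * (n + 1) + 1 = (n + 1) + (n + 1 + 1) by ring, pow_add] at h5
      exact Int.dvd_of_mul_dvd_mul_left
        (pow_ne_zero _ (Nat.cast_ne_zero.2 (Fact.out : p.Prime).ne_zero)) h5

theorem exists_verschiebung_eq {A : Type u} [CommRing A] (x : WittVector p A)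
    (hx : x.coeff 0 = 0) : ∃ y, x = WittVector.verschiebung y := by
  refine ⟨_, WittVector.eq_iterate_verschiebung (n := 1) fun i hi => ?_⟩
  obtain rfl : i = 0 := by omega
  exact hx

variable {R : Type u} [CommRing R] [IsLocalRing R] [CharP (ResidueField R) p]

theorem p_sub_V_one_mem_hatW (hp2 : p ≠ 2) :
    (p : WittVector p R) - WittVector.verschiebung 1 ∈ hatW p R := by
  have h1 : WittVector.map (Int.castRingHom R)
      ((p : WittVector p ℤ) - WittVector.verschiebung 1) =
        (p : WittVector p R) - WittVector.verschiebung 1 := by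
    rw [map_sub, map_natCast, WittVector.map_verschiebung, map_one]
  have h2 : ∀ n, ((p : WittVector p R) - WittVector.verschiebung 1).coeff n ∈
      maximalIdeal R ^ (n + 1) := by
    intro n
    obtain ⟨c, hc⟩ := pow_dvd_coeff_p_sub_V_one p hp2 n
    rw [← h1, WittVector.map_coeff, hc, map_mul, map_pow]
    exact Ideal.mul_mem_right _ _ (Ideal.pow_mem_pow (by simpa using natCast_p_mem p (R := R)) _)
  exact ⟨fun n => Ideal.pow_le_self n.succ_ne_zero (h2 n),
    fun N => ⟨N, fun n hn => Ideal.pow_le_pow_right (hn.trans n.le_succ) (h2 n)⟩⟩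

theorem verschiebung_mem_zinkRing (hp2 : p ≠ 2) (x : WittVector p R) (hx : x ∈ zinkRing p R) :
    WittVector.verschiebung x ∈ zinkRing p R := by
  obtain ⟨z, ⟨c, rfl, hc⟩, hx⟩ := hx
  have h1 : WittVector.verschiebung (c 0) = (p : WittVector p R) * c 1 -
      ((p : WittVector p R) - WittVector.verschiebung 1) * c 1 := by
    rw [← hc 0, sub_mul, sub_sub_cancel]
    simpa using WittVector.verschiebung_mul_frobenius (1 : WittVector p R) (c 1)
  have h2 : c 1 ∈ frobPerfect p R := ⟨fun n => c (n + 1), rfl, fun n => hc (n + 1)⟩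
  refine ⟨p * c 1, mul_mem (natCast_mem _ _) h2, ?_⟩
  rw [← sub_add_sub_cancel _ (WittVector.verschiebung (c 0)), ← map_sub]
  refine add_mem ((verschiebung_mem_hatW_iff p _).2 hx) ?_
  rw [h1, sub_sub_cancel_left]
  exact neg_mem (Ideal.mul_mem_right _ _ (p_sub_V_one_mem_hatW p hp2))

theorem isUnit_frobenius_coeff_zero (x : WittVector p R) :
    IsUnit ((WittVector.frobenius x).coeff 0) ↔ IsUnit (x.coeff 0) := by
  have h : (WittVector.frobenius x).coeff 0 = x.coeff 0 ^ p + p * x.coeff 1 := by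
    have h1 := WittVector.ghostComponent_frobenius 0 x
    rw [ghostComponent_eq_sum, ghostComponent_eq_sum] at h1
    simpa [Finset.sum_range_succ] using h1
  rw [← not_iff_not, ← mem_nonunits_iff, ← mem_maximalIdeal, ← mem_nonunits_iff,
    ← mem_maximalIdeal, h, Ideal.add_mem_iff_left _ (Ideal.mul_mem_right _ _ (natCast_p_mem p))]
  exact Ideal.IsPrime.pow_mem_iff_mem inferInstance _ (Fact.out : p.Prime).pos

theorem isUnit_of_coeff_zero (x : WittVector p R) (hx : IsUnit (x.coeff 0)) : IsUnit x := by
  have hfx : ∀ n, IsUnit ((WittVector.frobenius^[n] x).coeff 0) := by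
    intro n
    induction n with
    | zero => exact hx
    | succ n ih =>
      rw [Function.iterate_succ_apply']
      exact (isUnit_frobenius_coeff_zero p _).2 ih
  have hV : ∀ (n : ℕ) (u v : WittVector p R), WittVector.verschiebung^[n] (u + v) =
      WittVector.verschiebung^[n] u + WittVector.verschiebung^[n] v :=
    fun n u v => iterate_map_add _ n u v
  have step : ∀ (n : ℕ) (y : WittVector p R),
      ∃ d : WittVector p R, (∃ c, x * y - 1 = WittVector.verschiebung^[n] c) →
        ∃ c, x * (y + WittVector.verschiebung^[n] d) - 1 = WittVector.verschiebung^[n + 1] c := by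
    intro n y
    by_cases h : ∃ c, x * y - 1 = WittVector.verschiebung^[n] c
    · obtain ⟨c, hc⟩ := h
      obtain ⟨w, hw⟩ := hfx n
      refine ⟨WittVector.teichmuller p (-(c.coeff 0 * ↑w⁻¹)), fun _ => ?_⟩
      have h1 : (c + WittVector.teichmuller p (-(c.coeff 0 * ↑w⁻¹)) *
          WittVector.frobenius^[n] x).coeff 0 = 0 := by
        rw [WittVector.add_coeff_zero, WittVector.mul_coeff_zero, WittVector.teichmuller_coeff_zero,
          ← hw]
        simp
      obtain ⟨b, hb⟩ := exists_verschiebung_eq p _ h1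
      refine ⟨b, ?_⟩
      rw [mul_add, add_sub_right_comm, hc, mul_comm x, WittVector.iterate_verschiebung_mul_left,
        ← hV, hb, ← Function.iterate_succ_apply]
    · exact ⟨0, fun h' => absurd h' h⟩
  choose d hd using step
  let y : ℕ → WittVector p R := fun n =>
    Nat.rec 0 (fun n y => y + WittVector.verschiebung^[n] (d n y)) n
  have hy : ∀ n, y (n + 1) = y n + WittVector.verschiebung^[n] (d n (y n)) := fun n => rfl
  have hxy : ∀ n, ∃ c, x * y n - 1 = WittVector.verschiebung^[n] c := by
    intro n
    induction n with
    | zero => exact ⟨_, rfl⟩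
    | succ n ih => exact hd n (y n) ih
  have htV : ∀ n (c : WittVector p R),
      WittVector.truncate (p := p) n (WittVector.verschiebung^[n] c) = 0 := by
    intro n c
    rw [← RingHom.mem_ker, WittVector.mem_ker_truncate]
    exact fun i hi => WittVector.iterate_verschiebung_coeff_eq_zero c hi
  have htt : ∀ m n, m ≤ n → ∀ u v : WittVector p R,
      WittVector.truncate (p := p) n u = WittVector.truncate n v →
        WittVector.truncate (p := p) m u = WittVector.truncate m v := by
    intro m n hmn u v huv
    rw [← sub_eq_zero, ← map_sub, ← RingHom.mem_ker, WittVector.mem_ker_truncate] at huv ⊢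
    exact fun i hi => huv i (by omega)
  have hyt : ∀ m n, m ≤ n →
      WittVector.truncate (p := p) m (y n) = WittVector.truncate m (y m) := by
    intro m n hmn
    induction n, hmn using Nat.le_induction with
    | base => rfl
    | succ n hmn ih =>
      rw [← ih, hy]
      refine htt m n hmn _ _ ?_
      rw [map_add, htV, add_zero]
  let Y : WittVector p R := WittVector.mk p fun i => (y (i + 1)).coeff i
  have hY : ∀ n, WittVector.truncate (p := p) n Y = WittVector.truncate n (y n) := by
    intro n
    ext i
    rw [WittVector.coeff_truncate, WittVector.coeff_truncate, WittVector.coeff_mk]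
    have h1 := congrArg (TruncatedWittVector.coeff (Fin.last (i : ℕ))) (hyt (i + 1) n i.2)
    rw [WittVector.coeff_truncate, WittVector.coeff_truncate] at h1
    exact h1.symm
  refine IsUnit.of_mul_eq_one Y (sub_eq_zero.1 ?_)
  ext i
  obtain ⟨c, hc⟩ := hxy (i + 1)
  have h1 : WittVector.truncate (p := p) (i + 1) (x * Y - 1) = 0 := by
    rw [map_sub, map_mul, hY, ← map_mul, ← map_sub, hc, htV]
  rw [← RingHom.mem_ker, WittVector.mem_ker_truncate] at h1
  rw [WittVector.zero_coeff]
  exact h1 i i.lt_succ_self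

theorem exists_mul_eq_one (x : WittVector p R) (hx : x ∈ zinkRing p R) (h : IsUnit (x.coeff 0)) :
    ∃ y ∈ zinkRing p R, x * y = 1 := by
  obtain ⟨z, ⟨c, rfl, hc⟩, hxz⟩ := hx
  have h0 : IsUnit ((c 0).coeff 0) := by
    by_contra h1
    refine (mem_maximalIdeal _).1 ?_ h
    have h2 := add_mem (hxz.1 0) ((mem_maximalIdeal _).2 h1)
    rwa [← WittVector.add_coeff_zero, sub_add_cancel] at h2
  have hcu : ∀ n, IsUnit ((c n).coeff 0) := by
    intro n
    induction n with
    | zero => exact h0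
    | succ n ih => rwa [← hc n, isUnit_frobenius_coeff_zero] at ih
  choose d hd using fun n => (isUnit_of_coeff_zero p (c n) (hcu n)).exists_right_inv
  have hdz : d 0 ∈ frobPerfect p R := by
    refine ⟨d, rfl, fun n => ?_⟩
    have h1 := congrArg WittVector.frobenius (hd (n + 1))
    rw [map_mul, hc, map_one] at h1
    calc WittVector.frobenius (d (n + 1))
        = (c n * d n) * WittVector.frobenius (d (n + 1)) := by rw [hd, one_mul]
      _ = d n * (c n * WittVector.frobenius (d (n + 1))) := by ring
      _ = d n := by rw [h1, mul_one]
  obtain ⟨y, hy⟩ := (isUnit_of_coeff_zero p x h).exists_right_inv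
  refine ⟨y, ⟨d 0, hdz, ?_⟩, hy⟩
  have h1 : y - d 0 = -(y * d 0) * (x - c 0) := by
    linear_combination d 0 * hy - y * hd 0
  rw [h1]
  exact Ideal.mul_mem_left _ _ hxz

theorem mem_zinkRing_of_verschiebung_mem [IsAdicComplete (maximalIdeal R) R]
    [PerfectRing (ResidueField R) p] (hp2 : p ≠ 2) (x : WittVector p R)
    (hx : WittVector.verschiebung x ∈ zinkRing p R) : x ∈ zinkRing p R := by
  obtain ⟨z, ⟨c, rfl, hc⟩, hxz⟩ := exists_frobPerfect_lift p (toResidue p x)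
  have hz : c 0 ∈ zinkRing p R := frobPerfect_le_zinkRing p ⟨c, rfl, hc⟩
  have h1 : WittVector.verschiebung (x - c 0) ∈ hatW p R := by
    rw [← mem_zinkRing_toResidue_eq_zero_iff, map_sub]
    refine ⟨sub_mem hx (verschiebung_mem_zinkRing p hp2 _ hz), ?_⟩
    rw [← map_sub, toResidue, WittVector.map_verschiebung, ← toResidue, map_sub, hxz, sub_self,
      map_zero]
  simpa using add_mem (hatW_le_zinkRing p _ ((verschiebung_mem_hatW_iff p _).1 h1)) hz

/-- The Frobenius of `𝕎(R)`. -/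
noncomputable def frobZink : zinkRing p R →+* zinkRing p R :=
  WittVector.frobenius.restrict (zinkRing p R) (zinkRing p R) (frobenius_mem_zinkRing p)

theorem frobZink_lift [IsAdicComplete (maximalIdeal R) R] [PerfectRing (ResidueField R) p]
    (hp2 : p ≠ 2) (x : zinkRing p R) : (p : zinkRing p R) ∣ frobZink p x - x ^ p := by
  have hadd : ∀ a b : zinkRing p R, (p : zinkRing p R) ∣ frobZink p a - a ^ p →
      (p : zinkRing p R) ∣ frobZink p b - b ^ p →
      (p : zinkRing p R) ∣ frobZink p (a + b) - (a + b) ^ p := by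
    intro a b ha hb
    obtain ⟨r, hr⟩ := exists_add_pow_prime_eq (Fact.out : p.Prime) a b
    rw [hr, map_add, show frobZink p a + frobZink p b - (a ^ p + b ^ p + p * a * b * r) =
      (frobZink p a - a ^ p) + (frobZink p b - b ^ p) - p * (a * b * r) by ring]
    exact dvd_sub (dvd_add ha hb) (dvd_mul_right _ _)
  obtain ⟨x, z, hz, hxz⟩ := x
  have h1 : (p : zinkRing p R) ∣ frobZink p ⟨z, frobPerfect_le_zinkRing p hz⟩ -
      ⟨z, frobPerfect_le_zinkRing p hz⟩ ^ p := by
    have h2 : WittVector.frobenius (toResidue p z) - toResidue p z ^ p ∈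
        RingHom.ker (WittVector.constantCoeff (p := p) (R := ResidueField R)) := by
      rw [RingHom.mem_ker, map_sub, map_pow, WittVector.constantCoeff_apply,
        WittVector.constantCoeff_apply, WittVector.coeff_frobenius_charP, sub_self]
    rw [WittVector.ker_constantCoeff, Ideal.mem_span_singleton] at h2
    obtain ⟨y, hy⟩ := h2
    obtain ⟨w, hw, hwy⟩ := exists_frobPerfect_lift p y
    refine ⟨⟨w, frobPerfect_le_zinkRing p hw⟩, Subtype.ext (sub_eq_zero.1 ?_)⟩
    refine eq_zero_of_mem_frobPerfect p _ ?_ ?_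
    · exact sub_mem (sub_mem (frobenius_mem_frobPerfect p z hz) (pow_mem hz p))
        (mul_mem (natCast_mem _ p) hw)
    · change toResidue p (WittVector.frobenius z - z ^ p - (p : WittVector p R) * w) = 0
      rw [map_sub, map_sub, map_mul, map_natCast, map_pow, hwy, ← hy, toResidue, map_frobenius,
        sub_self]
  have h3 : ∀ h (hh : h ∈ hatW p R), (p : zinkRing p R) ∣
      frobZink p ⟨h, hatW_le_zinkRing p h hh⟩ - ⟨h, hatW_le_zinkRing p h hh⟩ ^ p := by
    intro h hh
    have ht : WittVector.teichmuller p (h.coeff 0) ∈ hatW p R := by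
      refine ⟨fun n => ?_, fun N => ⟨1, fun n hn => ?_⟩⟩
      · rcases Nat.eq_zero_or_pos n with rfl | hn
        · rw [WittVector.teichmuller_coeff_zero]; exact hh.1 0
        · rw [WittVector.teichmuller_coeff_pos p _ n hn]; exact zero_mem _
      · rw [WittVector.teichmuller_coeff_pos p _ n hn]; exact zero_mem _
    obtain ⟨y, hy⟩ : ∃ y, h - WittVector.teichmuller p (h.coeff 0) = WittVector.verschiebung y := by
      refine ⟨_, WittVector.eq_iterate_verschiebung (n := 1) fun i hi => ?_⟩
      obtain rfl : i = 0 := by omega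
      have h4 := map_sub (WittVector.constantCoeff (p := p)) h
        (WittVector.teichmuller p (h.coeff 0))
      simpa [WittVector.constantCoeff_apply] using h4
    have hVy : WittVector.verschiebung y ∈ hatW p R := by
      rw [← hy]; exact sub_mem hh ht
    have hy' := (verschiebung_mem_hatW_iff p y).1 hVy
    have e : (⟨h, hatW_le_zinkRing p h hh⟩ : zinkRing p R) =
        ⟨_, hatW_le_zinkRing p _ ht⟩ + ⟨_, hatW_le_zinkRing p _ hVy⟩ :=
      Subtype.ext (by simp [← hy])
    rw [e]
    refine hadd _ _ ?_ ?_
    · have h5 : frobZink p ⟨_, hatW_le_zinkRing p _ ht⟩ = ⟨_, hatW_le_zinkRing p _ ht⟩ ^ p :=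
        Subtype.ext (by
          change WittVector.frobenius (WittVector.teichmuller p (h.coeff 0)) =
            WittVector.teichmuller p (h.coeff 0) ^ p
          rw [frobenius_teichmuller, map_pow])
      rw [h5, sub_self]
      exact dvd_zero _
    · refine dvd_sub ?_ ?_
      · refine ⟨⟨y, hatW_le_zinkRing p y hy'⟩, Subtype.ext ?_⟩
        change WittVector.frobenius (WittVector.verschiebung y) = (p : WittVector p R) * y
        rw [WittVector.frobenius_verschiebung, mul_comm]
      · refine Dvd.dvd.trans ?_ (pow_dvd_pow _ (Fact.out : p.Prime).two_le)
        refine ⟨⟨WittVector.verschiebung (y * y), verschiebung_mem_zinkRing p hp2 _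
          (hatW_le_zinkRing p _ (Ideal.mul_mem_left _ _ hy'))⟩, Subtype.ext ?_⟩
        change WittVector.verschiebung y ^ 2 =
          (p : WittVector p R) * WittVector.verschiebung (y * y)
        rw [sq, ← WittVector.verschiebung_mul_frobenius, WittVector.frobenius_verschiebung,
          ← mul_assoc, mul_comm _ (p : WittVector p R), ← nsmul_eq_mul, map_nsmul, nsmul_eq_mul]
  have e : (⟨x, z, hz, hxz⟩ : zinkRing p R) =
      ⟨z, frobPerfect_le_zinkRing p hz⟩ + ⟨_, hatW_le_zinkRing p _ hxz⟩ :=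
    Subtype.ext (by simp)
  rw [e]
  exact hadd _ _ h1 (h3 _ hxz)

variable (R)

/-- The ideal `𝕀_R` of `𝕎(R)`, the kernel of the projection to the first component. -/
noncomputable def zinkIdeal : Ideal (zinkRing p R) :=
  RingHom.ker (WittVector.constantCoeff.comp (zinkRing p R).subtype)

variable [IsAdicComplete (maximalIdeal R) R] [PerfectRing (ResidueField R) p]

/-- The projection to the first component identifies `𝕎(R) / 𝕀_R` with `R`. -/
theorem exists_mem_zinkRing_coeff_zero (a : R) : ∃ x ∈ zinkRing p R, x.coeff 0 = a := by
  obtain ⟨z, hz, hza⟩ := exists_frobPerfect_lift p (toResidue p (WittVector.teichmuller p a))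
  have ha : a - z.coeff 0 ∈ maximalIdeal R := by
    have h1 := congrArg (fun w => WittVector.coeff w 0) hza
    simp only [toResidue, WittVector.map_coeff, WittVector.teichmuller_coeff_zero] at h1
    rw [← residue_eq_zero_iff, map_sub, h1, sub_self]
  refine ⟨z + WittVector.teichmuller p (a - z.coeff 0), add_mem
    (frobPerfect_le_zinkRing p hz) (hatW_le_zinkRing p _ ⟨fun n => ?_, fun N => ⟨1, fun n hn => ?_⟩⟩), ?_⟩
  · rcases Nat.eq_zero_or_pos n with rfl | hn
    · rwa [WittVector.teichmuller_coeff_zero]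
    · rw [WittVector.teichmuller_coeff_pos p _ n hn]; exact zero_mem _
  · rw [WittVector.teichmuller_coeff_pos p _ n hn]; exact zero_mem _
  · rw [WittVector.add_coeff_zero, WittVector.teichmuller_coeff_zero, add_sub_cancel]

theorem exists_verschiebung_zinkIdeal (hp2 : p ≠ 2) (x : zinkIdeal p R) :
    ∃ y : zinkRing p R,
      WittVector.verschiebung (y : WittVector p R) = (x : zinkRing p R) := by
  obtain ⟨y, hy⟩ := exists_verschiebung_eq p ((x : zinkRing p R) : WittVector p R) x.2
  exact ⟨⟨y, mem_zinkRing_of_verschiebung_mem p hp2 y (by rw [← hy]; exact x.1.2)⟩, hy.symm⟩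

/-- The Dieudonné frame `𝓓_R = (𝕎(R), 𝕀_R, R, f, f₁)`, where `f₁` is the inverse of the
Verschiebung `𝕎(R) → 𝕀_R`, for a complete local ring `R` with perfect residue field of odd
characteristic `p`. -/
noncomputable def dieudonneFrame (hp2 : p ≠ 2) : Frame.{u} p :=
  have hV := exists_verschiebung_zinkIdeal p R hp2
  { S := zinkRing p R
    I := zinkIdeal p R
    σ := frobZink p
    σ₁ :=
      { toFun := fun x => (hV x).choose
        map_add' := fun x y => Subtype.ext (WittVector.verschiebung_injective p R (by
          rw [(hV _).choose_spec, Subring.coe_add, map_add, (hV x).choose_spec, (hV y).choose_spec]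
          rfl))
        map_smul' := fun s x => Subtype.ext (WittVector.verschiebung_injective p R (by
          rw [(hV _).choose_spec, smul_eq_mul, mul_comm, Subring.coe_mul]
          change _ = WittVector.verschiebung (_ * WittVector.frobenius (s : WittVector p R))
          rw [WittVector.verschiebung_mul_frobenius, (hV x).choose_spec, mul_comm]
          rfl)) }
    le_jacobson := by
      have hle : zinkIdeal p R ⊔ Ideal.span {(p : zinkRing p R)} ≤
          (maximalIdeal R).comap (WittVector.constantCoeff.comp (zinkRing p R).subtype) := by
        rw [sup_le_iff, Ideal.span_singleton_le_iff_mem]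
        refine ⟨fun x hx => ?_, ?_⟩
        · rw [Ideal.mem_comap, (RingHom.mem_ker).1 hx]
          exact zero_mem _
        · rw [Ideal.mem_comap, map_natCast]
          exact natCast_p_mem p
      intro x hx
      have hx' : WittVector.constantCoeff (x : WittVector p R) ∈ maximalIdeal R := hle hx
      rw [Ideal.mem_jacobson_bot]
      intro y
      obtain ⟨w, hw, h⟩ := exists_mul_eq_one p _ (x * y + 1).2 (by
        by_contra h1
        have h2 : WittVector.constantCoeff (p := p) ((x * y + 1 : zinkRing p R) : WittVector p R) ∈
          maximalIdeal R := (mem_maximalIdeal _).2 h1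
        rw [Subring.coe_add, Subring.coe_mul, map_add, map_mul, Subring.coe_one, map_one,
          Ideal.add_mem_iff_right _ (Ideal.mul_mem_right _ _ hx')] at h2
        exact (Ideal.ne_top_iff_one _).1 (maximalIdeal.isMaximal R).ne_top h2)
      exact IsUnit.of_mul_eq_one ⟨w, hw⟩ (Subtype.ext h)
    frobenius_lift := frobZink_lift p hp2
    span_range_σ₁ := by
      refine (Ideal.eq_top_iff_one _).2 (Submodule.subset_span ?_)
      refine ⟨⟨⟨WittVector.verschiebung 1, verschiebung_mem_zinkRing p hp2 1 (one_mem _)⟩, ?_⟩, ?_⟩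
      · exact WittVector.verschiebung_coeff_zero (1 : WittVector p R)
      · exact Subtype.ext (WittVector.verschiebung_injective p R
          (hV ⟨⟨WittVector.verschiebung 1, _⟩, _⟩).choose_spec) }

/-- The inclusion of `𝕎(R)`, the ring underlying the frame `𝓓_R`, into `W(R)`. -/
noncomputable def toWitt (hp2 : p ≠ 2) : (dieudonneFrame p R hp2).S →+* WittVector p R :=
  (zinkRing p R).subtype

theorem range_toWitt (hp2 : p ≠ 2) : (toWitt p R hp2).range = zinkRing p R :=
  (zinkRing p R).range_subtype

theorem toWitt_injective (hp2 : p ≠ 2) : Function.Injective (toWitt p R hp2) :=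
  (zinkRing p R).subtype_injective

theorem verschiebung_dieudonneFrame_σ₁ (hp2 : p ≠ 2) (x : (dieudonneFrame p R hp2).I) :
    WittVector.verschiebung (toWitt p R hp2 ((dieudonneFrame p R hp2).σ₁ x)) =
      toWitt p R hp2 x :=
  (exists_verschiebung_zinkIdeal p R hp2 x).choose_spec

end DieudonneFrame

section Quotient

variable (p : ℕ) [Fact p.Prime] (R : Type u) [CommRing R] [IsLocalRing R]

/-- The ring `R_a = R / 𝔪 ^ a`. -/
abbrev truncRing (a : ℕ) : Type u := R ⧸ maximalIdeal R ^ a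

instance (a : ℕ) [NeZero a] : Nontrivial (truncRing R a) :=
  Ideal.Quotient.nontrivial_iff.2 fun h =>
    (maximalIdeal.isMaximal R).ne_top (top_le_iff.1 (h ▸ Ideal.pow_le_self (NeZero.ne a)))

instance (a : ℕ) [NeZero a] : IsLocalRing (truncRing R a) :=
  IsLocalRing.of_surjective' (Ideal.Quotient.mk _) Ideal.Quotient.mk_surjective

theorem maximalIdeal_truncRing (a : ℕ) [NeZero a] :
    maximalIdeal (truncRing R a) = (maximalIdeal R).map (Ideal.Quotient.mk _) :=
  (IsLocalRing.map_maximalIdeal_of_surjective (Ideal.Quotient.mk _)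
    Ideal.Quotient.mk_surjective).symm

theorem maximalIdeal_truncRing_pow (a : ℕ) [NeZero a] : maximalIdeal (truncRing R a) ^ a = ⊥ := by
  rw [maximalIdeal_truncRing, ← Ideal.map_pow, Ideal.map_quotient_self]

instance (a : ℕ) [NeZero a] : IsAdicComplete (maximalIdeal (truncRing R a)) (truncRing R a) where
  haus' x hx := by
    have h := hx a
    rwa [maximalIdeal_truncRing_pow, smul_eq_mul, Ideal.mul_top, SModEq.bot] at h
  prec' f hf := by
    refine ⟨f a, fun n => ?_⟩
    rcases le_total n a with h | h
    · exact hf h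
    · have h1 := hf h
      rw [maximalIdeal_truncRing_pow, smul_eq_mul, Ideal.mul_top, SModEq.bot] at h1
      rw [h1]
      exact SModEq.refl _

/-- The residue field of `R` maps isomorphically onto that of `R_a`. -/
theorem exists_ringEquiv_residueField (a : ℕ) [NeZero a] :
    Nonempty (ResidueField R ≃+* ResidueField (truncRing R a)) := by
  have := IsLocalHom.of_surjective (Ideal.Quotient.mk (maximalIdeal R ^ a))
    Ideal.Quotient.mk_surjective
  refine ⟨RingEquiv.ofBijective (ResidueField.map (Ideal.Quotient.mk (maximalIdeal R ^ a)))
    ⟨RingHom.injective _, fun y => ?_⟩⟩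
  obtain ⟨y, rfl⟩ := residue_surjective y
  obtain ⟨y, rfl⟩ := Ideal.Quotient.mk_surjective y
  exact ⟨residue R y, ResidueField.map_residue _ _⟩

instance (a : ℕ) [NeZero a] [CharP (ResidueField R) p] :
    CharP (ResidueField (truncRing R a)) p := by
  obtain ⟨e⟩ := exists_ringEquiv_residueField R a
  exact charP_of_injective_ringHom (f := e.toRingHom) e.injective p

instance (a : ℕ) [NeZero a] [CharP (ResidueField R) p] [PerfectRing (ResidueField R) p] :
    PerfectRing (ResidueField (truncRing R a)) p := by
  obtain ⟨e⟩ := exists_ringEquiv_residueField R a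
  refine PerfectRing.ofSurjective _ _ fun y => ?_
  obtain ⟨x, hx⟩ := surjective_frobenius (ResidueField R) p (e.symm y)
  refine ⟨e x, ?_⟩
  rw [frobenius_def] at hx ⊢
  rw [← map_pow, hx, e.apply_symm_apply]

end Quotient

end LauFrames

/-! Windows over a local frame are linear algebra. Let `θ` be the element with `σ = θ σ₁` on `I`; it
is `σ(E)` for `𝓑` and `p` for `𝓓_R`. In a basis adapted to `P = L ⊕ T`, a window is an invertible
matrix `A`, and a homomorphism from `A` to `B` is a matrix `X` with lower left block in `I` and `X A
= B X^♯`. Here `X^♯` applies `σ` to the diagonal blocks, `θ σ` to the upper right block and `σ₁` to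
the lower left block. Base change along a `u`-homomorphism `α` sends `A` to `α(A) diag(u, 1)`. By
`isCrystalline_of_matrices` it suffices to prove that this operation on matrices is fully faithful
and essentially surjective.

The structure of `R` comes from dimension theory. The map `π` is surjective because `𝔖` is
`J`-adically complete and `π` is surjective modulo `𝔪`. Since `p ∈ 𝔪 = π(J)`, some `E = p - s` with
`s ∈ J` lies in the kernel. The ring `𝔖/E𝔖` is Noetherian local with maximal ideal generated by `r`
elements and maps onto a ring of dimension `r`; hence it is a domain, and a nonzero kernel would
lower the dimension. As `δ(x_i) = [x_i]`, the components of `δ(s)` for `s ∈ J ^ a` lie in `J ^ (a p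
^ n)`, so `ϰ` takes values in `𝕎(R)`; the element `u = f₁(ϰ(E))` is a unit by a computation with
ghost components.

The equivalence is proved by induction along `R_{n+1} ← R_{n+2}`. For `a = 1` the map `ϰ_1` is an
isomorphism `W(k) ≅ 𝕎(R_1)`. For the step, keep the rings `𝔖_{n+2}` and `𝕎(R_{n+2})`, but enlarge
the ideals so that the quotient becomes `R_{n+1}`. On the Breuil side one adds `J ^ (n+1)` with `σ₁
= 0` there; on the Witt side one adds the Witt vectors whose first component lies in `𝔪 ^ (n+1)`,
and `f₁` becomes the shift of components. On the kernel of the projection to level `n + 1`, `σ`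
vanishes and `σ₁` is elementwise nilpotent (on the Witt side because components converge to zero).
Therefore `Y A - B Y^♯ = C` is uniquely solvable by iteration for matrices with entries in the
kernel, and homomorphisms lift uniquely (`IsNilThickening.existsUnique_lift`). What separates the
enlarged frame from the original one is a lift of the Hodge filtration from `R_{n+1}` to `R_{n+2}`,
and such lifts are the same on both sides because `𝔖_{n+2}/E` and `𝕎(R_{n+2})/𝕀` are both `R_{n+2}`
(`IsThickeningSquare.fullyFaithful`, `IsThickeningSquare.exists_lift`).

Finally `𝔖 = lim 𝔖_a` and `𝕎(R) = lim 𝕎(R_a)`. Full faithfulness passes to the limit by uniqueness,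
essential surjectivity by choosing compatible lifts. Essential surjectivity of `ϰ_a` then follows
from that of `ϰ`, because `𝕎(R) → 𝕎(R_a)` is surjective and local. The hypothesis `p ≠ 2` enters
through the stability of `𝕎` under the Verschiebung. -/

namespace LauFrames

/-! ### Matrices over a frame -/

section Matrices

open Matrix

/-- The data `(I, σ, σ₁, θ)` of a frame with underlying ring `S`, where `σ₁` is extended to a
function on `S` without any condition outside `I`, and `σ = θ σ₁` on `I`. -/
structure WinData (S : Type*) [CommRing S] where
  I : Ideal S
  σ : S →+* S
  τ : S → S
  θ : S
  τ_add : ∀ x ∈ I, ∀ y ∈ I, τ (x + y) = τ x + τ y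
  τ_mul : ∀ s, ∀ x ∈ I, τ (s * x) = σ s * τ x
  θ_mul : ∀ x ∈ I, θ * τ x = σ x

namespace WinData

variable {S S' : Type*} [CommRing S] [CommRing S'] (D : WinData S) (D' : WinData S')
variable {c d c' d' c'' d'' : Type*}

theorem τ_zero : D.τ 0 = 0 := by
  have h := D.τ_mul 0 0 (zero_mem _)
  rwa [zero_mul, map_zero, zero_mul] at h

theorem τ_sum {ι : Type*} (s : Finset ι) (f : ι → S) (hf : ∀ i ∈ s, f i ∈ D.I) :
    D.τ (∑ i ∈ s, f i) = ∑ i ∈ s, D.τ (f i) := by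
  classical
  induction s using Finset.induction_on with
  | empty => simp [D.τ_zero]
  | insert a s ha ih =>
    rw [Finset.sum_insert ha, Finset.sum_insert ha, D.τ_add _ (hf a (Finset.mem_insert_self a s)) _
      (Ideal.sum_mem _ fun i hi => hf i (Finset.mem_insert_of_mem hi)),
      ih fun i hi => hf i (Finset.mem_insert_of_mem hi)]

/-- The coordinates of the elements of `Q`. -/
def MemQ (v : c ⊕ d → S) : Prop := ∀ i, v (Sum.inr i) ∈ D.I

/-- The vector `v` with the operation that describes `F₁`. -/
def vsharp₁ (v : c ⊕ d → S) : c ⊕ d → S :=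
  Sum.elim (fun i => D.σ (v (Sum.inl i))) fun i => D.τ (v (Sum.inr i))

/-- The vector `v` with the operation that describes `F`. -/
def vsharp (v : c ⊕ d → S) : c ⊕ d → S :=
  Sum.elim (fun i => D.θ * D.σ (v (Sum.inl i))) fun i => D.σ (v (Sum.inr i))

/-- The matrices of linear maps which preserve `Q`. -/
def Adm (X : Matrix (c ⊕ d) (c' ⊕ d') S) : Prop := ∀ i j, X (Sum.inr i) (Sum.inl j) ∈ D.I

/-- The matrix `X` with the operation that describes the compatibility with `F` and `F₁`. -/
def sharp (X : Matrix (c ⊕ d) (c' ⊕ d') S) : Matrix (c ⊕ d) (c' ⊕ d') S :=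
  of fun i j => Sum.elim (fun j => D.vsharp₁ (fun i => X i (Sum.inl j)) i)
    (fun j => D.vsharp (fun i => X i (Sum.inr j)) i) j

@[simp] theorem sharp_inl_inl (X : Matrix (c ⊕ d) (c' ⊕ d') S) (i j) :
    D.sharp X (Sum.inl i) (Sum.inl j) = D.σ (X (Sum.inl i) (Sum.inl j)) := rfl
@[simp] theorem sharp_inl_inr (X : Matrix (c ⊕ d) (c' ⊕ d') S) (i j) :
    D.sharp X (Sum.inl i) (Sum.inr j) = D.θ * D.σ (X (Sum.inl i) (Sum.inr j)) := rfl
@[simp] theorem sharp_inr_inl (X : Matrix (c ⊕ d) (c' ⊕ d') S) (i j) :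
    D.sharp X (Sum.inr i) (Sum.inl j) = D.τ (X (Sum.inr i) (Sum.inl j)) := rfl
@[simp] theorem sharp_inr_inr (X : Matrix (c ⊕ d) (c' ⊕ d') S) (i j) :
    D.sharp X (Sum.inr i) (Sum.inr j) = D.σ (X (Sum.inr i) (Sum.inr j)) := rfl

theorem vsharp₁_add {v w : c ⊕ d → S} (hv : D.MemQ v) (hw : D.MemQ w) :
    D.vsharp₁ (v + w) = D.vsharp₁ v + D.vsharp₁ w := by
  ext (i | i)
  · simp [vsharp₁]
  · exact D.τ_add _ (hv i) _ (hw i)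

theorem vsharp₁_smul (s : S) {v : c ⊕ d → S} (hv : D.MemQ v) :
    D.vsharp₁ (s • v) = D.σ s • D.vsharp₁ v := by
  ext (i | i)
  · simp [vsharp₁]
  · exact D.τ_mul _ _ (hv i)

theorem vsharp_add (v w : c ⊕ d → S) : D.vsharp (v + w) = D.vsharp v + D.vsharp w := by
  ext (i | i) <;> simp [vsharp, mul_add]

theorem vsharp_smul (s : S) (v : c ⊕ d → S) : D.vsharp (s • v) = D.σ s • D.vsharp v := by
  ext (i | i)
  · simp [vsharp, mul_left_comm]
  · simp [vsharp]

theorem vsharp₁_smul_of_mem {a : S} (ha : a ∈ D.I) (v : c ⊕ d → S) :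
    D.vsharp₁ (a • v) = D.τ a • D.vsharp v := by
  ext (i | i)
  · simp [vsharp₁, vsharp, ← D.θ_mul a ha]
    ring
  · have := D.τ_mul (v (Sum.inr i)) a ha
    simp only [vsharp₁, vsharp, Sum.elim_inr, Pi.smul_apply, smul_eq_mul]
    rw [mul_comm a, this, mul_comm]

theorem memQ_smul_of_mem {a : S} (ha : a ∈ D.I) (v : c ⊕ d → S) : D.MemQ (a • v) :=
  fun _ => Ideal.mul_mem_right _ _ ha

section Fintype

variable [Fintype c] [Fintype d]

theorem Adm.mulVec {D : WinData S} {X : Matrix (c' ⊕ d') (c ⊕ d) S} (hX : D.Adm X) {v : c ⊕ d → S}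
    (hv : D.MemQ v) : D.MemQ (X *ᵥ v) := by
  intro i
  rw [Matrix.mulVec, dotProduct, Fintype.sum_sum_type]
  exact add_mem (Ideal.sum_mem _ fun j _ => Ideal.mul_mem_right _ _ (hX i j))
    (Ideal.sum_mem _ fun j _ => Ideal.mul_mem_left _ _ (hv j))

theorem Adm.mul {D : WinData S} {X : Matrix (c'' ⊕ d'') (c ⊕ d) S} (hX : D.Adm X)
    {Y : Matrix (c ⊕ d) (c' ⊕ d') S} (hY : D.Adm Y) : D.Adm (X * Y) := by
  intro i j
  rw [Matrix.mul_apply, Fintype.sum_sum_type]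
  exact add_mem (Ideal.sum_mem _ fun l _ => Ideal.mul_mem_right _ _ (hX i l))
    (Ideal.sum_mem _ fun l _ => Ideal.mul_mem_left _ _ (hY l j))

/-- The upper right block of `X` meets coordinates in `D.I`, where `σ = θ τ`; this is the origin of
the factor `θ` in that block of `sharp`. -/
theorem vsharp₁_mulVec {X : Matrix (c' ⊕ d') (c ⊕ d) S} (hX : D.Adm X) {v : c ⊕ d → S}
    (hv : D.MemQ v) : D.vsharp₁ (X *ᵥ v) = D.sharp X *ᵥ D.vsharp₁ v := by
  ext (i | i)
  · simp only [vsharp₁, Sum.elim_inl, Matrix.mulVec, dotProduct, Fintype.sum_sum_type, map_add,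
      map_sum, map_mul, sharp_inl_inl, sharp_inl_inr, Sum.elim_inr]
    congr 1
    refine Finset.sum_congr rfl fun j _ => ?_
    rw [← D.θ_mul _ (hv j)]
    ring
  · simp only [vsharp₁, Sum.elim_inl, Matrix.mulVec, dotProduct, Fintype.sum_sum_type,
      sharp_inr_inl, sharp_inr_inr, Sum.elim_inr]
    have h1 : ∀ j, X (Sum.inr i) (Sum.inl j) * v (Sum.inl j) ∈ D.I :=
      fun j => Ideal.mul_mem_right _ _ (hX i j)
    have h2 : ∀ j, X (Sum.inr i) (Sum.inr j) * v (Sum.inr j) ∈ D.I :=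
      fun j => Ideal.mul_mem_left _ _ (hv j)
    rw [D.τ_add _ (Ideal.sum_mem _ fun j _ => h1 j) _ (Ideal.sum_mem _ fun j _ => h2 j),
      D.τ_sum _ _ fun j _ => h1 j, D.τ_sum _ _ fun j _ => h2 j]
    congr 1
    · refine Finset.sum_congr rfl fun j _ => ?_
      rw [mul_comm, D.τ_mul _ _ (hX i j), mul_comm]
    · exact Finset.sum_congr rfl fun j _ => D.τ_mul _ _ (hv j)

/-- Here `σ = θ τ` is applied to the entries of the lower left block, and the factor `θ` is absorbed
by the upper coordinates of `vsharp v`. -/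
theorem vsharp_mulVec {X : Matrix (c' ⊕ d') (c ⊕ d) S} (hX : D.Adm X) (v : c ⊕ d → S) :
    D.vsharp (X *ᵥ v) = D.sharp X *ᵥ D.vsharp v := by
  ext (i | i)
  · simp only [vsharp, Sum.elim_inl, Matrix.mulVec, dotProduct, Fintype.sum_sum_type, map_add,
      map_sum, map_mul, sharp_inl_inl, sharp_inl_inr, Sum.elim_inr, mul_add, Finset.mul_sum]
    congr 1 <;> exact Finset.sum_congr rfl fun j _ => by ring
  · simp only [vsharp, Sum.elim_inl, Matrix.mulVec, dotProduct, Fintype.sum_sum_type, map_add,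
      map_sum, map_mul, sharp_inr_inl, sharp_inr_inr, Sum.elim_inr]
    congr 1
    refine Finset.sum_congr rfl fun j _ => ?_
    rw [← D.θ_mul _ (hX i j)]
    ring

/-- Columns of the first kind are vectors of `Q` and transform by `vsharp₁`, the others by `vsharp`.
Multiplicativity makes the relation `X A = B X^♯` stable under composition and inversion. -/
theorem sharp_mul {X : Matrix (c'' ⊕ d'') (c ⊕ d) S} (hX : D.Adm X)
    {Y : Matrix (c ⊕ d) (c' ⊕ d') S} (hY : D.Adm Y) :
    D.sharp (X * Y) = D.sharp X * D.sharp Y := by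
  ext i (j | j)
  · exact congrFun (D.vsharp₁_mulVec hX (v := fun i => Y i (Sum.inl j)) fun i => hY i j) i
  · exact congrFun (D.vsharp_mulVec hX (fun i => Y i (Sum.inr j))) i

end Fintype

theorem adm_one [DecidableEq c] [DecidableEq d] : D.Adm (1 : Matrix (c ⊕ d) (c ⊕ d) S) := by
  intro i j
  rw [Matrix.one_apply_ne (by simp)]
  exact zero_mem _

theorem sharp_one [DecidableEq c] [DecidableEq d] :
    D.sharp (1 : Matrix (c ⊕ d) (c ⊕ d) S) = 1 := by
  ext (i | i) (j | j)
  · by_cases h : i = j <;> simp [Matrix.one_apply, h]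
  · simp
  · simp [D.τ_zero]
  · by_cases h : i = j <;> simp [Matrix.one_apply, h]

theorem Adm.add {D : WinData S} {X Y : Matrix (c ⊕ d) (c' ⊕ d') S} (hX : D.Adm X) (hY : D.Adm Y) :
    D.Adm (X + Y) := fun i j => add_mem (hX i j) (hY i j)

theorem Adm.sub {D : WinData S} {X Y : Matrix (c ⊕ d) (c' ⊕ d') S} (hX : D.Adm X) (hY : D.Adm Y) :
    D.Adm (X - Y) := fun i j => sub_mem (hX i j) (hY i j)

theorem sharp_add {X Y : Matrix (c ⊕ d) (c' ⊕ d') S} (hX : D.Adm X) (hY : D.Adm Y) :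
    D.sharp (X + Y) = D.sharp X + D.sharp Y := by
  ext (i | i) (j | j)
  · simp
  · simp [mul_add]
  · exact D.τ_add _ (hX i j) _ (hY i j)
  · simp

theorem sharp_sub {X Y : Matrix (c ⊕ d) (c' ⊕ d') S} (hX : D.Adm X) (hY : D.Adm Y) :
    D.sharp (X - Y) = D.sharp X - D.sharp Y := by
  have h := D.sharp_add (hX.sub hY) hY
  rw [sub_add_cancel] at h
  rw [h, add_sub_cancel_right]

end WinData

/-- The diagonal matrix with entries `u` and `1` which describes the base change of windows. -/
def twist {S : Type*} [CommRing S] (c d : Type*) [DecidableEq c] [DecidableEq d] (u : Sˣ) :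
    Matrix (c ⊕ d) (c ⊕ d) S :=
  Matrix.diagonal (Sum.elim (fun _ => (u : S)) fun _ => 1)

theorem twist_one {S : Type*} [CommRing S] (c d : Type*) [DecidableEq c] [DecidableEq d] :
    twist c d (1 : Sˣ) = 1 := by
  rw [twist, ← Matrix.diagonal_one]
  congr 1
  ext (i | i) <;> simp

theorem twist_map {S T : Type*} [CommRing S] [CommRing T] (c d : Type*) [DecidableEq c]
    [DecidableEq d] (u : Sˣ) (φ : S →+* T) : (twist c d u).map φ = twist c d (Units.map φ u) := by
  rw [twist, Matrix.diagonal_map (map_zero φ), twist]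
  congr 1
  ext (i | i) <;> simp

theorem isUnit_twist {S : Type*} [CommRing S] (c d : Type*) [DecidableEq c] [DecidableEq d]
    [Fintype c] [Fintype d] (u : Sˣ) : IsUnit (twist c d u) := by
  rw [Matrix.isUnit_iff_isUnit_det, twist, Matrix.det_diagonal, Fintype.prod_sum_type]
  simp [u.isUnit.pow]

theorem isUnit_map_matrix {S T n : Type*} [CommRing S] [CommRing T] [Fintype n] [DecidableEq n]
    (φ : S →+* T) {A : Matrix n n S} (hA : IsUnit A) : IsUnit (A.map φ) :=
  hA.map φ.mapMatrix

/-- A homomorphism `α` between frames, in terms of `WinData`. -/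
structure IsWinHom {S S' : Type*} [CommRing S] [CommRing S'] (D : WinData S) (D' : WinData S')
    (α : S →+* S') (u : S'ˣ) : Prop where
  map_I : ∀ x ∈ D.I, α x ∈ D'.I
  map_σ : ∀ x, D'.σ (α x) = α (D.σ x)
  map_τ : ∀ x ∈ D.I, D'.τ (α x) = u * α (D.τ x)
  map_θ : α D.θ = u * D'.θ

/-- The base change of a matrix along a homomorphism of frames. -/
def bcMatrix {S S' : Type*} [CommRing S] [CommRing S'] {c d : Type*} [DecidableEq c] [DecidableEq d]
    [Fintype c] [Fintype d] (α : S →+* S') (u : S'ˣ) (A : Matrix (c ⊕ d) (c ⊕ d) S) :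
    Matrix (c ⊕ d) (c ⊕ d) S' := A.map α * twist c d u

section

variable {S S' : Type*} [CommRing S] [CommRing S'] {c d c' d' : Type*} [DecidableEq c]
  [DecidableEq d] [Fintype c] [Fintype d] [DecidableEq c'] [DecidableEq d'] [Fintype c'] [Fintype d']

theorem isUnit_bcMatrix (α : S →+* S') (u : S'ˣ) {A : Matrix (c ⊕ d) (c ⊕ d) S} (hA : IsUnit A) :
    IsUnit (bcMatrix α u A) := (isUnit_map_matrix α hA).mul (isUnit_twist c d u)

variable {D : WinData S} {D' : WinData S'} {α : S →+* S'} {u : S'ˣ}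

theorem IsWinHom.adm (h : IsWinHom D D' α u) {X : Matrix (c ⊕ d) (c' ⊕ d') S} (hX : D.Adm X) :
    D'.Adm (X.map α) := fun i j => h.map_I _ (hX i j)

/-- The unit `u` multiplies `σ₁` and divides `θ`, so it disturbs exactly the two off-diagonal blocks
of `sharp`; conjugation by `diag(u, 1)` absorbs it. This is why `bcMatrix` contains the factor
`twist`. -/
theorem IsWinHom.sharp_map (h : IsWinHom D D' α u) {X : Matrix (c ⊕ d) (c' ⊕ d') S}
    (hX : D.Adm X) : twist c d u * D'.sharp (X.map α) = (D.sharp X).map α * twist c' d' u := by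
  ext (i | i) (j | j)
  · simp [twist, h.map_σ, mul_comm]
  · simp [twist, h.map_σ, h.map_θ, mul_assoc]
  · simp [twist, h.map_τ _ (hX i j), mul_comm]
  · simp [twist, h.map_σ]

theorem IsWinHom.twist_vsharp (h : IsWinHom D D' α u) (v : c ⊕ d → S) :
    twist c d u *ᵥ D'.vsharp (α ∘ v) = α ∘ D.vsharp v := by
  ext (i | i)
  · simp [twist, Matrix.mulVec_diagonal, WinData.vsharp, h.map_σ, h.map_θ, mul_assoc]
  · simp [twist, Matrix.mulVec_diagonal, WinData.vsharp, h.map_σ]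

theorem IsWinHom.twist_vsharp₁ (h : IsWinHom D D' α u) {v : c ⊕ d → S} (hv : D.MemQ v) :
    twist c d u *ᵥ D'.vsharp₁ (α ∘ v) = (u : S') • (α ∘ D.vsharp₁ v) := by
  ext (i | i)
  · simp [twist, Matrix.mulVec_diagonal, WinData.vsharp₁, h.map_σ]
  · simp [twist, Matrix.mulVec_diagonal, WinData.vsharp₁, h.map_τ _ (hv i)]

theorem IsWinHom.bcMatrix_comm (h : IsWinHom D D' α u) {X : Matrix (c' ⊕ d') (c ⊕ d) S}
    (hX : D.Adm X) {A : Matrix (c ⊕ d) (c ⊕ d) S} {B : Matrix (c' ⊕ d') (c' ⊕ d') S}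
    (hAB : X * A = B * D.sharp X) :
    X.map α * bcMatrix α u A = bcMatrix α u B * D'.sharp (X.map α) := by
  rw [bcMatrix, bcMatrix, Matrix.mul_assoc, h.sharp_map hX, ← Matrix.mul_assoc, ← Matrix.mul_assoc,
    ← Matrix.map_mul, ← Matrix.map_mul, hAB]

end

/-- Full faithfulness of the base change, in terms of matrices. -/
def FullyFaithful {S S' : Type*} [CommRing S] [CommRing S'] (D : WinData S) (D' : WinData S')
    (α : S →+* S') (u : S'ˣ) : Prop :=
  ∀ (c d c' d' : ℕ) (A : Matrix (Fin c ⊕ Fin d) (Fin c ⊕ Fin d) S)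
    (B : Matrix (Fin c' ⊕ Fin d') (Fin c' ⊕ Fin d') S), IsUnit A → IsUnit B →
    ∀ X' : Matrix (Fin c' ⊕ Fin d') (Fin c ⊕ Fin d) S', D'.Adm X' →
      X' * bcMatrix α u A = bcMatrix α u B * D'.sharp X' →
      ∃! X : Matrix (Fin c' ⊕ Fin d') (Fin c ⊕ Fin d) S,
        D.Adm X ∧ X * A = B * D.sharp X ∧ X.map α = X'

/-- Essential surjectivity of the base change, in terms of matrices. -/
def EssentiallySurjective {S S' : Type*} [CommRing S] [CommRing S'] (D' : WinData S')
    (α : S →+* S') (u : S'ˣ) : Prop :=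
  ∀ (c d : ℕ) (A' : Matrix (Fin c ⊕ Fin d) (Fin c ⊕ Fin d) S'), IsUnit A' →
    ∃ (A : Matrix (Fin c ⊕ Fin d) (Fin c ⊕ Fin d) S)
      (X : Matrix (Fin c ⊕ Fin d) (Fin c ⊕ Fin d) S'), IsUnit A ∧ IsUnit X ∧ D'.Adm X ∧
        X * bcMatrix α u A = A' * D'.sharp X

/-! ### Invertible admissible matrices over a local ring -/

section Local

variable {S : Type*} [CommRing S] [IsLocalRing S] {c d : Type*} [DecidableEq c]
  [DecidableEq d] [Fintype c] [Fintype d] {D : WinData S}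

/-- Over the residue field an admissible matrix is block upper triangular, so its determinant is the
product of those of the diagonal blocks. -/
theorem WinData.isUnit_blocks (hI : D.I ≤ IsLocalRing.maximalIdeal S)
    {X : Matrix (c ⊕ d) (c ⊕ d) S} (hX : D.Adm X) (hu : IsUnit X) :
    IsUnit X.toBlocks₁₁ ∧ IsUnit X.toBlocks₂₂ := by
  let f := IsLocalRing.residue S
  have h1 : X.map f = Matrix.fromBlocks (X.toBlocks₁₁.map f) (X.toBlocks₁₂.map f) 0
      (X.toBlocks₂₂.map f) := by
    ext (i | i) (j | j)
    · rfl
    · rfl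
    · exact (IsLocalRing.residue_eq_zero_iff _).2 (hI (hX i j))
    · rfl
  have h2 := (Matrix.isUnit_iff_isUnit_det _).1 (isUnit_map_matrix f hu)
  rw [h1, Matrix.det_fromBlocks_zero₂₁, IsUnit.mul_iff] at h2
  rw [Matrix.isUnit_iff_isUnit_det, Matrix.isUnit_iff_isUnit_det]
  refine ⟨isUnit_of_map_unit f _ ?_, isUnit_of_map_unit f _ ?_⟩
  · rw [RingHom.map_det]; exact h2.1
  · rw [RingHom.map_det]; exact h2.2

/-- The lower left block of `Y X = 1` gives `Y₂₁ X₁₁ = -Y₂₂ X₂₁`. Since `X₁₁` is invertible and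
`X₂₁` has entries in the ideal, so has `Y₂₁`. -/
theorem WinData.adm_of_mul_eq_one (hI : D.I ≤ IsLocalRing.maximalIdeal S)
    {X Y : Matrix (c ⊕ d) (c ⊕ d) S} (hX : D.Adm X) (h : Y * X = 1) : D.Adm Y := by
  have hu : IsUnit X := IsUnit.of_mul_eq_one_right Y h
  obtain ⟨U, hU⟩ := (D.isUnit_blocks hI hX hu).1.exists_right_inv
  have h1 : Y.toBlocks₂₁ * X.toBlocks₁₁ + Y.toBlocks₂₂ * X.toBlocks₂₁ = 0 := by
    rw [← Matrix.fromBlocks_toBlocks Y, ← Matrix.fromBlocks_toBlocks X,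
      Matrix.fromBlocks_multiply, ← Matrix.fromBlocks_one, Matrix.fromBlocks_inj] at h
    exact h.2.2.1
  have h2 : Y.toBlocks₂₁ = -(Y.toBlocks₂₂ * X.toBlocks₂₁ * U) := by
    rw [← Matrix.mul_one Y.toBlocks₂₁, ← hU, ← Matrix.mul_assoc, eq_neg_of_add_eq_zero_left h1,
      Matrix.neg_mul]
  intro i j
  change Y.toBlocks₂₁ i j ∈ D.I
  rw [h2, Matrix.neg_apply, Matrix.mul_apply]
  refine neg_mem (Ideal.sum_mem _ fun l _ => Ideal.mul_mem_right _ _ ?_)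
  rw [Matrix.mul_apply]
  exact Ideal.sum_mem _ fun m _ => Ideal.mul_mem_left _ _ (hX m l)

end Local

end Matrices

end LauFrames

namespace LauFrames

/-! ### Normal bases of windows -/

section NormalBases

open Matrix

variable {p : ℕ} {𝓕 𝓕' : Frame.{u} p}

/-- The data `D` are those of the frame `𝓕`. -/
structure WinData.IsDataOf (D : WinData 𝓕.S) : Prop where
  I_eq : D.I = 𝓕.I
  σ_eq : D.σ = 𝓕.σ
  τ_eq : ∀ (x : 𝓕.S) (hx : x ∈ 𝓕.I), D.τ x = 𝓕.σ₁ ⟨x, hx⟩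

theorem WinData.IsDataOf.σ_apply {D : WinData 𝓕.S} (hD : D.IsDataOf) (x : 𝓕.S) :
    D.σ x = 𝓕.σ x := by rw [hD.σ_eq]

theorem WinData.IsDataOf.mem {D : WinData 𝓕.S} (hD : D.IsDataOf) {x : 𝓕.S} (hx : x ∈ 𝓕.I) :
    x ∈ D.I := by rwa [hD.I_eq]

/-- A normal basis of a window, with the matrix of `F₁` and `F` in this basis. -/
structure NormalBasis (D : WinData 𝓕.S) (𝓟 : Window 𝓕) (c d : ℕ) where
  e : 𝓟.P ≃ₗ[𝓕.S] (Fin c ⊕ Fin d → 𝓕.S)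
  A : Matrix (Fin c ⊕ Fin d) (Fin c ⊕ Fin d) 𝓕.S
  isUnit : IsUnit A
  mem_Q : ∀ x, x ∈ 𝓟.Q ↔ D.MemQ (e x)
  map_F : ∀ x, e (𝓟.F x) = A *ᵥ D.vsharp (e x)
  map_F₁ : ∀ x : 𝓟.Q, e (𝓟.F₁ x) = A *ᵥ D.vsharp₁ (e x)

/-- The elements `σ₁(a)` generate the unit ideal, so membership in a submodule can be tested after
multiplication by all of them. -/
theorem Frame.mul_mem_span {M : Type*} [AddCommGroup M] [Module 𝓕.S M] (N : Submodule 𝓕.S M) (x : M)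
    (h : ∀ a : 𝓕.I, 𝓕.σ₁ a • x ∈ N) : x ∈ N := by
  have h1 : ∀ s : 𝓕.S, s • x ∈ N := by
    intro s
    have hs : s ∈ Submodule.span 𝓕.S (Set.range 𝓕.σ₁) := by
      rw [𝓕.span_range_σ₁]; trivial
    induction hs using Submodule.span_induction with
    | mem y hy => obtain ⟨a, rfl⟩ := hy; exact h a
    | zero => rw [zero_smul]; exact zero_mem _
    | add y z _ _ hy hz => rw [add_smul]; exact add_mem hy hz
    | smul t y _ hy => rw [smul_assoc]; exact N.smul_mem _ hy
  simpa using h1 1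

variable {D : WinData 𝓕.S} (hD : D.IsDataOf)

include hD in
-- For `a ∈ I` both sides agree after multiplication by `σ₁(a)`: `σ₁(a) F(x) = F₁(a x) = σ(a) F₁(x)
-- = θ σ₁(a) F₁(x)`. Thus `F` on `L` is determined by `F₁`.
theorem Window.F_eq (𝓟 : Window 𝓕) (x : 𝓟.Q) : 𝓟.F x = D.θ • 𝓟.F₁ x := by
  refine sub_eq_zero.1 ?_
  rw [← Submodule.mem_bot 𝓕.S]
  refine 𝓕.mul_mem_span _ _ fun a => ?_
  have h1 := 𝓟.F₁_smul a x (𝓟.smul_mem_Q a x)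
  have h2 : (⟨(a : 𝓕.S) • (x : 𝓟.P), 𝓟.smul_mem_Q a x⟩ : 𝓟.Q) = (a : 𝓕.S) • x := rfl
  rw [h2, map_smulₛₗ] at h1
  rw [Submodule.mem_bot, smul_sub, ← h1, smul_comm, ← smul_assoc, smul_eq_mul, sub_eq_zero,
    ← hD.σ_apply, ← D.θ_mul a (hD.mem a.2), hD.τ_eq _ a.2, mul_smul]

section Std

variable {c d : ℕ}

theorem WinData.memQ_single_inl (D : WinData 𝓕.S) (j : Fin c) (s : 𝓕.S) :
    D.MemQ (Pi.single (Sum.inl j) s : Fin c ⊕ Fin d → 𝓕.S) := fun i => by simp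

theorem WinData.vsharp₁_single (D : WinData 𝓕.S) (j : Fin c) :
    D.vsharp₁ (Pi.single (Sum.inl j) 1 : Fin c ⊕ Fin d → 𝓕.S) = Pi.single (Sum.inl j) 1 := by
  ext (i | i)
  · by_cases h : i = j <;> simp [vsharp₁, Pi.single_apply, h]
  · simp [vsharp₁, D.τ_zero]

theorem WinData.vsharp_single (D : WinData 𝓕.S) (j : Fin d) :
    D.vsharp (Pi.single (Sum.inr j) 1 : Fin c ⊕ Fin d → 𝓕.S) = Pi.single (Sum.inr j) 1 := by
  ext (i | i)
  · simp [vsharp]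
  · by_cases h : i = j <;> simp [vsharp, Pi.single_apply, h]

/-- The window with the normal basis given by the unit vectors and with structure matrix `A`. -/
noncomputable def stdWindow (A : Matrix (Fin c ⊕ Fin d) (Fin c ⊕ Fin d) 𝓕.S)
    (hA : IsUnit A) : Window 𝓕 where
  P := Fin c ⊕ Fin d → 𝓕.S
  Q :=
    { carrier := {v | D.MemQ v}
      zero_mem' := fun i => zero_mem _
      add_mem' := fun hv hw i => add_mem (hv i) (hw i)
      smul_mem' := fun s v hv i => Ideal.mul_mem_left _ _ (hv i) }
  F :=
    { toFun := fun v => A *ᵥ D.vsharp v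
      map_add' := fun v w => by rw [D.vsharp_add, Matrix.mulVec_add]
      map_smul' := fun s v => by rw [D.vsharp_smul, Matrix.mulVec_smul, hD.σ_eq] }
  F₁ :=
    { toFun := fun v => A *ᵥ D.vsharp₁ v
      map_add' := fun v w => by
        rw [Submodule.coe_add, D.vsharp₁_add v.2 w.2, Matrix.mulVec_add]
      map_smul' := fun s v => by
        rw [Submodule.coe_smul, D.vsharp₁_smul s v.2, Matrix.mulVec_smul, hD.σ_eq] }
  exists_normal_decomposition := by
    let L : Submodule 𝓕.S (Fin c ⊕ Fin d → 𝓕.S) :=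
      { carrier := {v | ∀ i, v (Sum.inr i) = 0}
        zero_mem' := fun i => rfl
        add_mem' := fun hv hw i => by rw [Pi.add_apply, hv i, hw i, add_zero]
        smul_mem' := fun s v hv i => by rw [Pi.smul_apply, hv i, smul_zero] }
    let T : Submodule 𝓕.S (Fin c ⊕ Fin d → 𝓕.S) :=
      { carrier := {v | ∀ i, v (Sum.inl i) = 0}
        zero_mem' := fun i => rfl
        add_mem' := fun hv hw i => by rw [Pi.add_apply, hv i, hw i, add_zero]
        smul_mem' := fun s v hv i => by rw [Pi.smul_apply, hv i, smul_zero] }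
    have hdec : ∀ v : Fin c ⊕ Fin d → 𝓕.S, v = Sum.elim (fun i => v (Sum.inl i)) (fun _ => 0) +
        Sum.elim (fun _ => 0) fun i => v (Sum.inr i) := by
      intro v
      ext (i | i) <;> simp
    refine ⟨L, T, ⟨?_, ?_⟩, ?_⟩
    · rw [Submodule.disjoint_def]
      intro v hv hw
      ext (i | i)
      · exact hw i
      · exact hv i
    · rw [codisjoint_iff, eq_top_iff]
      intro v _
      rw [hdec v]
      exact Submodule.add_mem_sup (fun i => rfl) (fun i => rfl)
    · apply le_antisymm
      · intro v hv
        rw [hdec v]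
        refine Submodule.add_mem_sup (fun i => rfl) ?_
        have h1 : (Sum.elim (fun _ => 0) fun i => v (Sum.inr i) : Fin c ⊕ Fin d → 𝓕.S) =
            ∑ j, v (Sum.inr j) • (Pi.single (Sum.inr j) 1 : Fin c ⊕ Fin d → 𝓕.S) := by
          ext (i | i) <;> simp [Finset.sum_apply, Pi.single_apply]
        rw [h1]
        refine Submodule.sum_mem _ fun j _ => Submodule.smul_mem_smul (hD.I_eq ▸ hv j) fun i => ?_
        simp
      · rw [sup_le_iff]
        refine ⟨fun v hv i => (hv i).symm ▸ zero_mem _, Submodule.smul_le.2 fun a ha v _ => ?_⟩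
        · exact D.memQ_smul_of_mem (hD.mem ha) v
  F₁_smul := fun a x hax => by
    change A *ᵥ D.vsharp₁ ((a : 𝓕.S) • x) = 𝓕.σ₁ a • (A *ᵥ D.vsharp x)
    rw [D.vsharp₁_smul_of_mem (hD.mem a.2), Matrix.mulVec_smul, hD.τ_eq _ a.2]
  span_range_F₁ := by
    rw [eq_top_iff]
    intro v _
    obtain ⟨w, rfl⟩ := Matrix.mulVec_surjective_iff_isUnit.2 hA v
    rw [pi_eq_sum_univ' w, Matrix.mulVec_sum]
    refine Submodule.sum_mem _ fun j _ => ?_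
    rw [Matrix.mulVec_smul]
    refine Submodule.smul_mem _ _ ?_
    -- Unit vectors of the first kind lie in `Q` and are fixed by `vsharp₁`, so the corresponding
    -- column of `A` is a value of `F₁`. Those of the second kind need not lie in `Q`; their
    -- multiples by `a ∈ I` do, and give the column times `σ₁(a)`, which suffices.
    rcases j with j | j
    · refine Submodule.subset_span ⟨⟨Pi.single (Sum.inl j) 1, D.memQ_single_inl j 1⟩, ?_⟩
      change A *ᵥ D.vsharp₁ (Pi.single (Sum.inl j) 1) = _
      rw [D.vsharp₁_single]
    · refine 𝓕.mul_mem_span _ _ fun a => Submodule.subset_span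
        ⟨⟨(a : 𝓕.S) • Pi.single (Sum.inr j) 1, D.memQ_smul_of_mem (hD.mem a.2) _⟩, ?_⟩
      change A *ᵥ D.vsharp₁ ((a : 𝓕.S) • Pi.single (Sum.inr j) 1) = _
      rw [D.vsharp₁_smul_of_mem (hD.mem a.2), Matrix.mulVec_smul, hD.τ_eq _ a.2, D.vsharp_single]

/-- The normal basis of the standard window. -/
noncomputable def stdNormalBasis (A : Matrix (Fin c ⊕ Fin d) (Fin c ⊕ Fin d) 𝓕.S)
    (hA : IsUnit A) : NormalBasis D (stdWindow hD A hA) c d where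
  e := LinearEquiv.refl _ _
  A := A
  isUnit := hA
  mem_Q := fun x => Iff.rfl
  map_F := fun x => rfl
  map_F₁ := fun x => rfl

end Std

include hD in
/-- Every window over a local frame has a normal basis. -/
theorem exists_normalBasis [IsLocalRing 𝓕.S] (𝓟 : Window 𝓕) :
    ∃ c d, Nonempty (NormalBasis D 𝓟 c d) := by
  obtain ⟨L, T, hLT, hQ⟩ := 𝓟.exists_normal_decomposition
  have hL : Module.Finite 𝓕.S L := Module.Finite.of_surjective (L.projectionOnto T hLT)
    (fun x => ⟨x, by simp⟩)
  have hT : Module.Finite 𝓕.S T := Module.Finite.of_surjective (T.projectionOnto L hLT.symm)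
    (fun x => ⟨x, by simp⟩)
  have hL' : Module.Projective 𝓕.S L := Module.Projective.of_split L.subtype (L.projectionOnto T hLT)
    (by ext; simp)
  have hT' : Module.Projective 𝓕.S T := Module.Projective.of_split T.subtype
    (T.projectionOnto L hLT.symm) (by ext; simp)
  have hLf : Module.Free 𝓕.S L := Module.free_of_flat_of_isLocalRing
  have hTf : Module.Free 𝓕.S T := Module.free_of_flat_of_isLocalRing
  let bL := Module.finBasis 𝓕.S L
  let bT := Module.finBasis 𝓕.S T
  set c := Module.finrank 𝓕.S L
  set d := Module.finrank 𝓕.S T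
  let e : 𝓟.P ≃ₗ[𝓕.S] (Fin c ⊕ Fin d → 𝓕.S) :=
    (L.prodEquivOfIsCompl T hLT).symm ≪≫ₗ (bL.equivFun.prodCongr bT.equivFun) ≪≫ₗ
      (LinearEquiv.sumArrowLequivProdArrow _ _ _ _).symm
  have he : ∀ v, e.symm v = (∑ j, v (Sum.inl j) • (bL j : 𝓟.P)) + ∑ j, v (Sum.inr j) • (bT j : 𝓟.P) := by
    intro v
    simp only [e, LinearEquiv.trans_symm, LinearEquiv.trans_apply, LinearEquiv.symm_symm,
      LinearEquiv.prodCongr_symm, LinearEquiv.prodCongr_apply, Submodule.coe_prodEquivOfIsCompl',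
      Module.Basis.equivFun_symm_apply, Submodule.coe_sum, Submodule.coe_smul]
    rfl
  have heL : ∀ j, e.symm (Pi.single (Sum.inl j) 1) = bL j := by
    intro j
    rw [he]
    simp [Pi.single_apply]
  have heT : ∀ j, e.symm (Pi.single (Sum.inr j) 1) = bT j := by
    intro j
    rw [he]
    simp [Pi.single_apply]
  have hbL : ∀ j, (bL j : 𝓟.P) ∈ 𝓟.Q := fun j => hQ ▸ Submodule.mem_sup_left (bL j).2
  have hmem : ∀ x, x ∈ 𝓟.Q ↔ D.MemQ (e x) := by
    intro x
    constructor
    · intro hx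
      rw [hQ, Submodule.mem_sup] at hx
      obtain ⟨l, hl, t, ht, rfl⟩ := hx
      intro i
      rw [map_add, Pi.add_apply]
      refine add_mem ?_ ?_
      · have h1 : e l = Sum.elim (bL.equivFun ⟨l, hl⟩) 0 := by
          rw [← e.eq_symm_apply, he]
          have h2 := congrArg (Submodule.subtype L) (bL.sum_equivFun ⟨l, hl⟩)
          rw [map_sum] at h2
          simp only [Sum.elim_inl, Sum.elim_inr, Pi.zero_apply, zero_smul, Finset.sum_const_zero,
            add_zero]
          exact h2.symm
        rw [h1]
        exact zero_mem _
      · refine Submodule.smul_induction_on (p := fun t => e t (Sum.inr i) ∈ D.I) ht ?_ ?_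
        · intro a ha t _
          rw [map_smul]
          exact Ideal.mul_mem_right _ _ (hD.I_eq ▸ ha)
        · intro t s ht hs
          rw [map_add]
          exact add_mem ht hs
    · intro hx
      rw [← e.symm_apply_apply x, he, hQ]
      refine Submodule.add_mem_sup (Submodule.sum_mem _ fun j _ => L.smul_mem _ (bL j).2)
        (Submodule.sum_mem _ fun j _ => Submodule.smul_mem_smul (hD.I_eq ▸ hx j) (bT j).2)
  -- The columns are the values of `F₁` on the basis of `L` and of `F` on the basis of `T`; these
  -- determine both operators.
  let A : Matrix (Fin c ⊕ Fin d) (Fin c ⊕ Fin d) 𝓕.S := Matrix.of fun i j =>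
    e (Sum.elim (fun j => 𝓟.F₁ ⟨bL j, hbL j⟩) (fun j => 𝓟.F (bT j)) j) i
  have hA : ∀ v, e.symm (A *ᵥ v) = (∑ j, v (Sum.inl j) • 𝓟.F₁ ⟨bL j, hbL j⟩) +
      ∑ j, v (Sum.inr j) • 𝓟.F (bT j) := by
    intro v
    rw [e.symm_apply_eq, map_add, map_sum, map_sum]
    ext i
    rw [Matrix.mulVec, dotProduct, Fintype.sum_sum_type, Pi.add_apply, Finset.sum_apply,
      Finset.sum_apply]
    congr 1 <;> exact Finset.sum_congr rfl fun j _ => by simp [A, mul_comm]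
  have hF₁ : ∀ x : 𝓟.Q, e (𝓟.F₁ x) = A *ᵥ D.vsharp₁ (e x) := by
    intro x
    rw [← e.eq_symm_apply, hA]
    have hx : x = (∑ j, e x (Sum.inl j) • (⟨bL j, hbL j⟩ : 𝓟.Q)) +
        ∑ j, (⟨e x (Sum.inr j) • (bT j : 𝓟.P),
          𝓟.smul_mem_Q ⟨e x (Sum.inr j), hD.I_eq ▸ (hmem x).1 x.2 j⟩ _⟩ : 𝓟.Q) := by
      apply Subtype.ext
      rw [Submodule.coe_add, Submodule.coe_sum, Submodule.coe_sum]
      exact (e.symm_apply_apply (x : 𝓟.P)).symm.trans (he _)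
    conv_lhs => rw [hx]
    rw [map_add, map_sum, map_sum]
    congr 1
    · refine Finset.sum_congr rfl fun j _ => ?_
      rw [map_smulₛₗ, ← hD.σ_apply]
      rfl
    · refine Finset.sum_congr rfl fun j _ => ?_
      rw [𝓟.F₁_smul ⟨e x (Sum.inr j), hD.I_eq ▸ (hmem x).1 x.2 j⟩, ← hD.τ_eq]
      rfl
  have hF : ∀ x, e (𝓟.F x) = A *ᵥ D.vsharp (e x) := by
    intro x
    rw [← e.eq_symm_apply, hA]
    conv_lhs => rw [← e.symm_apply_apply x, he, map_add, map_sum, map_sum]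
    congr 1
    · refine Finset.sum_congr rfl fun j _ => ?_
      rw [map_smulₛₗ, ← hD.σ_apply, 𝓟.F_eq hD ⟨bL j, hbL j⟩, smul_smul, mul_comm]
      rfl
    · refine Finset.sum_congr rfl fun j _ => ?_
      rw [map_smulₛₗ, ← hD.σ_apply]
      rfl
  refine ⟨c, d, ⟨⟨e, A, Matrix.mulVec_surjective_iff_isUnit.1 fun v => ?_, hmem, hF, hF₁⟩⟩⟩
  -- Every value of `F₁` lies in the image of `A`, and these values generate `P`; so `A` is
  -- surjective and hence invertible.
  have h1 : e.symm v ∈ Submodule.span 𝓕.S (Set.range 𝓟.F₁) := by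
    rw [𝓟.span_range_F₁]; trivial
  have h2 : Submodule.span 𝓕.S (Set.range 𝓟.F₁) ≤
      (LinearMap.range A.mulVecLin).comap e.toLinearMap := by
    rw [Submodule.span_le]
    rintro _ ⟨x, rfl⟩
    exact ⟨_, (hF₁ x).symm⟩
  obtain ⟨w, hw⟩ := h2 h1
  exact ⟨w, by simpa using hw⟩

end NormalBases

end LauFrames

namespace LauFrames

/-! ### Homomorphisms of windows in terms of matrices -/

section HomMatrices

open Matrix

variable {p : ℕ} {𝓕 𝓕' : Frame.{u} p} {D : WinData 𝓕.S} {D' : WinData 𝓕'.S}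
variable {c d c' d' c'' d'' : ℕ}

theorem comp_single (φ : 𝓕.S →+* 𝓕'.S) {n : Type*} [DecidableEq n] (j : n) :
    (φ ∘ Pi.single j 1 : n → 𝓕'.S) = Pi.single j 1 := by
  ext i
  by_cases h : i = j <;> simp [Pi.single_apply, h]

/-! ### The matrix of an `α`-homomorphism -/

section Alpha

variable {α : FrameHom 𝓕 𝓕'} {𝓟 : Window 𝓕} {𝓟' 𝓟'' : Window 𝓕'}
  (nb : NormalBasis D 𝓟 c d) (nb' : NormalBasis D' 𝓟' c' d') (nb'' : NormalBasis D' 𝓟'' c'' d'')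

/-- The matrix of an `α`-homomorphism with respect to normal bases. -/
noncomputable def AlphaHom.matrix (g : AlphaHom α 𝓟 𝓟') :
    Matrix (Fin c' ⊕ Fin d') (Fin c ⊕ Fin d) 𝓕'.S :=
  of fun i j => nb'.e (g.g (nb.e.symm (Pi.single j 1))) i

theorem AlphaHom.matrix_mulVec (g : AlphaHom α 𝓟 𝓟') (x : 𝓟.P) :
    nb'.e (g.g x) = g.matrix nb nb' *ᵥ (α.toRingHom ∘ nb.e x) := by
  have h1 : ∀ v : Fin c ⊕ Fin d → 𝓕.S,
      nb'.e (g.g (nb.e.symm v)) = g.matrix nb nb' *ᵥ (α.toRingHom ∘ v) := by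
    intro v
    have h2 : v = ∑ j, v j • (Pi.single j 1 : _ → 𝓕.S) := by
      ext i
      simp [Finset.sum_apply, Pi.single_apply]
    conv_lhs => rw [h2]
    simp only [map_sum, map_smul, map_smulₛₗ]
    ext i
    rw [Finset.sum_apply, Matrix.mulVec, dotProduct]
    exact Finset.sum_congr rfl fun j _ => by simp [AlphaHom.matrix, mul_comm]
  rw [← h1, LinearEquiv.symm_apply_apply]

theorem AlphaHom.matrix_adm (g : AlphaHom α 𝓟 𝓟') : D'.Adm (g.matrix nb nb') := by
  intro i j
  refine (nb'.mem_Q _).1 (g.map_Q _ ((nb.mem_Q _).2 ?_)) i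
  rw [LinearEquiv.apply_symm_apply]
  exact D.memQ_single_inl j 1

variable (hα : IsWinHom D D' α.toRingHom α.u)

theorem comp_mulVec {m n : Type*} [Fintype n] (φ : 𝓕.S →+* 𝓕'.S) (A : Matrix m n 𝓕.S) (v : n → 𝓕.S) :
    φ ∘ (A *ᵥ v) = A.map φ *ᵥ (φ ∘ v) := by
  ext i
  simp [Matrix.mulVec, dotProduct]

include hα in
-- Compatibility with `F` compares the two matrices on the vectors `vsharp (α ∘ v)`, compatibility
-- with `F₁` on `vsharp₁ (α ∘ v)` for `v` in `Q`. The former include the unit vectors of the second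
-- kind, the latter those of the first kind, so together they determine the matrix.
theorem AlphaHom.matrix_comm (g : AlphaHom α 𝓟 𝓟') :
    g.matrix nb nb' * bcMatrix α.toRingHom α.u nb.A = nb'.A * D'.sharp (g.matrix nb nb') := by
  have h1 : ∀ v, (g.matrix nb nb' * bcMatrix α.toRingHom α.u nb.A) *ᵥ D'.vsharp (α.toRingHom ∘ v) =
      (nb'.A * D'.sharp (g.matrix nb nb')) *ᵥ D'.vsharp (α.toRingHom ∘ v) := by
    intro v
    rw [← Matrix.mulVec_mulVec, ← Matrix.mulVec_mulVec, bcMatrix, ← Matrix.mulVec_mulVec,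
      hα.twist_vsharp, ← D'.vsharp_mulVec (g.matrix_adm nb nb'), ← comp_mulVec]
    obtain ⟨x, rfl⟩ := nb.e.surjective v
    rw [← nb.map_F, ← g.matrix_mulVec, ← g.matrix_mulVec, ← g.map_F, nb'.map_F]
  have h2 : ∀ v, D.MemQ v →
      (g.matrix nb nb' * bcMatrix α.toRingHom α.u nb.A) *ᵥ D'.vsharp₁ (α.toRingHom ∘ v) =
      (nb'.A * D'.sharp (g.matrix nb nb')) *ᵥ D'.vsharp₁ (α.toRingHom ∘ v) := by
    intro v hv
    rw [← Matrix.mulVec_mulVec, ← Matrix.mulVec_mulVec, bcMatrix, ← Matrix.mulVec_mulVec,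
      hα.twist_vsharp₁ hv, ← D'.vsharp₁_mulVec (g.matrix_adm nb nb')
        (fun i => hα.map_I _ (hv i)), Matrix.mulVec_smul, Matrix.mulVec_smul, ← comp_mulVec]
    obtain ⟨x, rfl⟩ := nb.e.surjective v
    have hx := (nb.mem_Q _).2 hv
    rw [← nb.map_F₁ ⟨x, hx⟩, ← g.matrix_mulVec, ← g.matrix_mulVec, ← map_smul, ← g.map_F₁ ⟨x, hx⟩,
      nb'.map_F₁]
  refine Matrix.ext_of_mulVec_single fun j => ?_
  rcases j with j | j
  · have h3 := h2 (Pi.single (Sum.inl j) 1) (D.memQ_single_inl j 1)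
    rwa [comp_single, D'.vsharp₁_single] at h3
  · have h3 := h1 (Pi.single (Sum.inr j) 1)
    rwa [comp_single, D'.vsharp_single] at h3

include hα in
theorem AlphaHom.exists_matrix_eq (X : Matrix (Fin c' ⊕ Fin d') (Fin c ⊕ Fin d) 𝓕'.S)
    (hX : D'.Adm X) (hXA : X * bcMatrix α.toRingHom α.u nb.A = nb'.A * D'.sharp X) :
    ∃ g : AlphaHom α 𝓟 𝓟', g.matrix nb nb' = X := by
  have hQ : ∀ x ∈ 𝓟.Q, nb'.e.symm (X *ᵥ (α.toRingHom ∘ nb.e x)) ∈ 𝓟'.Q := by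
    intro x hx
    rw [nb'.mem_Q, LinearEquiv.apply_symm_apply]
    exact hX.mulVec fun i => hα.map_I _ ((nb.mem_Q _).1 hx i)
  let g : AlphaHom α 𝓟 𝓟' :=
    { g :=
        { toFun := fun x => nb'.e.symm (X *ᵥ (α.toRingHom ∘ nb.e x))
          map_add' := fun x y => by
            rw [← map_add, ← Matrix.mulVec_add]
            congr 2
            ext i
            simp
          map_smul' := fun s x => by
            rw [← map_smul, ← Matrix.mulVec_smul]
            congr 2
            ext i
            simp }
      map_Q := hQ
      map_F := fun x => by
        apply nb'.e.injective
        change nb'.e (𝓟'.F (nb'.e.symm (X *ᵥ (α.toRingHom ∘ nb.e x)))) =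
          nb'.e (nb'.e.symm (X *ᵥ (α.toRingHom ∘ nb.e (𝓟.F x))))
        rw [nb'.map_F, LinearEquiv.apply_symm_apply, LinearEquiv.apply_symm_apply, nb.map_F,
          comp_mulVec, ← hα.twist_vsharp, D'.vsharp_mulVec hX, Matrix.mulVec_mulVec,
          Matrix.mulVec_mulVec, Matrix.mulVec_mulVec, ← hXA, bcMatrix, Matrix.mul_assoc]
      map_F₁ := fun x => by
        apply nb'.e.injective
        rw [nb'.map_F₁, map_smul]
        change nb'.A *ᵥ D'.vsharp₁ (nb'.e (nb'.e.symm (X *ᵥ (α.toRingHom ∘ nb.e x)))) =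
          (α.u : 𝓕'.S) • nb'.e (nb'.e.symm (X *ᵥ (α.toRingHom ∘ nb.e (𝓟.F₁ x))))
        rw [LinearEquiv.apply_symm_apply, LinearEquiv.apply_symm_apply, nb.map_F₁,
          comp_mulVec, ← Matrix.mulVec_smul, ← Matrix.mulVec_smul,
          ← hα.twist_vsharp₁ ((nb.mem_Q _).1 x.2), D'.vsharp₁_mulVec hX
            (fun i => hα.map_I _ ((nb.mem_Q _).1 x.2 i)), Matrix.mulVec_mulVec,
          Matrix.mulVec_mulVec, Matrix.mulVec_mulVec, ← hXA, bcMatrix, Matrix.mul_assoc] }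
  refine ⟨g, ?_⟩
  ext i j
  change nb'.e (nb'.e.symm (X *ᵥ (α.toRingHom ∘ nb.e (nb.e.symm (Pi.single j 1))))) i = X i j
  rw [LinearEquiv.apply_symm_apply, LinearEquiv.apply_symm_apply, comp_single]
  simp

theorem AlphaHom.matrix_injective :
    Function.Injective fun g : AlphaHom α 𝓟 𝓟' => g.matrix nb nb' := by
  intro g h hgh
  ext x
  apply nb'.e.injective
  rw [g.matrix_mulVec nb nb', h.matrix_mulVec nb nb']
  simp only at hgh
  rw [hgh]

end Alpha

/-- The identity of a frame. -/
def FrameHom.id (𝓕 : Frame.{u} p) : FrameHom 𝓕 𝓕 where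
  toRingHom := RingHom.id 𝓕.S
  u := 1
  map_I := fun _ h => h
  map_σ := fun _ => rfl
  map_σ₁ := fun a => by simp

theorem isWinHom_id (D : WinData 𝓕.S) : IsWinHom D D (RingHom.id 𝓕.S) 1 where
  map_I := fun _ h => h
  map_σ := fun _ => rfl
  map_τ := fun a _ => by simp
  map_θ := by simp

theorem bcMatrix_id (A : Matrix (Fin c ⊕ Fin d) (Fin c ⊕ Fin d) 𝓕.S) :
    bcMatrix (RingHom.id 𝓕.S) 1 A = A := by
  rw [bcMatrix, twist_one, Matrix.mul_one]
  rfl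

/-- A homomorphism of windows over `𝓕` as a homomorphism over the identity of `𝓕`. -/
def homEquivAlpha (𝓟 𝓟' : Window 𝓕) : (𝓟 ⟶ 𝓟') ≃ AlphaHom (FrameHom.id 𝓕) 𝓟 𝓟' where
  toFun h :=
    { g := Window.Hom.g h
      map_Q := Window.Hom.map_Q h
      map_F := Window.Hom.map_F h
      map_F₁ := fun x => (Window.Hom.map_F₁ h x).trans (one_smul _ _).symm }
  invFun h :=
    { g := h.g
      map_Q := h.map_Q
      map_F := h.map_F
      map_F₁ := fun x => (h.map_F₁ x).trans (one_smul _ _) }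
  left_inv _ := rfl
  right_inv _ := rfl

section Hom

variable {𝓟 𝓟' : Window 𝓕} (nb : NormalBasis D 𝓟 c d) (nb' : NormalBasis D 𝓟' c' d')

/-- The matrix of a homomorphism of windows with respect to normal bases. -/
noncomputable def homMatrix (h : 𝓟 ⟶ 𝓟') : Matrix (Fin c' ⊕ Fin d') (Fin c ⊕ Fin d) 𝓕.S :=
  (homEquivAlpha 𝓟 𝓟' h).matrix nb nb'

theorem homMatrix_mulVec (h : 𝓟 ⟶ 𝓟') (x : 𝓟.P) :
    nb'.e (Window.Hom.g h x) = homMatrix nb nb' h *ᵥ nb.e x :=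
  (homEquivAlpha 𝓟 𝓟' h).matrix_mulVec nb nb' x

theorem homMatrix_adm (h : 𝓟 ⟶ 𝓟') : D.Adm (homMatrix nb nb' h) :=
  (homEquivAlpha 𝓟 𝓟' h).matrix_adm nb nb'

theorem homMatrix_comm (h : 𝓟 ⟶ 𝓟') :
    homMatrix nb nb' h * nb.A = nb'.A * D.sharp (homMatrix nb nb' h) := by
  have h1 := (homEquivAlpha 𝓟 𝓟' h).matrix_comm nb nb' (isWinHom_id D)
  rwa [show bcMatrix (FrameHom.id 𝓕).toRingHom (FrameHom.id 𝓕).u nb.A = nb.A from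
    bcMatrix_id nb.A] at h1

theorem exists_homMatrix_eq (X : Matrix (Fin c' ⊕ Fin d') (Fin c ⊕ Fin d) 𝓕.S)
    (hX : D.Adm X) (hXA : X * nb.A = nb'.A * D.sharp X) :
    ∃ h : 𝓟 ⟶ 𝓟', homMatrix nb nb' h = X := by
  obtain ⟨g, hg⟩ := AlphaHom.exists_matrix_eq (α := FrameHom.id 𝓕) nb nb' (isWinHom_id D) X hX (by
    rwa [show bcMatrix (FrameHom.id 𝓕).toRingHom (FrameHom.id 𝓕).u nb.A = nb.A from
      bcMatrix_id nb.A])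
  exact ⟨(homEquivAlpha 𝓟 𝓟').symm g, by rw [homMatrix, Equiv.apply_symm_apply, hg]⟩

theorem homMatrix_injective : Function.Injective (homMatrix nb nb') :=
  (AlphaHom.matrix_injective nb nb').comp (homEquivAlpha 𝓟 𝓟').injective

end Hom

/-! ### The universal property of base change and the matrix criterion for crystalline homomorphisms
-/

section Composition

variable {α : FrameHom 𝓕 𝓕'} 

theorem AlphaHom.matrix_postcomp {𝓟 : Window 𝓕} {𝓟' 𝓟'' : Window 𝓕'}
    (nb : NormalBasis D 𝓟 c d) (nb' : NormalBasis D' 𝓟' c' d') (nb'' : NormalBasis D' 𝓟'' c'' d'')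
    (g : AlphaHom α 𝓟 𝓟') (h : 𝓟' ⟶ 𝓟'') :
    (g.postcomp h).matrix nb nb'' = homMatrix nb' nb'' h * g.matrix nb nb' := by
  refine Matrix.ext_of_mulVec_single fun j => ?_
  rw [← comp_single α.toRingHom, ← nb.e.apply_symm_apply (Pi.single j 1), ← AlphaHom.matrix_mulVec,
    ← Matrix.mulVec_mulVec, ← AlphaHom.matrix_mulVec, ← homMatrix_mulVec]
  rfl

theorem AlphaHom.matrix_precomp {𝓟₀ 𝓟 : Window 𝓕} {𝓟' : Window 𝓕'}
    (nb₀ : NormalBasis D 𝓟₀ c'' d'') (nb : NormalBasis D 𝓟 c d) (nb' : NormalBasis D' 𝓟' c' d')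
    (h : 𝓟₀ ⟶ 𝓟) (g : AlphaHom α 𝓟 𝓟') :
    (AlphaHom.precomp h g).matrix nb₀ nb' =
      g.matrix nb nb' * (homMatrix nb₀ nb h).map α.toRingHom := by
  refine Matrix.ext_of_mulVec_single fun j => ?_
  rw [← comp_single α.toRingHom, ← nb₀.e.apply_symm_apply (Pi.single j 1),
    ← AlphaHom.matrix_mulVec, ← Matrix.mulVec_mulVec, ← comp_mulVec, ← homMatrix_mulVec,
    ← AlphaHom.matrix_mulVec]
  rfl

/-- An `α`-homomorphism given by an invertible matrix has the universal property of base change. -/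
theorem AlphaHom.bijective_postcomp [IsLocalRing 𝓕'.S] (hI : D'.I ≤ IsLocalRing.maximalIdeal 𝓕'.S)
    (hD' : D'.IsDataOf)
    (hα : IsWinHom D D' α.toRingHom α.u) {𝓟 : Window 𝓕} {𝓟' : Window 𝓕'}
    (nb : NormalBasis D 𝓟 c d) (nb' : NormalBasis D' 𝓟' c d) (g : AlphaHom α 𝓟 𝓟')
    (hg : IsUnit (g.matrix nb nb')) (𝓟'' : Window 𝓕') :
    Function.Bijective fun h : 𝓟' ⟶ 𝓟'' => g.postcomp h := by
  obtain ⟨c'', d'', ⟨nb''⟩⟩ := exists_normalBasis hD' 𝓟''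
  obtain ⟨Y, hXY⟩ := hg.exists_right_inv
  have hYX := mul_eq_one_comm.1 hXY
  have hX := g.matrix_adm nb nb'
  have hY := D'.adm_of_mul_eq_one hI hX hYX
  constructor
  · intro h₁ h₂ h
    apply homMatrix_injective nb' nb''
    have h1 := congrArg (fun k => AlphaHom.matrix nb nb'' k * Y) h
    simpa only [matrix_postcomp nb nb' nb'', Matrix.mul_assoc, hXY, Matrix.mul_one] using h1
  · intro k
    have h1 := k.matrix_comm nb nb'' hα
    have h2 := g.matrix_comm nb nb' hα
    have h3 := k.matrix_adm nb nb''
    obtain ⟨h, hh⟩ := exists_homMatrix_eq nb' nb'' (k.matrix nb nb'' * Y) (h3.mul hY) (by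
      -- As `sharp` is multiplicative on admissible matrices, the inverse `Y` satisfies the
      -- commutation relation in the opposite direction.
      have h4 : Y * nb'.A = bcMatrix α.toRingHom α.u nb.A * D'.sharp Y := by
        have h5 : D'.sharp (g.matrix nb nb') * D'.sharp Y = 1 := by
          rw [← D'.sharp_mul hX hY, hXY, D'.sharp_one]
        calc Y * nb'.A = Y * (nb'.A * D'.sharp (g.matrix nb nb')) * D'.sharp Y := by
              rw [Matrix.mul_assoc, Matrix.mul_assoc, h5, Matrix.mul_one]
          _ = bcMatrix α.toRingHom α.u nb.A * D'.sharp Y := by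
              rw [← h2, ← Matrix.mul_assoc, hYX, Matrix.one_mul]
      rw [Matrix.mul_assoc, h4, ← Matrix.mul_assoc, h1, D'.sharp_mul h3 hY, Matrix.mul_assoc])
    refine ⟨h, AlphaHom.matrix_injective nb nb'' ?_⟩
    simp only
    rw [matrix_postcomp nb nb' nb'', hh, Matrix.mul_assoc, hYX, Matrix.mul_one]

theorem AlphaHom.postcomp_comp {𝓟 : Window 𝓕} {𝓟₁ 𝓟₂ 𝓟₃ : Window 𝓕'}
    (g : AlphaHom α 𝓟 𝓟₁) (h : 𝓟₁ ⟶ 𝓟₂) (k : 𝓟₂ ⟶ 𝓟₃) :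
    g.postcomp (h ≫ k) = (g.postcomp h).postcomp k := rfl

/-- Objects with the universal property of base change define a base change functor. -/
noncomputable def baseChangeOfUniversal (obj : Window 𝓕 → Window 𝓕')
    (unit : ∀ 𝓟, AlphaHom α 𝓟 (obj 𝓟))
    (h : ∀ 𝓟 𝓟', Function.Bijective fun h : obj 𝓟 ⟶ 𝓟' => (unit 𝓟).postcomp h) :
    BaseChange α where
  functor :=
    { obj := obj
      map := fun {𝓟₁ 𝓟₂} f => ((h 𝓟₁ _).2 (AlphaHom.precomp f (unit 𝓟₂))).choose
      map_id := fun 𝓟 => (h 𝓟 _).1 (((h 𝓟 _).2 (AlphaHom.precomp (𝟙 𝓟) (unit 𝓟))).choose_spec)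
      map_comp := fun {𝓟₁ 𝓟₂ 𝓟₃} f g => (h 𝓟₁ _).1 (by
        have h1 := ((h 𝓟₁ _).2 (AlphaHom.precomp f (unit 𝓟₂))).choose_spec
        have h2 := ((h 𝓟₂ _).2 (AlphaHom.precomp g (unit 𝓟₃))).choose_spec
        refine ((h 𝓟₁ _).2 (AlphaHom.precomp (f ≫ g) (unit 𝓟₃))).choose_spec.trans ?_
        simp only at h1 h2 ⊢
        rw [AlphaHom.postcomp_comp, h1]
        exact (congrArg (AlphaHom.precomp f) h2).symm) }
  unit := unit
  naturality := fun {𝓟₁ 𝓟₂} f => ((h 𝓟₁ _).2 (AlphaHom.precomp f (unit 𝓟₂))).choose_spec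
  bijective := h

/-- A homomorphism of local frames is crystalline if the base change of matrices is fully faithful
and essentially surjective. -/
theorem isCrystalline_of_matrices [IsLocalRing 𝓕.S] [IsLocalRing 𝓕'.S] (hD : D.IsDataOf)
    (hD' : D'.IsDataOf)
    (hα : IsWinHom D D' α.toRingHom α.u) (hff : FullyFaithful D D' α.toRingHom α.u)
    (hes : EssentiallySurjective D' α.toRingHom α.u) : IsCrystalline α := by
  have hI : D'.I ≤ IsLocalRing.maximalIdeal 𝓕'.S := by
    rw [hD'.I_eq, ← IsLocalRing.jacobson_eq_maximalIdeal ⊥ bot_ne_top]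
    exact le_sup_left.trans 𝓕'.le_jacobson
  choose c d nb using fun 𝓟 : Window 𝓕 => exists_normalBasis hD 𝓟
  replace nb := fun 𝓟 => (nb 𝓟).some
  -- The base change is the standard window of the matrix `bcMatrix`, and the universal homomorphism
  -- is the one whose matrix is the identity.
  let obj : Window 𝓕 → Window 𝓕' := fun 𝓟 =>
    stdWindow hD' (bcMatrix α.toRingHom α.u (nb 𝓟).A) (isUnit_bcMatrix _ _ (nb 𝓟).isUnit)
  let nb' : ∀ 𝓟, NormalBasis D' (obj 𝓟) (c 𝓟) (d 𝓟) := fun 𝓟 =>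
    stdNormalBasis hD' (bcMatrix α.toRingHom α.u (nb 𝓟).A) (isUnit_bcMatrix _ _ (nb 𝓟).isUnit)
  have hunit : ∀ 𝓟, ∃ g : AlphaHom α 𝓟 (obj 𝓟), g.matrix (nb 𝓟) (nb' 𝓟) = 1 := fun 𝓟 =>
    AlphaHom.exists_matrix_eq (nb 𝓟) (nb' 𝓟) hα 1 D'.adm_one (by
      rw [D'.sharp_one, Matrix.one_mul, Matrix.mul_one]
      rfl)
  choose unit hunit using hunit
  have huniv : ∀ 𝓟 𝓟', Function.Bijective fun h : obj 𝓟 ⟶ 𝓟' => (unit 𝓟).postcomp h :=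
    fun 𝓟 𝓟' => AlphaHom.bijective_postcomp hI hD' hα (nb 𝓟) (nb' 𝓟) (unit 𝓟)
      (by rw [hunit]; exact isUnit_one) 𝓟'
  let T := baseChangeOfUniversal obj unit huniv
  -- Since the units have matrix `1`, naturality says that the functor applies `α` to the entries of
  -- the matrix of a homomorphism.
  have hmap : ∀ {𝓟₁ 𝓟₂ : Window 𝓕} (f : 𝓟₁ ⟶ 𝓟₂),
      homMatrix (nb' 𝓟₁) (nb' 𝓟₂) (T.functor.map f) =
        (homMatrix (nb 𝓟₁) (nb 𝓟₂) f).map α.toRingHom := by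
    intro 𝓟₁ 𝓟₂ f
    have h1 := ((unit 𝓟₁).matrix_postcomp (nb 𝓟₁) (nb' 𝓟₁) (nb' 𝓟₂) (T.functor.map f)).symm.trans
      ((congrArg (AlphaHom.matrix (nb 𝓟₁) (nb' 𝓟₂)) (T.naturality f)).trans
        (AlphaHom.matrix_precomp (nb 𝓟₁) (nb 𝓟₂) (nb' 𝓟₂) f (unit 𝓟₂)))
    rwa [hunit, hunit, Matrix.one_mul, Matrix.mul_one] at h1
  have hkey : ∀ {𝓟₁ 𝓟₂ : Window 𝓕} (g : obj 𝓟₁ ⟶ obj 𝓟₂),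
      ∃! X, D.Adm X ∧ X * (nb 𝓟₁).A = (nb 𝓟₂).A * D.sharp X ∧
        X.map α.toRingHom = homMatrix (nb' 𝓟₁) (nb' 𝓟₂) g := fun {𝓟₁ 𝓟₂} g =>
    hff _ _ _ _ _ _ (nb 𝓟₁).isUnit (nb 𝓟₂).isUnit _ (homMatrix_adm _ _ g)
      (homMatrix_comm (nb' 𝓟₁) (nb' 𝓟₂) g)
  refine ⟨T, ?_⟩
  have hfaith : T.functor.Faithful := ⟨fun {𝓟₁ 𝓟₂} f g h => by
    apply homMatrix_injective (nb 𝓟₁) (nb 𝓟₂)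
    refine (hkey (T.functor.map f)).unique ⟨homMatrix_adm _ _ f, homMatrix_comm _ _ f, ?_⟩
      ⟨homMatrix_adm _ _ g, homMatrix_comm _ _ g, ?_⟩
    · exact (hmap f).symm
    · rw [h]; exact (hmap g).symm⟩
  have hfull : T.functor.Full := ⟨fun {𝓟₁ 𝓟₂} g => by
    obtain ⟨X, ⟨hX, hXA, hXg⟩, -⟩ := hkey g
    obtain ⟨f, hf⟩ := exists_homMatrix_eq (nb 𝓟₁) (nb 𝓟₂) X hX hXA
    refine ⟨f, homMatrix_injective (nb' 𝓟₁) (nb' 𝓟₂) ?_⟩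
    rw [hmap, hf, hXg]⟩
  have hess : T.functor.EssSurj := ⟨fun 𝓟' => by
    obtain ⟨c', d', ⟨nb₁⟩⟩ := exists_normalBasis hD' 𝓟'
    obtain ⟨A, X, hA, hX, hXa, hXA⟩ := hes c' d' nb₁.A nb₁.isUnit
    obtain ⟨g, hg⟩ := AlphaHom.exists_matrix_eq (stdNormalBasis hD A hA) nb₁ hα X hXa hXA
    -- The matrix of `g` is invertible, so `g` is also universal. Hence `𝓟'` and the base change of
    -- the standard window of `A` represent the same functor and are isomorphic.
    have hguniv := fun 𝓟'' => AlphaHom.bijective_postcomp hI hD' hα (stdNormalBasis hD A hA) nb₁ g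
      (by rwa [hg]) 𝓟''
    let 𝓟 := stdWindow hD A hA
    obtain ⟨a, ha⟩ := (huniv 𝓟 𝓟').2 g
    obtain ⟨b, hb⟩ := (hguniv (obj 𝓟)).2 (unit 𝓟)
    simp only at ha hb
    refine ⟨𝓟, ⟨⟨a, b, (huniv 𝓟 _).1 ?_, (hguniv _).1 ?_⟩⟩⟩
    · exact (congrArg (fun k => AlphaHom.postcomp k b) ha).trans hb
    · exact (congrArg (fun k => AlphaHom.postcomp k a) hb).trans ha⟩
  exact { }

end Composition

end HomMatrices

end LauFrames

namespace LauFrames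

/-! ### Deformation of windows along nilpotent thickenings -/

section Thickening

open Matrix

theorem Matrix.mul_apply_mem_right {S l m n : Type*} [CommRing S] [Fintype m] (J : Ideal S)
    (B : Matrix l m S) {Y : Matrix m n S} (hY : ∀ i j, Y i j ∈ J) (i : l) (j : n) :
    (B * Y) i j ∈ J := by
  rw [Matrix.mul_apply]
  exact Ideal.sum_mem _ fun k _ => Ideal.mul_mem_left _ _ (hY k j)

theorem Matrix.mul_apply_mem_left {S l m n : Type*} [CommRing S] [Fintype m] (J : Ideal S)
    {Y : Matrix l m S} (hY : ∀ i j, Y i j ∈ J) (B : Matrix m n S) (i : l) (j : n) :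
    (Y * B) i j ∈ J := by
  rw [Matrix.mul_apply]
  exact Ideal.sum_mem _ fun k _ => Ideal.mul_mem_right _ _ (hY i k)

theorem exists_matrix_map_eq {S T m n : Type*} [CommRing S] [CommRing T] {q : S →+* T}
    (hq : Function.Surjective q) (Y : Matrix m n T) : ∃ X : Matrix m n S, X.map q = Y := by
  choose f hf using hq
  exact ⟨Y.map f, by ext i j; exact hf _⟩

theorem isUnit_of_isUnit_map {S T n : Type*} [CommRing S] [CommRing T] [Fintype n] [DecidableEq n]
    (q : S →+* T) [IsLocalHom q] {A : Matrix n n S} (h : IsUnit (A.map q)) : IsUnit A := by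
  rw [Matrix.isUnit_iff_isUnit_det] at h ⊢
  refine isUnit_of_map_unit q _ ?_
  rwa [RingHom.map_det]

/-- A surjective strict homomorphism of frames `q` which induces an isomorphism `R ≅ R'`, such that
on the kernel `σ` is zero and `σ₁` is elementwise nilpotent. -/
structure IsNilThickening {S S₀ : Type*} [CommRing S] [CommRing S₀] (D : WinData S)
    (D₀ : WinData S₀) (q : S →+* S₀) : Prop where
  surj : Function.Surjective q
  hom : IsWinHom D D₀ q 1
  mem_I : ∀ x, q x ∈ D₀.I → x ∈ D.I
  σ_ker : ∀ x, q x = 0 → D.σ x = 0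
  nil : ∀ x, q x = 0 → ∃ n, D.τ^[n] x = 0

/-! ### Unique lifting of homomorphisms along a nilpotent thickening -/

namespace IsNilThickening

variable {S S₀ : Type*} [CommRing S] [CommRing S₀] {D : WinData S} {D₀ : WinData S₀} {q : S →+* S₀}
variable (h : IsNilThickening D D₀ q)

include h in
theorem ker_le {x : S} (hx : q x = 0) : x ∈ D.I := h.mem_I _ (hx ▸ zero_mem _)

include h in
theorem map_τ {x : S} (hx : x ∈ D.I) : q (D.τ x) = D₀.τ (q x) := by
  rw [h.hom.map_τ x hx, Units.val_one, one_mul]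

include h in
theorem τ_mem_ker {x : S} (hx : q x = 0) : q (D.τ x) = 0 := by
  rw [h.map_τ (h.ker_le hx), hx, D₀.τ_zero]

/-- The ideal of all elements of the kernel annihilated by the `n`-th iterate of `σ₁`. -/
def kerNil (n : ℕ) : Ideal S where
  carrier := {x | q x = 0 ∧ D.τ^[n] x = 0}
  zero_mem' := ⟨map_zero q, Function.iterate_fixed D.τ_zero n⟩
  add_mem' := fun {x y} hx hy => by
    refine ⟨by rw [map_add, hx.1, hy.1, add_zero], ?_⟩
    obtain ⟨hx, hx'⟩ := hx
    obtain ⟨hy, hy'⟩ := hy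
    induction n generalizing x y with
    | zero => simp_all
    | succ n ih =>
      rw [Function.iterate_succ_apply] at hx' hy' ⊢
      rw [D.τ_add x (h.ker_le hx) y (h.ker_le hy)]
      exact ih (h.τ_mem_ker hx) hx' (h.τ_mem_ker hy) hy'
  smul_mem' := fun s x hx => by
    refine ⟨by rw [smul_eq_mul, map_mul, hx.1, mul_zero], ?_⟩
    obtain ⟨hx, hx'⟩ := hx
    induction n generalizing s x with
    | zero => simp_all
    | succ n ih =>
      rw [Function.iterate_succ_apply] at hx' ⊢
      rw [smul_eq_mul, D.τ_mul s x (h.ker_le hx)]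
      exact ih (D.σ s) _ (h.τ_mem_ker hx) hx'

theorem kerNil_zero {x : S} (hx : x ∈ h.kerNil 0) : x = 0 := hx.2

theorem kerNil_mono {m n : ℕ} (hmn : m ≤ n) : h.kerNil m ≤ h.kerNil n := by
  intro x hx
  refine ⟨hx.1, ?_⟩
  obtain ⟨k, rfl⟩ := Nat.exists_eq_add_of_le' hmn
  rw [Function.iterate_add_apply, hx.2, Function.iterate_fixed D.τ_zero]

theorem τ_mem_kerNil {n : ℕ} {x : S} (hx : x ∈ h.kerNil (n + 1)) : D.τ x ∈ h.kerNil n :=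
  ⟨h.τ_mem_ker hx.1, hx.2⟩

theorem exists_kerNil {m n : Type*} [Finite m] [Finite n] (Y : Matrix m n S)
    (hY : Y.map q = 0) : ∃ N, ∀ i j, Y i j ∈ h.kerNil N := by
  have h1 : ∀ i j, q (Y i j) = 0 := fun i j => congrFun (congrFun hY i) j
  choose f hf using fun ij : m × n => h.nil _ (h1 ij.1 ij.2)
  obtain ⟨N, hN⟩ := (Set.finite_range f).bddAbove
  exact ⟨N, fun i j => h.kerNil_mono (hN ⟨(i, j), rfl⟩) ⟨h1 i j, hf (i, j)⟩⟩

variable {c d c' d' : Type*}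

theorem adm_of_ker {Y : Matrix (c' ⊕ d') (c ⊕ d) S} {n : ℕ} (hY : ∀ i j, Y i j ∈ h.kerNil n) :
    D.Adm Y := fun i j => h.ker_le (hY _ _).1

/-- Three blocks of `sharp Y` vanish because `σ` kills the kernel; in the remaining one `τ` lowers
the order of nilpotency by one. -/
theorem sharp_mem_kerNil {Y : Matrix (c' ⊕ d') (c ⊕ d) S} {n : ℕ}
    (hY : ∀ i j, Y i j ∈ h.kerNil (n + 1)) (i j) : D.sharp Y i j ∈ h.kerNil n := by
  rcases i with i | i <;> rcases j with j | j
  · rw [D.sharp_inl_inl, h.σ_ker _ (hY _ _).1]; exact zero_mem _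
  · rw [D.sharp_inl_inr, h.σ_ker _ (hY _ _).1, mul_zero]; exact zero_mem _
  · exact h.τ_mem_kerNil (hY _ _)
  · rw [D.sharp_inr_inr, h.σ_ker _ (hY _ _).1]; exact zero_mem _

include h in
theorem sharp_map {X : Matrix (c' ⊕ d') (c ⊕ d) S} (hX : D.Adm X) :
    (D.sharp X).map q = D₀.sharp (X.map q) := by
  have hθ : q D.θ = D₀.θ := by rw [h.hom.map_θ, Units.val_one, one_mul]
  ext (i | i) (j | j)
  · simp [h.hom.map_σ]
  · simp [h.hom.map_σ, hθ]
  · simp [h.map_τ (hX i j)]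
  · simp [h.hom.map_σ]

variable [Fintype c] [Fintype d] [DecidableEq c] [DecidableEq d] [Fintype c'] [Fintype d']
  {A : Matrix (c ⊕ d) (c ⊕ d) S} {B : Matrix (c' ⊕ d') (c' ⊕ d') S}

include h in
-- The relation reads `Y = B Y^♯ A⁻¹`, and each substitution lowers the order of nilpotency of the
-- entries by one.
theorem eq_zero_of_comm (hA : IsUnit A) {Y : Matrix (c' ⊕ d') (c ⊕ d) S} (hY : Y.map q = 0)
    (hYA : Y * A = B * D.sharp Y) : Y = 0 := by
  obtain ⟨N, hN⟩ := h.exists_kerNil Y hY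
  obtain ⟨A', hA'⟩ := hA.exists_right_inv
  have hY' : Y = B * D.sharp Y * A' := by rw [← hYA, Matrix.mul_assoc, hA', Matrix.mul_one]
  induction N with
  | zero => ext i j; exact h.kerNil_zero (hN i j)
  | succ N ih =>
    refine ih fun i j => ?_
    rw [hY']
    exact Matrix.mul_apply_mem_left _
      (Matrix.mul_apply_mem_right _ B (h.sharp_mem_kerNil hN)) A' i j

/-- Successive approximation: `E A⁻¹` solves the equation up to the error `B (E A⁻¹)^♯`, which has
smaller order of nilpotency, so finitely many corrections suffice. -/
theorem exists_sub_eq (hA : IsUnit A) {n : ℕ} {E : Matrix (c' ⊕ d') (c ⊕ d) S}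
    (hE : ∀ i j, E i j ∈ h.kerNil n) :
    ∃ Y : Matrix (c' ⊕ d') (c ⊕ d) S, (∀ i j, Y i j ∈ h.kerNil n) ∧ Y * A - B * D.sharp Y = E := by
  obtain ⟨A', hA'⟩ := hA.exists_left_inv
  induction n generalizing E with
  | zero =>
    have : E = 0 := by ext i j; exact h.kerNil_zero (hE i j)
    refine ⟨0, fun i j => zero_mem _, ?_⟩
    have h1 := D.sharp_sub (X := E) (Y := E) (h.adm_of_ker hE) (h.adm_of_ker hE)
    rw [sub_self, sub_self] at h1
    rw [this, h1]
    simp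
  | succ n ih =>
    have h1 := Matrix.mul_apply_mem_left _ hE A'
    obtain ⟨Y, hY, hYE⟩ := ih (Matrix.mul_apply_mem_right _ B (h.sharp_mem_kerNil h1))
    refine ⟨E * A' + Y, fun i j => add_mem (h1 i j) (h.kerNil_mono n.le_succ (hY i j)), ?_⟩
    rw [Matrix.add_mul, D.sharp_add (h.adm_of_ker h1) (h.adm_of_ker hY), Matrix.mul_add,
      add_sub_add_comm, hYE, Matrix.mul_assoc, hA', Matrix.mul_one, sub_add_cancel]

include h in
-- Every lift `X` of `X₀` is admissible because the ideal of the thickening is the full preimage of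
-- that of `D₀`. The defect `B X^♯ - X A` has entries in the kernel and is removed by
-- `exists_sub_eq`; uniqueness is `eq_zero_of_comm` for the difference of two solutions.
theorem existsUnique_lift (hA : IsUnit A) {X₀ : Matrix (c' ⊕ d') (c ⊕ d) S₀} (hX₀ : D₀.Adm X₀)
    (hXA : X₀ * A.map q = B.map q * D₀.sharp X₀) :
    ∃! X : Matrix (c' ⊕ d') (c ⊕ d) S, D.Adm X ∧ X * A = B * D.sharp X ∧ X.map q = X₀ := by
  have hadm : ∀ {X : Matrix (c' ⊕ d') (c ⊕ d) S}, X.map q = X₀ → D.Adm X := fun hX i j =>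
    h.mem_I _ (by rw [← hX] at hX₀; exact hX₀ i j)
  obtain ⟨X, hX⟩ := exists_matrix_map_eq h.surj X₀
  obtain ⟨N, hN⟩ := h.exists_kerNil (B * D.sharp X - X * A) (by
    rw [Matrix.map_sub _ (map_sub q), Matrix.map_mul, Matrix.map_mul, h.sharp_map (hadm hX), hX,
      hXA, sub_self])
  obtain ⟨Y, hY, hYE⟩ := h.exists_sub_eq (B := B) hA hN
  refine ⟨X + Y, ⟨(hadm hX).add (h.adm_of_ker hY), ?_, ?_⟩, ?_⟩
  · rw [D.sharp_add (hadm hX) (h.adm_of_ker hY), Matrix.add_mul, Matrix.mul_add]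
    rw [add_comm]
    exact sub_eq_sub_iff_add_eq_add.1 hYE
  · ext i j
    rw [Matrix.map_apply, Matrix.add_apply, map_add, (hY i j).1, add_zero, ← hX, Matrix.map_apply]
  · rintro Z ⟨hZ, hZA, hZX⟩
    have hXY : D.Adm (X + Y) := (hadm hX).add (h.adm_of_ker hY)
    refine sub_eq_zero.1 (h.eq_zero_of_comm (B := B) hA ?_ ?_)
    · ext i j
      rw [Matrix.map_apply, Matrix.sub_apply, Matrix.add_apply, map_sub, map_add, (hY i j).1,
        ← Matrix.map_apply (f := q), hZX, ← hX]
      simp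
    · rw [D.sharp_sub hZ hXY, Matrix.sub_mul, Matrix.mul_sub, hZA,
        D.sharp_add (hadm hX) (h.adm_of_ker hY), Matrix.add_mul, Matrix.mul_add]
      rw [add_comm (X * A), sub_eq_sub_iff_add_eq_add.1 hYE]

end IsNilThickening

/-- The data `Dt` extend the data `D` to a larger ideal. -/
structure WinData.Extends {S : Type*} [CommRing S] (D Dt : WinData S) : Prop where
  I_le : D.I ≤ Dt.I
  σ_eq : Dt.σ = D.σ
  θ_eq : Dt.θ = D.θ
  τ_eq : ∀ x ∈ D.I, Dt.τ x = D.τ x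

theorem WinData.Extends.sharp_eq {S c d c' d' : Type*} [CommRing S] {D Dt : WinData S}
    (h : D.Extends Dt) {X : Matrix (c' ⊕ d') (c ⊕ d) S} (hX : D.Adm X) :
    Dt.sharp X = D.sharp X := by
  ext (i | i) (j | j)
  · simp [h.σ_eq]
  · simp [h.σ_eq, h.θ_eq]
  · simp [h.τ_eq _ (hX i j)]
  · simp [h.σ_eq]

theorem bcMatrix_map {S₁ S₀ W₁ W₀ : Type*} [CommRing S₁] [CommRing S₀] [CommRing W₁] [CommRing W₀]
    {q : S₁ →+* S₀} {q' : W₁ →+* W₀} {ϰ₁ : S₁ →+* W₁} {ϰ₀ : S₀ →+* W₀} {u₁ : W₁ˣ} {u₀ : W₀ˣ}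
    (hq : ∀ x, q' (ϰ₁ x) = ϰ₀ (q x)) (hu : q' u₁ = u₀) {c d : Type*} [DecidableEq c] [DecidableEq d]
    [Fintype c] [Fintype d] (A : Matrix (c ⊕ d) (c ⊕ d) S₁) :
    (bcMatrix ϰ₁ u₁ A).map q' = bcMatrix ϰ₀ u₀ (A.map q) := by
  rw [bcMatrix, Matrix.map_mul, twist_map, bcMatrix]
  congr 1
  · ext i j
    exact hq _
  · congr 1
    ext
    exact hu

/-- A homomorphism `ϰ₁` of frames that lifts a homomorphism `ϰ₀`, together with extensions of its
source and target to thickenings of the source and target of `ϰ₀`. -/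
structure IsThickeningSquare {S₁ S₀ W₁ W₀ : Type*} [CommRing S₁] [CommRing S₀] [CommRing W₁]
    [CommRing W₀] (D₁ Dt : WinData S₁) (D₀ : WinData S₀) (D₁' Dt' : WinData W₁) (D₀' : WinData W₀)
    (q : S₁ →+* S₀) (q' : W₁ →+* W₀) (ϰ₁ : S₁ →+* W₁) (ϰ₀ : S₀ →+* W₀) (u₁ : W₁ˣ) (u₀ : W₀ˣ) :
    Prop where
  nil : IsNilThickening Dt D₀ q
  nil' : IsNilThickening Dt' D₀' q'
  comm : ∀ x, q' (ϰ₁ x) = ϰ₀ (q x)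
  map_u : q' u₁ = u₀
  ext : D₁.Extends Dt
  ext' : D₁'.Extends Dt'
  hom : IsWinHom Dt Dt' ϰ₁ u₁
  reflect : ∀ x, ϰ₁ x ∈ D₁'.I → x ∈ D₁.I
  τ_ker : ∀ x, q x = 0 → Dt.τ x = 0
  surj : ∀ y ∈ Dt'.I, ∃ z, q z = 0 ∧ y - ϰ₁ z ∈ D₁'.I

/-! ### Lifting windows and homomorphisms from a frame to its thickening -/

namespace IsThickeningSquare

variable {S₁ S₀ W₁ W₀ : Type*} [CommRing S₁] [CommRing S₀] [CommRing W₁]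
  [CommRing W₀] {D₁ Dt : WinData S₁} {D₀ : WinData S₀} {D₁' Dt' : WinData W₁} {D₀' : WinData W₀}
  {q : S₁ →+* S₀} {q' : W₁ →+* W₀} {ϰ₁ : S₁ →+* W₁} {ϰ₀ : S₀ →+* W₀} {u₁ : W₁ˣ} {u₀ : W₀ˣ}
  (h : IsThickeningSquare D₁ Dt D₀ D₁' Dt' D₀' q q' ϰ₁ ϰ₀ u₁ u₀)

include h in
-- The reduction of `X'` comes from a unique `X₀` by `hff`, and `X₀` has a unique lift `X` over the
-- thickened source. Both `ϰ₁(X)` and `X'` lift the same matrix over the thickened target, so they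
-- agree. Admissibility for the smaller ideal follows from `reflect`.
theorem fullyFaithful (hff : FullyFaithful D₀ D₀' ϰ₀ u₀) : FullyFaithful D₁ D₁' ϰ₁ u₁ := by
  intro c d c' d' A B hA hB X' hX' hXA'
  rw [← h.ext'.sharp_eq hX'] at hXA'
  have hX't : Dt'.Adm X' := fun i j => h.ext'.I_le (hX' i j)
  have h0 : D₀'.Adm (X'.map q') := h.nil'.hom.adm hX't
  have h0' : X'.map q' * bcMatrix ϰ₀ u₀ (A.map q) =
      bcMatrix ϰ₀ u₀ (B.map q) * D₀'.sharp (X'.map q') := by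
    rw [← bcMatrix_map h.comm h.map_u, ← bcMatrix_map h.comm h.map_u, ← h.nil'.sharp_map hX't,
      ← Matrix.map_mul, ← Matrix.map_mul, hXA']
  obtain ⟨X₀, ⟨hX₀, hXA₀, hX₀'⟩, huniq⟩ := hff c d c' d' (A.map q) (B.map q) (isUnit_map_matrix q hA)
    (isUnit_map_matrix q hB) _ h0 h0'
  obtain ⟨X, ⟨hX, hXA, hXX₀⟩, hXuniq⟩ := h.nil.existsUnique_lift hA hX₀ hXA₀
  have hmap : X.map ϰ₁ = X' := by
    have h1 := h.nil'.existsUnique_lift (B := bcMatrix ϰ₁ u₁ B) (isUnit_bcMatrix ϰ₁ u₁ hA) h0 (by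
      rw [← h.nil'.sharp_map hX't, ← Matrix.map_mul, ← Matrix.map_mul, hXA'])
    refine h1.unique ⟨h.hom.adm hX, h.hom.bcMatrix_comm hX hXA, ?_⟩ ⟨hX't, hXA', rfl⟩
    rw [← hX₀', ← hXX₀]
    ext i j
    exact h.comm _
  have hadm : D₁.Adm X := fun i j => h.reflect _ (by rw [← hmap] at hX'; exact hX' i j)
  refine ⟨X, ⟨hadm, by rw [← h.ext.sharp_eq hadm, hXA], hmap⟩, ?_⟩
  rintro Y ⟨hY, hYA, hYX⟩
  rw [← h.ext.sharp_eq hY] at hYA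
  have hYt : Dt.Adm Y := fun i j => h.ext.I_le (hY i j)
  refine hXuniq Y ⟨hYt, hYA, huniq _ ⟨h.nil.hom.adm hYt, ?_, ?_⟩⟩
  · rw [← h.nil.sharp_map hYt, ← Matrix.map_mul, ← Matrix.map_mul, hYA]
  · rw [← hYX]
    ext i j
    exact (h.comm _).symm

include h in
-- Over the thickened frames any lift `B` of `A₀` admits a unique lift `Y` of `X₀`, but the lower
-- left block of `Y` is only known to lie in the larger ideal: the Hodge filtrations may differ. The
-- remedy is to change the lift of the filtration on the source by a unipotent matrix `Z` congruent
-- to `1`, replacing `B` by `Z⁻¹ B` and `Y` by `Y ϰ₁(Z)`.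
theorem exists_lift [IsLocalRing W₁] (hI : Dt'.I ≤ IsLocalRing.maximalIdeal W₁) [IsLocalHom q]
    [IsLocalHom q'] {c d : Type*} [Fintype c] [Fintype d] [DecidableEq c] [DecidableEq d]
    (A' : Matrix (c ⊕ d) (c ⊕ d) W₁) (A₀ : Matrix (c ⊕ d) (c ⊕ d) S₀) (hA₀ : IsUnit A₀)
    (X₀ : Matrix (c ⊕ d) (c ⊕ d) W₀) (hX₀u : IsUnit X₀) (hX₀ : D₀'.Adm X₀)
    (hXA₀ : X₀ * bcMatrix ϰ₀ u₀ A₀ = A'.map q' * D₀'.sharp X₀) :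
    ∃ (A : Matrix (c ⊕ d) (c ⊕ d) S₁) (X : Matrix (c ⊕ d) (c ⊕ d) W₁), IsUnit A ∧ IsUnit X ∧
      D₁'.Adm X ∧ X * bcMatrix ϰ₁ u₁ A = A' * D₁'.sharp X ∧ A.map q = A₀ ∧ X.map q' = X₀ := by
  obtain ⟨B, rfl⟩ := exists_matrix_map_eq h.nil.surj A₀
  have hB : IsUnit B := isUnit_of_isUnit_map q hA₀
  obtain ⟨Y, ⟨hY, hYB, rfl⟩, -⟩ := h.nil'.existsUnique_lift (B := A') (isUnit_bcMatrix ϰ₁ u₁ hB) hX₀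
    (by rwa [bcMatrix_map h.comm h.map_u])
  have hYu : IsUnit Y := isUnit_of_isUnit_map q' hX₀u
  obtain ⟨V, hV⟩ := (Dt'.isUnit_blocks hI hY hYu).2.exists_right_inv
  -- The lower left block of `Y ϰ₁(Z)` will be `Y₂₂ (V Y₂₁ + ϰ₁(z))` with `V = Y₂₂⁻¹`; so `ϰ₁(z)`
  -- has to cancel `V Y₂₁` modulo the smaller ideal.
  choose z hz hz' using fun i j => h.surj (-(V * Y.toBlocks₂₁) i j)
    (neg_mem (Matrix.mul_apply_mem_right _ V hY i j))
  let Z : Matrix (c ⊕ d) (c ⊕ d) S₁ := Matrix.fromBlocks 1 0 (Matrix.of z) 1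
  have hZ : Dt.Adm Z := fun i j => h.nil.ker_le (hz i j)
  have hZq : Z.map q = 1 := by
    rw [← Matrix.fromBlocks_one, Matrix.fromBlocks_map]
    congr 1
    · exact Matrix.map_one q (map_zero q) (map_one q)
    · exact Matrix.map_zero q (map_zero q)
    · ext i j; exact hz i j
    · exact Matrix.map_one q (map_zero q) (map_one q)
  have hZu : IsUnit Z := isUnit_of_isUnit_map q (by rw [hZq]; exact isUnit_one)
  -- The only nontrivial entries of `Z` lie in the kernel of `q`, where `τ` vanishes; therefore
  -- modifying by `Z` does not disturb the commutation relation.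
  have hZs : Dt.sharp Z = 1 := by
    rw [← Dt.sharp_one]
    ext (i | i) (j | j)
    · simp [Z, Matrix.one_apply]
    · simp [Z]
    · change Dt.τ (z i j) = Dt.τ 0
      rw [h.τ_ker _ (hz i j), Dt.τ_zero]
    · simp [Z, Matrix.one_apply]
  obtain ⟨U, hU⟩ := hZu.exists_right_inv
  have hZ' : Dt'.Adm (Z.map ϰ₁) := h.hom.adm hZ
  -- This is transported along `ϰ₁`: the two factors `twist` in `IsWinHom.sharp_map` cancel.
  have hZs' : Dt'.sharp (Z.map ϰ₁) = 1 := by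
    have h1 := h.hom.sharp_map hZ
    rw [hZs, Matrix.map_one ϰ₁ (map_zero _) (map_one _), Matrix.one_mul] at h1
    exact (isUnit_twist c d u₁).mul_left_cancel (h1.trans (Matrix.mul_one _).symm)
  have hadm : D₁'.Adm (Y * Z.map ϰ₁) := by
    have h1 : (Y * Z.map ϰ₁).toBlocks₂₁ =
        Y.toBlocks₂₂ * (V * Y.toBlocks₂₁ + (Matrix.of z).map ϰ₁) := by
      rw [← Matrix.fromBlocks_toBlocks Y, Matrix.fromBlocks_map, Matrix.fromBlocks_multiply]
      simp only [Matrix.toBlocks_fromBlocks₂₁, Matrix.toBlocks_fromBlocks₂₂]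
      rw [Matrix.mul_add, ← Matrix.mul_assoc, hV, Matrix.one_mul,
        Matrix.map_one ϰ₁ (map_zero _) (map_one _), Matrix.mul_one]
    intro i j
    change (Y * Z.map ϰ₁).toBlocks₂₁ i j ∈ D₁'.I
    rw [h1]
    refine Matrix.mul_apply_mem_right _ _ (fun i j => ?_) i j
    have h2 := neg_mem (hz' i j)
    rwa [neg_sub, sub_neg_eq_add, add_comm] at h2
  refine ⟨U * B, Y * Z.map ϰ₁, ?_, hYu.mul (isUnit_map_matrix ϰ₁ hZu), hadm, ?_, ?_, ?_⟩
  · exact (IsUnit.of_mul_eq_one_right Z hU).mul hB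
  · rw [← h.ext'.sharp_eq hadm, Dt'.sharp_mul hY hZ', hZs', Matrix.mul_one, ← hYB, bcMatrix,
      bcMatrix, Matrix.map_mul, Matrix.mul_assoc, ← Matrix.mul_assoc (Z.map ϰ₁),
      ← Matrix.mul_assoc (Z.map ϰ₁), ← Matrix.map_mul, hU,
      Matrix.map_one ϰ₁ (map_zero _) (map_one _), Matrix.one_mul]
  · have h1 := congrArg (fun M => M.map q) hU
    simp only [Matrix.map_mul, hZq, Matrix.one_mul, Matrix.map_one q (map_zero _) (map_one _)] at h1
    rw [Matrix.map_mul, h1, Matrix.one_mul]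
  · have h1 : (Z.map ϰ₁).map q' = 1 := by
      rw [← Matrix.map_one ϰ₀ (map_zero _) (map_one _), ← hZq]
      ext i j
      exact h.comm _
    rw [Matrix.map_mul, h1, Matrix.mul_one]

end IsThickeningSquare

end Thickening

end LauFrames

namespace LauFrames

/-! ### Regular local rings -/

section Regular

open IsLocalRing

theorem WithBot.enat_le_of_add_one_le {a b : WithBot ℕ∞} (h : a + 1 ≤ b + 1) : a ≤ b := by
  induction a with
  | bot => exact bot_le
  | coe a =>
    induction b with
    | bot => simp at h
    | coe b =>
      norm_cast at h ⊢
      exact (ENat.add_le_add_iff_right (by simp)).1 h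

theorem WithBot.not_natCast_add_one_le (n : ℕ) : ¬ ((n : WithBot ℕ∞) + 1 ≤ n) := by
  norm_cast
  exact n.not_succ_le_self

/-- This is Krull's height theorem: the dimension is at most the minimal number of generators of the
maximal ideal. -/
theorem ringKrullDim_le_of_span_range {n : ℕ} {A : Type u} [CommRing A] [IsLocalRing A]
    [IsNoetherianRing A] (x : Fin n → A) (hx : Ideal.span (Set.range x) = maximalIdeal A) :
    ringKrullDim A ≤ n := by
  refine (ringKrullDim_le_spanFinrank_maximalIdeal A).trans ?_
  rw [← hx]
  have h1 := Submodule.spanFinrank_span_le_ncard_of_finite (R := A) (Set.finite_range x)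
  have h2 : (Set.range x).ncard ≤ n := by
    rw [← Set.image_univ]
    refine (Set.ncard_image_le Set.finite_univ).trans ?_
    simp [Set.ncard_univ]
  exact_mod_cast h1.trans h2

/-- The prime is the smallest member of a chain of primes of length `n`; the whole chain survives in
the quotient. -/
theorem exists_isPrime_le_ringKrullDim_quotient {A : Type u} [CommRing A] {n : ℕ}
    (h : (n : WithBot ℕ∞) ≤ ringKrullDim A) :
    ∃ q : Ideal A, q.IsPrime ∧ (n : WithBot ℕ∞) ≤ ringKrullDim (A ⧸ q) := by
  obtain ⟨l, hl⟩ := Order.le_krullDim_iff.1 h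
  refine ⟨l.head.asIdeal, l.head.2, ?_⟩
  rw [ringKrullDim_quotient]
  let l' : LTSeries (PrimeSpectrum.zeroLocus (R := A) (l.head.asIdeal : Set A)) :=
    { length := l.length
      toFun := fun i => ⟨l i, l.head_le i⟩
      step := fun i => l.step i }
  rw [← hl]
  exact Order.LTSeries.length_le_krullDim l'

/-- A Noetherian local ring of dimension at least `n` whose maximal ideal has `n` generators is a
domain. -/
theorem isDomain_of_span_range_eq_maximalIdeal (n : ℕ) (A : Type u) [CommRing A] [IsLocalRing A]
    [IsNoetherianRing A] (x : Fin n → A) (hx : Ideal.span (Set.range x) = maximalIdeal A)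
    (hn : (n : WithBot ℕ∞) ≤ ringKrullDim A) : IsDomain A := by
  induction n generalizing A with
  | zero =>
    have h1 : maximalIdeal A = ⊥ := by
      rw [← hx, Set.range_eq_empty, Ideal.span_empty]
    exact ((isField_iff_maximalIdeal_eq).2 h1).isDomain
  | succ n ih =>
    have hx0 : x 0 ∈ maximalIdeal A := hx ▸ Ideal.subset_span ⟨0, rfl⟩
    have hsp : Ideal.span {x 0} ≤ maximalIdeal A := (Ideal.span_singleton_le_iff_mem _).2 hx0
    have : Nontrivial (A ⧸ Ideal.span {x 0}) := Ideal.Quotient.nontrivial_iff.2 fun h =>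
      (maximalIdeal.isMaximal A).ne_top (top_le_iff.1 (h ▸ hsp))
    have : IsLocalRing (A ⧸ Ideal.span {x 0}) :=
      IsLocalRing.of_surjective' (Ideal.Quotient.mk _) Ideal.Quotient.mk_surjective
    have hgen : Ideal.span (Set.range fun i : Fin n => Ideal.Quotient.mk (Ideal.span {x 0})
        (x i.succ)) = maximalIdeal (A ⧸ Ideal.span {x 0}) := by
      rw [← IsLocalRing.map_maximalIdeal_of_surjective (Ideal.Quotient.mk (Ideal.span {x 0}))
        Ideal.Quotient.mk_surjective, ← hx, Ideal.map_span]
      apply le_antisymm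
      · rw [Ideal.span_le]
        rintro _ ⟨i, rfl⟩
        exact Ideal.subset_span ⟨_, ⟨i.succ, rfl⟩, rfl⟩
      · rw [Ideal.span_le]
        rintro _ ⟨_, ⟨i, rfl⟩, rfl⟩
        refine Fin.cases ?_ (fun i => ?_) i
        · rw [Ideal.Quotient.eq_zero_iff_mem.2 (Ideal.mem_span_singleton_self (x 0))]
          exact zero_mem _
        · exact Ideal.subset_span ⟨i, rfl⟩
    have hstep : ∀ (B : Type u) [CommRing B] [IsLocalRing B] [IsNoetherianRing B] (y : B),
        y ∈ maximalIdeal B → ringKrullDim B ≤ ringKrullDim (B ⧸ Ideal.span {y}) + 1 := by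
      intro B _ _ _ y hy
      have h1 := ringKrullDim_le_ringKrullDim_quotient_add_card {y} (by
        rw [IsLocalRing.ringJacobson_eq_maximalIdeal]
        simpa using hy)
      rwa [Finset.coe_singleton, Finset.card_singleton, Nat.cast_one] at h1
    have hdim := ringKrullDim_le_of_span_range _ hgen
    -- Dividing by `x 0` removes one generator and lowers the dimension by at most one, so the
    -- induction hypothesis applies.
    have hdom : IsDomain (A ⧸ Ideal.span {x 0}) := ih _ _ hgen
      (WithBot.enat_le_of_add_one_le ((by exact_mod_cast hn : ((n : WithBot ℕ∞) + 1 ≤ _)).trans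
        (hstep A (x 0) hx0)))
    -- The aim is to show that this prime `q`, whose quotient has dimension at least `n + 1`, is
    -- zero. It cannot contain `x 0`, since `A / (x 0)` has dimension at most `n`.
    obtain ⟨q, hq, hqd⟩ := exists_isPrime_le_ringKrullDim_quotient hn
    rw [Nat.cast_add, Nat.cast_one] at hqd
    have hxq : x 0 ∉ q := by
      intro h
      refine WithBot.not_natCast_add_one_le n (hqd.trans (le_trans ?_ hdim))
      exact ringKrullDim_le_of_surjective
        (Ideal.Quotient.factor ((Ideal.span_singleton_le_iff_mem _).2 h))
        (Ideal.Quotient.factor_surjective _)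
    have : IsLocalRing (A ⧸ q) :=
      IsLocalRing.of_surjective' (Ideal.Quotient.mk _) Ideal.Quotient.mk_surjective
    have hxm : Ideal.Quotient.mk q (x 0) ∈ maximalIdeal (A ⧸ q) := by
      rw [← IsLocalRing.map_maximalIdeal_of_surjective (Ideal.Quotient.mk q)
        Ideal.Quotient.mk_surjective]
      exact Ideal.mem_map_of_mem _ hx0
    have hC := WithBot.enat_le_of_add_one_le (hqd.trans (hstep (A ⧸ q) _ hxm))
    let f : A →+* (A ⧸ q) ⧸ Ideal.span {Ideal.Quotient.mk q (x 0)} :=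
      (Ideal.Quotient.mk _).comp (Ideal.Quotient.mk q)
    have hf : Function.Surjective f :=
      Ideal.Quotient.mk_surjective.comp Ideal.Quotient.mk_surjective
    let f₁ : A ⧸ Ideal.span {x 0} →+* (A ⧸ q) ⧸ Ideal.span {Ideal.Quotient.mk q (x 0)} :=
      Ideal.Quotient.lift _ f fun a ha => by
        obtain ⟨b, rfl⟩ := Ideal.mem_span_singleton.1 ha
        rw [map_mul]
        refine mul_eq_zero_of_left ?_ _
        exact Ideal.Quotient.eq_zero_iff_mem.2 (Ideal.mem_span_singleton_self _)
    have hf₁ : Function.Surjective f₁ := Ideal.Quotient.lift_surjective_of_surjective _ _ hf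
    -- The quotient of `A` by `q + (x 0)` still has dimension at least `n` and is a quotient of the
    -- domain `A / (x 0)` of dimension at most `n`. Hence nothing more is divided out, that is, `q ⊆
    -- (x 0)`.
    have hqx : q ≤ Ideal.span {x 0} := by
      intro y hy
      by_contra hyx
      have h1 : Ideal.Quotient.mk (Ideal.span {x 0}) y ≠ 0 := fun h =>
        hyx (Ideal.Quotient.eq_zero_iff_mem.1 h)
      have h2 := ringKrullDim_succ_le_of_surjective f₁ hf₁ (mem_nonZeroDivisors_of_ne_zero h1) (by
        change Ideal.Quotient.mk _ (Ideal.Quotient.mk q y) = 0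
        rw [Ideal.Quotient.eq_zero_iff_mem.2 hy, map_zero])
      refine WithBot.not_natCast_add_one_le n ?_
      exact (add_le_add_left hC 1).trans (h2.trans hdim)
    -- If `x 0 * z ∈ q` then `z ∈ q`, as `q` is prime and does not contain `x 0`. Thus `q = (x 0)
    -- q`, and Nakayama's lemma gives `q = 0`.
    have hqbot : q = ⊥ := by
      refine Submodule.eq_bot_of_le_smul_of_le_jacobson_bot (Ideal.span {x 0}) q
        (IsNoetherian.noetherian q) (fun y hy => ?_)
        (by rwa [IsLocalRing.jacobson_eq_maximalIdeal ⊥ bot_ne_top])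
      obtain ⟨z, rfl⟩ := Ideal.mem_span_singleton.1 (hqx hy)
      exact Submodule.smul_mem_smul (Ideal.mem_span_singleton_self _)
        ((hq.mem_or_mem hy).resolve_left hxq)
    rw [hqbot] at hq
    exact IsDomain.of_bot_isPrime A

/-- The source is a domain of dimension at most `n`; dividing out a nonzero element would give a
dimension strictly less than `n`. -/
theorem injective_of_surjective_of_le_ringKrullDim {n : ℕ} {A B : Type u} [CommRing A] [CommRing B]
    [IsLocalRing A] [IsNoetherianRing A] (x : Fin n → A)
    (hx : Ideal.span (Set.range x) = maximalIdeal A) (hn : (n : WithBot ℕ∞) ≤ ringKrullDim B)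
    (f : A →+* B) (hf : Function.Surjective f) : Function.Injective f := by
  have := isDomain_of_span_range_eq_maximalIdeal n A x hx
    (hn.trans (ringKrullDim_le_of_surjective f hf))
  rw [injective_iff_map_eq_zero]
  intro a ha
  by_contra h
  have h2 := ringKrullDim_succ_le_of_surjective f hf (mem_nonZeroDivisors_of_ne_zero h) ha
  exact WithBot.not_natCast_add_one_le n
    ((add_le_add_left hn 1).trans (h2.trans (ringKrullDim_le_of_span_range x hx)))

end Regular

/-! ### The ring `𝔖` and its quotient `R` -/

section Presentation

open IsLocalRing

section

variable (p : ℕ) [Fact p.Prime] (k : Type u) [Field k] (r : ℕ)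

theorem X_mem_J𝔖 (i : Fin r) : MvPowerSeries.X i ∈ J𝔖 p k r := Ideal.subset_span ⟨i, rfl⟩

theorem mem_J𝔖_iff (f : 𝔖 p k r) : f ∈ J𝔖 p k r ↔ MvPowerSeries.constantCoeff f = 0 := by
  have h := mem_J𝔖_pow p k r 1 f
  rw [pow_one] at h
  rw [h, Nat.cast_one, MvPowerSeries.one_le_order_iff_constCoeff_eq_zero]

theorem sub_C_mem_J𝔖 (f : 𝔖 p k r) :
    f - MvPowerSeries.C (MvPowerSeries.constantCoeff f) ∈ J𝔖 p k r := by
  rw [mem_J𝔖_iff]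
  simp

theorem mem_J𝔖_pow_iff_coeff (a : ℕ) (f : 𝔖 p k r) :
    f ∈ J𝔖 p k r ^ a ↔ ∀ d : Fin r →₀ ℕ, d.degree < a → MvPowerSeries.coeff d f = 0 := by
  rw [mem_J𝔖_pow]
  constructor
  · intro h d hd
    exact MvPowerSeries.coeff_of_lt_order (lt_of_lt_of_le (by exact_mod_cast hd) h)
  · exact fun h => MvPowerSeries.nat_le_order h

/-- Since `J ^ a` is the ideal of series without terms of degree less than `a`, convergence means
that each coefficient becomes stationary. -/
instance : IsAdicComplete (J𝔖 p k r) (𝔖 p k r) where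
  haus' x hx := by
    ext d
    have h := hx (d.degree + 1)
    rw [SModEq.zero, smul_eq_mul, Ideal.mul_top, mem_J𝔖_pow_iff_coeff] at h
    rw [h d (Nat.lt_succ_self _)]
    simp
  prec' f hf := by
    -- The class modulo `J ^ (deg d + 1)` is the first one that determines the coefficient at `d`.
    let L : 𝔖 p k r := fun d => MvPowerSeries.coeff d (f (d.degree + 1))
    have hL : ∀ d, MvPowerSeries.coeff d L = MvPowerSeries.coeff d (f (d.degree + 1)) := fun _ => rfl
    refine ⟨L, fun n => ?_⟩
    rw [SModEq.sub_mem, smul_eq_mul, Ideal.mul_top, mem_J𝔖_pow_iff_coeff]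
    intro d hd
    have h := hf (m := d.degree + 1) (n := n) hd
    rw [SModEq.sub_mem, smul_eq_mul, Ideal.mul_top, mem_J𝔖_pow_iff_coeff] at h
    have h1 := h d (Nat.lt_succ_self _)
    rw [map_sub, sub_eq_zero] at h1
    rw [map_sub, hL, h1, sub_self]

variable [CharP k p] [PerfectRing k p]

/-- A nonunit has constant term divisible by `p`, which is the constant term of `E`. Modulo `E` the
variables therefore generate the maximal ideal. -/
theorem maximalIdeal_𝔖_le {E : 𝔖 p k r} (hE : MvPowerSeries.constantCoeff E = p) :
    maximalIdeal (𝔖 p k r) ≤ Ideal.span {E} ⊔ J𝔖 p k r := by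
  intro s hs
  have h1 : MvPowerSeries.constantCoeff s ∈ Ideal.span {(p : WittVector p k)} := by
    rw [WittVector.mem_span_p_iff_coeff_zero_eq_zero]
    by_contra h
    refine (mem_nonunits_iff.1 ((mem_maximalIdeal _).1 hs)) ?_
    rw [MvPowerSeries.isUnit_iff_constantCoeff]
    exact WittVector.isUnit_of_coeff_zero_ne_zero _ h
  obtain ⟨c, hc⟩ := Ideal.mem_span_singleton.1 h1
  have h2 : s = E * MvPowerSeries.C c + (s - E * MvPowerSeries.C c) := by ring
  rw [h2]
  refine Submodule.add_mem_sup (Ideal.mul_mem_right _ _ (Ideal.mem_span_singleton_self E)) ?_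
  rw [mem_J𝔖_iff, map_sub, map_mul, hE, hc]
  simp

end

section

variable {p : ℕ} [Fact p.Prime] {R : Type u} [CommRing R] [IsLocalRing R] {r : ℕ}
  {k : Type u} [Field k]
  {π : 𝔖 p k r →+* R}
  (hπX : Ideal.span (Set.range fun i => π (MvPowerSeries.X i)) = maximalIdeal R)

include hπX in
theorem map_J𝔖 : (J𝔖 p k r).map π = maximalIdeal R := by
  rw [J𝔖, Ideal.map_span, ← Set.range_comp]
  exact hπX

include hπX in
theorem map_mem_maximalIdeal_pow {a : ℕ} {s : 𝔖 p k r}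
    (hs : s ∈ J𝔖 p k r ^ a) : π s ∈ maximalIdeal R ^ a := by
  rw [← map_J𝔖 hπX, ← Ideal.map_pow]
  exact Ideal.mem_map_of_mem _ hs

include hπX in
-- As `𝔖` is `J`-adically complete and `R` is separated for `J R = 𝔪`, surjectivity may be checked
-- modulo `𝔪`.
theorem surjective_π [IsAdicComplete (maximalIdeal R) R]
    (hπ : Function.Surjective ((residue R).comp π)) : Function.Surjective π := by
  have h1 : IsHausdorff ((J𝔖 p k r).map π) R := by
    rw [map_J𝔖 hπX]; infer_instance
  refine surjective_of_mk_map_comp_surjective (I := J𝔖 p k r) π fun y => ?_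
  obtain ⟨y, rfl⟩ := Ideal.Quotient.mk_surjective y
  obtain ⟨s, hs⟩ := hπ (residue R y)
  refine ⟨s, ?_⟩
  rw [RingHom.comp_apply, Ideal.Quotient.eq, map_J𝔖 hπX, ← residue_eq_zero_iff, map_sub,
    sub_eq_zero]
  exact hs

include hπX in
theorem exists_mem_J𝔖_pow (hπ : Function.Surjective π) (a : ℕ)
    {y : R} (hy : y ∈ maximalIdeal R ^ a) : ∃ s ∈ J𝔖 p k r ^ a, π s = y := by
  rw [← map_J𝔖 hπX, ← Ideal.map_pow] at hy
  exact (Ideal.mem_map_iff_of_surjective π hπ).1 hy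

include hπX in
-- Since `p ∈ 𝔪 = π(J)`, there is an `s ∈ J` with `π(s) = p`, and `E = p - s` works.
theorem exists_E [CharP (ResidueField R) p] (hπ : Function.Surjective π) :
    ∃ E : 𝔖 p k r, MvPowerSeries.constantCoeff E = (p : WittVector p k) ∧ π E = 0 := by
  obtain ⟨s, hs, hsp⟩ := exists_mem_J𝔖_pow hπX hπ 1 (y := (p : R)) (by
    rw [pow_one]; exact natCast_p_mem p)
  rw [pow_one, mem_J𝔖_iff] at hs
  exact ⟨p - s, by rw [map_sub, hs, sub_zero, map_natCast], by
    rw [map_sub, hsp, map_natCast, sub_self]⟩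

variable [CharP k p] [PerfectRing k p]

include hπX in
-- The ring `𝔖 / E𝔖` is Noetherian local and its maximal ideal is generated by the `r` variables, so
-- its surjection onto `R`, of dimension at least `r`, is injective.
theorem ker_π (hr : (r : WithBot ℕ∞) ≤ ringKrullDim R) (hπ : Function.Surjective π)
    {E : 𝔖 p k r} (hE : MvPowerSeries.constantCoeff E = (p : WittVector p k)) (hπE : π E = 0) :
    RingHom.ker π = Ideal.span {E} := by
  have hle : Ideal.span {E} ≤ RingHom.ker π := (Ideal.span_singleton_le_iff_mem _).2 hπE
  refine le_antisymm ?_ hle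
  have hEm : Ideal.span {E} ≤ maximalIdeal (𝔖 p k r) :=
    (Ideal.span_singleton_le_iff_mem _).2 (E_mem_maximalIdeal p k r E hE)
  have : Nontrivial (𝔖 p k r ⧸ Ideal.span {E}) := Ideal.Quotient.nontrivial_iff.2 fun h =>
    (maximalIdeal.isMaximal (𝔖 p k r)).ne_top (top_le_iff.1 (h ▸ hEm))
  have : IsLocalRing (𝔖 p k r ⧸ Ideal.span {E}) :=
    IsLocalRing.of_surjective' (Ideal.Quotient.mk _) Ideal.Quotient.mk_surjective
  have : IsNoetherianRing (𝔖 p k r) := MvPowerSeries.isNoetherianRing _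
  have hgen : Ideal.span (Set.range fun i : Fin r => Ideal.Quotient.mk (Ideal.span {E})
      (MvPowerSeries.X i : 𝔖 p k r)) = maximalIdeal (𝔖 p k r ⧸ Ideal.span {E}) := by
    rw [← IsLocalRing.map_maximalIdeal_of_surjective (Ideal.Quotient.mk (Ideal.span {E}))
      Ideal.Quotient.mk_surjective]
    have h1 : Ideal.span (Set.range fun i : Fin r => Ideal.Quotient.mk (Ideal.span {E})
        (MvPowerSeries.X i : 𝔖 p k r)) = (J𝔖 p k r).map (Ideal.Quotient.mk (Ideal.span {E})) := by
      rw [J𝔖, Ideal.map_span, ← Set.range_comp]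
      rfl
    rw [h1]
    apply le_antisymm
    · refine Ideal.map_mono ?_
      rw [J𝔖, Ideal.span_le]
      rintro _ ⟨i, rfl⟩
      rw [SetLike.mem_coe, mem_maximalIdeal, mem_nonunits_iff,
        MvPowerSeries.isUnit_iff_constantCoeff, MvPowerSeries.constantCoeff_X]
      exact not_isUnit_zero
    · refine (Ideal.map_mono (maximalIdeal_𝔖_le p k r hE)).trans ?_
      rw [Ideal.map_sup, Ideal.map_quotient_self, bot_sup_eq]
  have hinj := injective_of_surjective_of_le_ringKrullDim _ hgen hr
    (Ideal.Quotient.lift (Ideal.span {E}) π fun _ h => hle h)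
    (Ideal.Quotient.lift_surjective_of_surjective _ _ hπ)
  intro s hs
  rw [← Ideal.Quotient.eq_zero_iff_mem]
  exact hinj ((Ideal.Quotient.lift_mk _ _ _).trans (hs.trans (map_zero _).symm))

end

end Presentation

end LauFrames

namespace LauFrames

/-! ### Shifts of Witt vectors and extensions of the Dieudonné frame -/

section Shift

open IsLocalRing

variable (p : ℕ) [Fact p.Prime]

theorem shift_map {A B : Type*} [CommRing A] [CommRing B] (φ : A →+* B) (x : WittVector p A) :
    (WittVector.map φ x).shift 1 = WittVector.map φ (x.shift 1) := by
  ext n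
  simp [WittVector.shift_coeff]

/-- The two Witt vectors have disjoint supports, so they are added componentwise. This yields the
decomposition `x = [x₀] + V(shift x)` used throughout. -/
theorem coeff_teichmuller_add_verschiebung {A : Type*} [CommRing A] (a : A) (x : WittVector p A)
    (n : ℕ) : (WittVector.teichmuller p a + WittVector.verschiebung x).coeff n =
      (WittVector.teichmuller p a).coeff n + (WittVector.verschiebung x).coeff n := by
  apply WittVector.coeff_add_of_disjoint
  intro n
  rcases Nat.eq_zero_or_pos n with rfl | hn
  · right; simp
  · left; exact WittVector.teichmuller_coeff_pos p a n hn

theorem teichmuller_add_verschiebung_shift {A : Type*} [CommRing A] (x : WittVector p A) :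
    WittVector.teichmuller p (x.coeff 0) + WittVector.verschiebung (x.shift 1) = x := by
  ext n
  rw [coeff_teichmuller_add_verschiebung]
  cases n with
  | zero => simp
  | succ n =>
    rw [WittVector.teichmuller_coeff_pos p _ _ n.succ_pos, WittVector.verschiebung_coeff_succ,
      WittVector.shift_coeff, zero_add, add_comm]

theorem shift_teichmuller_add_verschiebung {A : Type*} [CommRing A] (a : A) (x : WittVector p A) :
    (WittVector.teichmuller p a + WittVector.verschiebung x).shift 1 = x := by
  ext n
  rw [WittVector.shift_coeff, coeff_teichmuller_add_verschiebung, add_comm 1,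
    WittVector.teichmuller_coeff_pos p _ _ n.succ_pos, WittVector.verschiebung_coeff_succ, zero_add]

variable {A : Type u} [CommRing A] {I : Ideal A} (hI : I * I = ⊥)

include hI in
-- Take the multiplicative filtration `⊤, I, 0, 0, …`. The component of index `n` of `[a] + [b]`
-- lies in step `p ^ n`, which is zero for `n ≥ 1`. Hence the Teichmüller map is additive on an
-- ideal of square zero.
theorem teichmuller_add {a b : A} (ha : a ∈ I) (hb : b ∈ I) :
    WittVector.teichmuller p (a + b) = WittVector.teichmuller p a + WittVector.teichmuller p b := by
  let K : ℕ → Ideal A := fun j => if j = 0 then ⊤ else if j = 1 then I else ⊥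
  have h0 : K 0 = ⊤ := rfl
  have hmul : ∀ i j, K i * K j ≤ K (i + j) := by
    intro i j
    rcases i with _ | _ | i <;> rcases j with _ | _ | j <;> simp [K, hI]
  have hK : ∀ a ∈ I, ∀ n, (WittVector.teichmuller p a).coeff n ∈ K (p ^ n) := by
    intro a ha n
    cases n with
    | zero => simpa [K] using ha
    | succ n =>
      rw [WittVector.teichmuller_coeff_pos p _ _ n.succ_pos]
      exact zero_mem _
  have h := coeff_add_mem p K h0 hmul _ _ (hK a ha) (hK b hb)
  ext n
  cases n with
  | zero => simp [WittVector.add_coeff_zero]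
  | succ n =>
    have h1 := h (n + 1)
    have h2 : 1 < p ^ (n + 1) := Nat.one_lt_pow n.succ_ne_zero (Fact.out : p.Prime).one_lt
    simp only [K, if_neg (show p ^ (n + 1) ≠ 0 by omega), if_neg (show p ^ (n + 1) ≠ 1 by omega)] at h1
    rw [WittVector.teichmuller_coeff_pos p _ _ n.succ_pos, (Submodule.mem_bot A).1 h1]

include hI in
-- The shift inverts `V` and kills the summand `[x₀]`; since `[·]` is additive on `I`, this extends
-- `f₁` additively to Witt vectors with first component in `I`.
theorem shift_add {x y : WittVector p A} (hx : x.coeff 0 ∈ I) (hy : y.coeff 0 ∈ I) :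
    (x + y).shift 1 = x.shift 1 + y.shift 1 := by
  have h : x + y = WittVector.teichmuller p (x.coeff 0 + y.coeff 0) +
      WittVector.verschiebung (x.shift 1 + y.shift 1) := by
    conv_lhs => rw [← teichmuller_add_verschiebung_shift p x,
      ← teichmuller_add_verschiebung_shift p y]
    rw [teichmuller_add p hI hx hy, map_add]
    ring
  rw [h, shift_teichmuller_add_verschiebung]

include hI in
theorem pow_eq_zero_of_mem_sq_zero {a : A} (ha : a ∈ I) {n : ℕ} (hn : 2 ≤ n) : a ^ n = 0 := by
  obtain ⟨m, rfl⟩ := Nat.exists_eq_add_of_le hn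
  have h : a * a ∈ I * I := Ideal.mul_mem_mul ha ha
  rw [hI, Submodule.mem_bot] at h
  rw [pow_add, sq, h, zero_mul]

include hI in
-- For `a ∈ I` the powers `a ^ (p ^ n)` with `n ≥ 1` vanish, so `s [a] = [s₀ a]` has zero shift; the
-- rest is `s V(y) = V(f(s) y)`.
theorem shift_mul (s : WittVector p A) {x : WittVector p A} (hx : x.coeff 0 ∈ I) :
    (s * x).shift 1 = WittVector.frobenius s * x.shift 1 := by
  have h1 : s * WittVector.teichmuller p (x.coeff 0) =
      WittVector.teichmuller p (s.coeff 0 * x.coeff 0) := by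
    ext n
    rw [coeff_mul_teichmuller]
    cases n with
    | zero => rw [pow_zero, pow_one, WittVector.teichmuller_coeff_zero]
    | succ n =>
      rw [WittVector.teichmuller_coeff_pos p _ _ n.succ_pos, pow_eq_zero_of_mem_sq_zero hI hx
        (Nat.one_lt_pow n.succ_ne_zero (Fact.out : p.Prime).one_lt), mul_zero]
  have h : s * x = WittVector.teichmuller p (s.coeff 0 * x.coeff 0) +
      WittVector.verschiebung (WittVector.frobenius s * x.shift 1) := by
    conv_lhs => rw [← teichmuller_add_verschiebung_shift p x]
    rw [mul_add, h1, mul_comm (WittVector.frobenius s), WittVector.verschiebung_mul_frobenius,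
      mul_comm s (WittVector.verschiebung _)]
  rw [h, shift_teichmuller_add_verschiebung]

include hI in
-- Here `f([a] + V(y)) = [a ^ p] + p y`, and `a ^ p = 0`. So the extended frame keeps the same `θ =
-- p`.
theorem frobenius_eq_mul_shift {x : WittVector p A} (hx : x.coeff 0 ∈ I) :
    WittVector.frobenius x = p * x.shift 1 := by
  conv_lhs => rw [← teichmuller_add_verschiebung_shift p x]
  rw [map_add, frobenius_teichmuller,
    pow_eq_zero_of_mem_sq_zero hI hx (Fact.out : p.Prime).two_le, WittVector.teichmuller_zero, zero_add,
    WittVector.frobenius_verschiebung, mul_comm]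

end Shift

/-! ### Frame structures on `𝕎(A)` attached to ideals of square zero -/

section ZinkData

open IsLocalRing

variable (p : ℕ) [Fact p.Prime]

theorem teichmuller_mem_hatW {A : Type u} [CommRing A] [IsLocalRing A] {a : A}
    (ha : a ∈ maximalIdeal A) : WittVector.teichmuller p a ∈ hatW p A := by
  refine ⟨fun n => ?_, fun N => ⟨1, fun n hn => ?_⟩⟩
  · rcases Nat.eq_zero_or_pos n with rfl | hn
    · rwa [WittVector.teichmuller_coeff_zero]
    · rw [WittVector.teichmuller_coeff_pos p _ n hn]; exact zero_mem _
  · rw [WittVector.teichmuller_coeff_pos p _ n hn]; exact zero_mem _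

section

variable (A : Type u) [CommRing A] [IsLocalRing A]

/-- The projection of `𝕎(A)` to the first component. -/
noncomputable def zinkCoeff : zinkRing p A →+* A :=
  WittVector.constantCoeff.comp (zinkRing p A).subtype

theorem zinkCoeff_apply (x : zinkRing p A) : zinkCoeff p A x = (x : WittVector p A).coeff 0 := rfl

variable [CharP (ResidueField A) p]

theorem isUnit_of_isUnit_zinkCoeff (x : zinkRing p A) (hx : IsUnit (zinkCoeff p A x)) :
    IsUnit x := by
  rw [zinkCoeff_apply] at hx
  obtain ⟨y, hy, h⟩ := exists_mul_eq_one p (x : WittVector p A) x.2 hx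
  have h1 : x * (⟨y, hy⟩ : zinkRing p A) = 1 := Subtype.ext h
  exact IsUnit.of_mul_eq_one _ h1

instance isLocalHom_zinkCoeff : IsLocalHom (zinkCoeff p A) where
  map_nonunit := isUnit_of_isUnit_zinkCoeff p A

instance isLocalRing_zinkRing : IsLocalRing (zinkRing p A) := (zinkCoeff p A).domain_isLocalRing

end

variable {A : Type u} [CommRing A] [IsLocalRing A] [CharP (ResidueField A) p]
  [IsAdicComplete (maximalIdeal A) A] [PerfectRing (ResidueField A) p] (hp2 : p ≠ 2)
  (I : Ideal A) (hI : I * I = ⊥)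

include hp2 in
-- The vector `V(shift x) = x - [x₀]` lies in `𝕎(A)` because `[x₀] ∈ Ŵ(𝔪)`, and for `p ≠ 2` the ring
-- `𝕎(A)` contains `y` as soon as it contains `V(y)`.
theorem shift_mem_zinkRing {x : WittVector p A} (hx : x ∈ zinkRing p A)
    (hx0 : x.coeff 0 ∈ maximalIdeal A) : x.shift 1 ∈ zinkRing p A := by
  refine mem_zinkRing_of_verschiebung_mem p hp2 _ ?_
  have h := teichmuller_add_verschiebung_shift p x
  rw [← eq_sub_iff_add_eq'] at h
  rw [h]
  exact sub_mem hx (hatW_le_zinkRing p _ (teichmuller_mem_hatW p hx0))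

omit [CharP (ResidueField A) p] [IsAdicComplete (maximalIdeal A) A]
  [PerfectRing (ResidueField A) p] in
include hI in
theorem le_maximalIdeal_of_sq_zero : I ≤ maximalIdeal A := fun a ha => by
  refine le_maximalIdeal (fun h => ?_) ha
  rw [h, Ideal.top_mul] at hI
  exact top_ne_bot hI

open Classical in
/-- The inverse of the Verschiebung of `𝕎(A)`, extended by the shift of components. -/
noncomputable def zinkShift (x : zinkRing p A) : zinkRing p A :=
  if h : (x : WittVector p A).shift 1 ∈ zinkRing p A then ⟨_, h⟩ else 0

include hp2 in
theorem coe_zinkShift {x : zinkRing p A} (hx : (x : WittVector p A).coeff 0 ∈ maximalIdeal A) :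
    (zinkShift p x : WittVector p A) = (x : WittVector p A).shift 1 := by
  rw [zinkShift, dif_pos (shift_mem_zinkRing p hp2 x.2 hx)]

/-- The frame structure on `𝕎(A)` with the ideal of all Witt vectors with first component in an
ideal `I` of square zero. -/
noncomputable def zinkData : WinData (zinkRing p A) where
  I := I.comap (zinkCoeff p A)
  σ := frobZink p
  τ := zinkShift p
  θ := p
  τ_add x hx y hy := Subtype.ext (by
    have hm := le_maximalIdeal_of_sq_zero I hI
    have hx0 : (x : WittVector p A).coeff 0 ∈ I := hx
    have hy0 : (y : WittVector p A).coeff 0 ∈ I := hy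
    have hxy : ((x + y : zinkRing p A) : WittVector p A).coeff 0 ∈ I := by
      rw [Subring.coe_add, WittVector.add_coeff_zero]
      exact add_mem hx0 hy0
    rw [Subring.coe_add, coe_zinkShift p hp2 (hm hx0), coe_zinkShift p hp2 (hm hy0),
      coe_zinkShift p hp2 (hm hxy), Subring.coe_add, shift_add p hI hx0 hy0])
  τ_mul s x hx := Subtype.ext (by
    have hm := le_maximalIdeal_of_sq_zero I hI
    have hx0 : (x : WittVector p A).coeff 0 ∈ I := hx
    have hsx : ((s * x : zinkRing p A) : WittVector p A).coeff 0 ∈ I := by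
      rw [Subring.coe_mul, WittVector.mul_coeff_zero]
      exact Ideal.mul_mem_left _ _ hx0
    rw [Subring.coe_mul, coe_zinkShift p hp2 (hm hx0), coe_zinkShift p hp2 (hm hsx),
      Subring.coe_mul, shift_mul p hI _ hx0]
    rfl)
  θ_mul x hx := Subtype.ext (by
    have hm := le_maximalIdeal_of_sq_zero I hI
    have hx0 : (x : WittVector p A).coeff 0 ∈ I := hx
    rw [Subring.coe_mul, coe_zinkShift p hp2 (hm hx0)]
    exact (frobenius_eq_mul_shift p hI hx).symm)

theorem mem_zinkData_I (x : zinkRing p A) :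
    x ∈ (zinkData p hp2 I hI).I ↔ (x : WittVector p A).coeff 0 ∈ I := Iff.rfl

theorem zinkData_extends {I' : Ideal A} (hI' : I' * I' = ⊥) (h : I ≤ I') :
    (zinkData p hp2 I hI).Extends (zinkData p hp2 I' hI') where
  I_le := Ideal.comap_mono h
  σ_eq := rfl
  θ_eq := rfl
  τ_eq := fun _ _ => rfl

theorem zinkData_I_le : (zinkData p hp2 I hI).I ≤ maximalIdeal (zinkRing p A) := by
  intro x hx
  rw [mem_maximalIdeal, mem_nonunits_iff]
  intro h
  exact (mem_maximalIdeal _).1 (le_maximalIdeal_of_sq_zero I hI hx) (h.map (zinkCoeff p A))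

variable (A) in
/-- The data of the Dieudonné frame. -/
noncomputable def dieudonneData : WinData (dieudonneFrame p A hp2).S :=
  zinkData p hp2 (⊥ : Ideal A) (Ideal.mul_bot _)

theorem isDataOf_dieudonneData : (dieudonneData p A hp2).IsDataOf where
  I_eq := rfl
  σ_eq := rfl
  τ_eq x hx := by
    refine toWitt_injective p A hp2 (WittVector.verschiebung_injective p A ?_)
    rw [verschiebung_dieudonneFrame_σ₁]
    have hx0 : (toWitt p A hp2 x).coeff 0 = 0 := hx
    have h1 : toWitt p A hp2 ((dieudonneData p A hp2).τ x) = (toWitt p A hp2 x).shift 1 :=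
      coe_zinkShift p hp2 (x := x) (by
        change (toWitt p A hp2 x).coeff 0 ∈ _
        rw [hx0]
        exact zero_mem _)
    rw [h1]
    conv_rhs => rw [← teichmuller_add_verschiebung_shift p (toWitt p A hp2 x), hx0,
      WittVector.teichmuller_zero, zero_add]

end ZinkData

/-! ### Functoriality of `𝕎` -/

section Functoriality

open IsLocalRing

variable (p : ℕ) [Fact p.Prime] {A B : Type u} [CommRing A] [IsLocalRing A] [CommRing B]
  [IsLocalRing B] (φ : A →+* B)

theorem map_mem_frobPerfect {x : WittVector p A} (hx : x ∈ frobPerfect p A) :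
    WittVector.map φ x ∈ frobPerfect p B := by
  obtain ⟨c, rfl, hc⟩ := hx
  exact ⟨fun n => WittVector.map φ (c n), rfl, fun n => by
    rw [← map_frobenius, hc]⟩

variable [IsLocalHom φ]

theorem map_mem_maximalIdeal_pow_of_isLocalHom {n : ℕ} {a : A} (ha : a ∈ maximalIdeal A ^ n) :
    φ a ∈ maximalIdeal B ^ n := by
  have h := Ideal.mem_map_of_mem φ ha
  rw [Ideal.map_pow] at h
  refine Ideal.pow_right_mono (Ideal.map_le_iff_le_comap.2 fun b hb => ?_) n h
  rw [mem_maximalIdeal, mem_nonunits_iff] at hb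
  rw [Ideal.mem_comap, mem_maximalIdeal, mem_nonunits_iff]
  exact fun hφb => hb (isUnit_of_map_unit φ b hφb)

theorem map_mem_hatW {x : WittVector p A} (hx : x ∈ hatW p A) :
    WittVector.map φ x ∈ hatW p B := by
  refine ⟨fun n => ?_, fun N => ?_⟩
  · rw [WittVector.map_coeff]
    simpa using map_mem_maximalIdeal_pow_of_isLocalHom φ (n := 1) (by simpa using hx.1 n)
  · obtain ⟨M, hM⟩ := hx.2 N
    refine ⟨M, fun n hn => ?_⟩
    rw [WittVector.map_coeff]
    exact map_mem_maximalIdeal_pow_of_isLocalHom φ (hM n hn)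

theorem map_mem_zinkRing {x : WittVector p A} (hx : x ∈ zinkRing p A) :
    WittVector.map φ x ∈ zinkRing p B := by
  obtain ⟨z, hz, hxz⟩ := hx
  exact ⟨_, map_mem_frobPerfect p φ hz, by rw [← map_sub]; exact map_mem_hatW p φ hxz⟩

/-- The homomorphism `𝕎(A) → 𝕎(B)` induced by a local homomorphism. -/
noncomputable def zinkMap : zinkRing p A →+* zinkRing p B :=
  (WittVector.map φ).restrict _ _ fun _ hx => map_mem_zinkRing p φ hx

theorem coe_zinkMap (x : zinkRing p A) :
    (zinkMap p φ x : WittVector p B) = WittVector.map φ (x : WittVector p A) := rfl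

theorem frobZink_zinkMap (x : zinkRing p A) :
    frobZink p (zinkMap p φ x) = zinkMap p φ (frobZink p x) :=
  Subtype.ext (map_frobenius p φ _).symm

instance isLocalHom_zinkMap [CharP (ResidueField A) p] : IsLocalHom (zinkMap p φ) where
  map_nonunit x hx := by
    refine isUnit_of_map_unit (zinkCoeff p A) x (isUnit_of_map_unit φ _ ?_)
    exact hx.map (zinkCoeff p B)

theorem toResidue_map (x : WittVector p A) :
    toResidue p (WittVector.map φ x) = WittVector.map (ResidueField.map φ) (toResidue p x) := by
  ext n
  simp [toResidue, ResidueField.map_residue]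

/-- The Frobenius-perfect part is lifted through the residue field, where its elements are
determined by their residues. The part in `Ŵ(𝔪)` is lifted componentwise; as `𝔪 ^ N = 0` in `B`,
almost all components are zero. -/
theorem zinkMap_surjective [CharP (ResidueField A) p] [IsAdicComplete (maximalIdeal A) A]
    [PerfectRing (ResidueField A) p] [CharP (ResidueField B) p] [IsAdicComplete (maximalIdeal B) B]
    (hφ : Function.Surjective φ) (N : ℕ) (hN : maximalIdeal B ^ N = ⊥) :
    Function.Surjective (zinkMap p φ) := by
  rintro ⟨x, z, hz, hxz⟩
  have hres : Function.Surjective (ResidueField.map φ) := by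
    intro y
    obtain ⟨y, rfl⟩ := residue_surjective y
    obtain ⟨a, rfl⟩ := hφ y
    exact ⟨residue A a, ResidueField.map_residue φ a⟩
  obtain ⟨y, hy⟩ := WittVector.map_surjective _ hres (toResidue p z)
  obtain ⟨z', hz', hz'y⟩ := exists_frobPerfect_lift (R := A) p y
  have h1 : WittVector.map φ z' = z := by
    refine sub_eq_zero.1 (eq_zero_of_mem_frobPerfect p _
      (sub_mem (map_mem_frobPerfect p φ hz') hz) ?_)
    rw [map_sub, toResidue_map, hz'y, hy, sub_self]
  -- Zero is lifted to zero, so that the lifted Witt vector has almost all components zero and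
  -- belongs to `Ŵ(𝔪)`.
  have h2 : ∀ b ∈ maximalIdeal B, ∃ a ∈ maximalIdeal A, φ a = b ∧ (b = 0 → a = 0) := by
    intro b hb
    by_cases h : b = 0
    · exact ⟨0, zero_mem _, by rw [h, map_zero], fun _ => rfl⟩
    · obtain ⟨a, rfl⟩ := hφ b
      refine ⟨a, ?_, rfl, fun h' => absurd h' h⟩
      rw [mem_maximalIdeal, mem_nonunits_iff] at hb ⊢
      exact fun ha => hb (ha.map φ)
  choose f hfm hf hf0 using fun n => h2 _ (hxz.1 n)
  have h3 : WittVector.mk p f ∈ hatW p A := by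
    refine ⟨fun n => by rw [WittVector.coeff_mk]; exact hfm n, fun n => ?_⟩
    obtain ⟨M, hM⟩ := hxz.2 N
    refine ⟨M, fun i hi => ?_⟩
    have h4 := hM i hi
    rw [hN, Submodule.mem_bot] at h4
    rw [WittVector.coeff_mk, hf0 i h4]
    exact zero_mem _
  refine ⟨⟨z' + WittVector.mk p f, add_mem (frobPerfect_le_zinkRing p hz')
    (hatW_le_zinkRing p _ h3)⟩, Subtype.ext ?_⟩
  rw [coe_zinkMap, map_add, h1]
  have h5 : WittVector.map φ (WittVector.mk p f) = x - z := by
    ext n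
    rw [WittVector.map_coeff, WittVector.coeff_mk, hf]
  rw [h5, add_sub_cancel]

variable [CharP (ResidueField A) p] [IsAdicComplete (maximalIdeal A) A]
  [PerfectRing (ResidueField A) p] [CharP (ResidueField B) p] [IsAdicComplete (maximalIdeal B) B]
  [PerfectRing (ResidueField B) p] (hp2 : p ≠ 2)

include hp2 in
theorem zinkShift_zinkMap {x : zinkRing p A}
    (hx : (x : WittVector p A).coeff 0 ∈ maximalIdeal A) :
    zinkShift p (zinkMap p φ x) = zinkMap p φ (zinkShift p x) := by
  refine Subtype.ext ?_
  rw [coe_zinkShift p hp2, coe_zinkMap, coe_zinkMap, coe_zinkShift p hp2 hx, shift_map]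
  rw [coe_zinkMap, WittVector.map_coeff]
  simpa using map_mem_maximalIdeal_pow_of_isLocalHom φ (n := 1) (by simpa using hx)

theorem isWinHom_zinkMap {I : Ideal A} (hI : I * I = ⊥) {I' : Ideal B} (hI' : I' * I' = ⊥)
    (h : I ≤ I'.comap φ) :
    IsWinHom (zinkData p hp2 I hI) (zinkData p hp2 I' hI') (zinkMap p φ) 1 where
  map_I x hx := h hx
  map_σ x := frobZink_zinkMap p φ x
  map_τ x hx := by
    rw [Units.val_one, one_mul]
    exact zinkShift_zinkMap p φ hp2 (le_maximalIdeal_of_sq_zero I hI hx)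
  map_θ := by
    rw [Units.val_one, one_mul]
    exact map_natCast _ _

end Functoriality

end LauFrames

namespace LauFrames

/-! ### Frames with a principal ideal and their extensions -/

section Principal

variable {S : Type*} [CommRing S] (σ : S →+* S) (E : S) (N : Ideal S)

open Classical in
/-- The operation `E y + n ↦ σ y` for `n ∈ N`, extended by zero. -/
noncomputable def principalτ (x : S) : S :=
  if h : ∃ y, x - E * y ∈ N then σ h.choose else 0

variable (hN : ∀ y, E * y ∈ N → y ∈ N) (hσN : ∀ y ∈ N, σ y = 0)

include hN hσN in
-- The value does not depend on `y`: two choices differ by an element of `N`, because `E` is regular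
-- modulo `N`, and `σ` kills `N`.
theorem principalτ_eq {x y : S} (h : x - E * y ∈ N) : principalτ σ E N x = σ y := by
  have h1 : ∃ y, x - E * y ∈ N := ⟨y, h⟩
  rw [principalτ, dif_pos h1, ← sub_eq_zero, ← map_sub]
  refine hσN _ (hN _ ?_)
  have h2 := sub_mem h h1.choose_spec
  rwa [sub_sub_sub_cancel_left, ← mul_sub] at h2

theorem mem_span_singleton_sup_iff {x : S} :
    x ∈ Ideal.span {E} ⊔ N ↔ ∃ y, x - E * y ∈ N := by
  rw [Submodule.mem_sup]
  constructor
  · rintro ⟨y, hy, z, hz, rfl⟩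
    obtain ⟨y, rfl⟩ := Ideal.mem_span_singleton.1 hy
    exact ⟨y, by rwa [add_sub_cancel_left]⟩
  · rintro ⟨y, hy⟩
    exact ⟨E * y, Ideal.mem_span_singleton.2 (dvd_mul_right _ _), _, hy, add_sub_cancel _ _⟩

/-- The data of the frame `(S, ES + N, σ, σ₁)` with `σ₁(Ey) = σ(y)` and `σ₁(N) = 0`. -/
noncomputable def principalData : WinData S where
  I := Ideal.span {E} ⊔ N
  σ := σ
  τ := principalτ σ E N
  θ := σ E
  τ_add x hx y hy := by
    obtain ⟨x', hx⟩ := (mem_span_singleton_sup_iff E N).1 hx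
    obtain ⟨y', hy⟩ := (mem_span_singleton_sup_iff E N).1 hy
    rw [principalτ_eq σ E N hN hσN hx, principalτ_eq σ E N hN hσN hy, ← map_add]
    refine principalτ_eq σ E N hN hσN ?_
    rw [mul_add, add_sub_add_comm]
    exact add_mem hx hy
  τ_mul s x hx := by
    obtain ⟨x', hx⟩ := (mem_span_singleton_sup_iff E N).1 hx
    rw [principalτ_eq σ E N hN hσN hx, ← map_mul]
    refine principalτ_eq σ E N hN hσN ?_
    rw [mul_left_comm, ← mul_sub]
    exact Ideal.mul_mem_left _ _ hx
  θ_mul x hx := by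
    obtain ⟨x', hx⟩ := (mem_span_singleton_sup_iff E N).1 hx
    rw [principalτ_eq σ E N hN hσN hx, ← map_mul, ← sub_eq_zero, ← map_sub, ← neg_sub]
    exact hσN _ (neg_mem hx)

theorem principalData_τ {x y : S} (h : x - E * y ∈ N) :
    (principalData σ E N hN hσN).τ x = σ y := principalτ_eq σ E N hN hσN h

theorem principalData_τ_ker {x : S} (h : x ∈ N) : (principalData σ E N hN hσN).τ x = 0 := by
  rw [principalData_τ σ E N hN hσN (y := 0) (by simpa using h), map_zero]

theorem principalData_extends (h0 : ∀ y, E * y ∈ (⊥ : Ideal S) → y ∈ (⊥ : Ideal S))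
    (hσ0 : ∀ y ∈ (⊥ : Ideal S), σ y = 0) :
    (principalData σ E ⊥ h0 hσ0).Extends (principalData σ E N hN hσN) where
  I_le := sup_le_sup_left bot_le _
  σ_eq := rfl
  θ_eq := rfl
  τ_eq x hx := by
    obtain ⟨y, hy⟩ := (mem_span_singleton_sup_iff E ⊥).1 hx
    rw [principalData_τ σ E ⊥ h0 hσ0 hy]
    exact principalData_τ σ E N hN hσN ((bot_le : (⊥ : Ideal S) ≤ N) hy)

theorem isNilThickening_principalData {S₀ : Type*} [CommRing S₀] {σ₀ : S₀ →+* S₀}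
    (q : S →+* S₀) (hq : Function.Surjective q) (hqσ : ∀ x, σ₀ (q x) = q (σ x))
    (hqN : ∀ x, q x = 0 ↔ x ∈ N)
    (h0 : ∀ y, q E * y ∈ (⊥ : Ideal S₀) → y ∈ (⊥ : Ideal S₀))
    (hσ0 : ∀ y ∈ (⊥ : Ideal S₀), σ₀ y = 0) :
    IsNilThickening (principalData σ E N hN hσN) (principalData σ₀ (q E) ⊥ h0 hσ0) q where
  surj := hq
  hom :=
    { map_I := fun x hx => by
        obtain ⟨y, hy⟩ := (mem_span_singleton_sup_iff E N).1 hx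
        refine (mem_span_singleton_sup_iff (q E) ⊥).2 ⟨q y, ?_⟩
        rwa [← map_mul, ← map_sub, Submodule.mem_bot, hqN]
      map_σ := hqσ
      map_τ := fun x hx => by
        obtain ⟨y, hy⟩ := (mem_span_singleton_sup_iff E N).1 hx
        rw [principalData_τ σ E N hN hσN hy, Units.val_one, one_mul, ← hqσ]
        refine principalData_τ σ₀ (q E) ⊥ h0 hσ0 ?_
        rwa [← map_mul, ← map_sub, Submodule.mem_bot, hqN]
      map_θ := by
        rw [Units.val_one, one_mul]
        exact (hqσ E).symm }
  mem_I x hx := by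
    obtain ⟨y, hy⟩ := (mem_span_singleton_sup_iff (q E) ⊥).1 hx
    obtain ⟨y, rfl⟩ := hq y
    refine (mem_span_singleton_sup_iff E N).2 ⟨y, ?_⟩
    rwa [← map_mul, ← map_sub, Submodule.mem_bot, hqN] at hy
  σ_ker x hx := hσN x ((hqN x).1 hx)
  nil x hx := ⟨1, principalData_τ_ker σ E N hN hσN ((hqN x).1 hx)⟩

/-- Since `σ₁(E) = 1`, the unit has to be the value of `σ₁` at `ϰ(E)`. Semilinearity then gives the
compatibility on all multiples of `E`, and the one for `θ` follows from `θ τ = σ` at `ϰ(E)`. -/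
theorem isWinHom_principalData {W : Type*} [CommRing W] (D : WinData W) (ϰ : S →+* W) (u : Wˣ)
    (hϰσ : ∀ x, D.σ (ϰ x) = ϰ (σ x)) (hE : ϰ E ∈ D.I) (hu : D.τ (ϰ E) = u)
    (hϰN : ∀ x ∈ N, ϰ x ∈ D.I ∧ D.τ (ϰ x) = 0) :
    IsWinHom (principalData σ E N hN hσN) D ϰ u where
  map_I x hx := by
    obtain ⟨y, hy⟩ := (mem_span_singleton_sup_iff E N).1 hx
    rw [← sub_add_cancel x (E * y), map_add, map_mul]
    exact add_mem (hϰN _ hy).1 (Ideal.mul_mem_right _ _ hE)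
  map_σ := hϰσ
  map_τ x hx := by
    obtain ⟨y, hy⟩ := (mem_span_singleton_sup_iff E N).1 hx
    rw [principalData_τ σ E N hN hσN hy]
    conv_lhs => rw [← sub_add_cancel x (E * y), map_add, map_mul, mul_comm (ϰ E)]
    rw [D.τ_add _ (hϰN _ hy).1 _ (Ideal.mul_mem_left _ _ hE), (hϰN _ hy).2, D.τ_mul _ _ hE, hu,
      hϰσ, zero_add, mul_comm]
  map_θ := by
    rw [mul_comm, ← hu, D.θ_mul _ hE, hϰσ]
    rfl

end Principal

theorem isDataOf_principalData {p : ℕ} {S : Type u} [CommRing S] [IsLocalRing S] {σ : S →+* S}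
    (hσ : ∀ a : S, (p : S) ∣ σ a - a ^ p) {E : S} (hreg : ∀ y : S, E * y = 0 → y = 0)
    (hE : E ∈ IsLocalRing.maximalIdeal S) (hp : (p : S) ∈ IsLocalRing.maximalIdeal S)
    (h0 : ∀ y, E * y ∈ (⊥ : Ideal S) → y ∈ (⊥ : Ideal S))
    (hσ0 : ∀ y ∈ (⊥ : Ideal S), σ y = 0) :
    WinData.IsDataOf (𝓕 := principalFrame p S σ hσ E hreg hE hp) (principalData σ E ⊥ h0 hσ0) where
  I_eq := sup_bot_eq _
  σ_eq := rfl
  τ_eq x hx := by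
    obtain ⟨y, rfl⟩ := Ideal.mem_span_singleton.1 hx
    have h1 : ∀ y : S, E * y - E * y ∈ (⊥ : Ideal S) := fun y => by
      rw [sub_self]
      exact zero_mem _
    exact (principalData_τ σ E ⊥ h0 hσ0 (h1 y)).trans
      (principalFrame_σ₁ p S σ hσ E hreg hE hp y hx).symm

/-! ### The homomorphism `δ` -/

section Delta

open IsLocalRing

variable (p : ℕ) [Fact p.Prime] (k : Type u) [Field k] [CharP k p] [PerfectRing k p] (r : ℕ)

theorem frobenius_δ𝔖 (s : 𝔖 p k r) :
    WittVector.frobenius (δ𝔖 p k r s) = δ𝔖 p k r (frob𝔖 p k r s) := by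
  refine eq_of_ghost_eq p (𝔖_torsionFree p k r) _ _ fun n => ?_
  rw [WittVector.ghostComponent_frobenius, ghostComponent_δ𝔖, ghostComponent_δ𝔖,
    Function.iterate_succ_apply]

theorem δ𝔖_X (i : Fin r) :
    δ𝔖 p k r (MvPowerSeries.X i) = WittVector.teichmuller p (MvPowerSeries.X i) := by
  refine eq_of_ghost_eq p (𝔖_torsionFree p k r) _ _ fun n => ?_
  rw [WittVector.ghostComponent_teichmuller, ghostComponent_δ𝔖]
  induction n with
  | zero => simp
  | succ n ih => rw [Function.iterate_succ_apply', ih, map_pow, frob𝔖_X, ← pow_mul, pow_succ']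

theorem δ𝔖_coeff_zero (s : 𝔖 p k r) : (δ𝔖 p k r s).coeff 0 = s := by
  have h := ghostComponent_δ𝔖 p k r s 0
  rw [ghostComponent_eq_sum] at h
  simpa using h

/-- By `δ(x_i) = [x_i]`, multiplication by `x_i` multiplies the component of index `n` by `x_i ^ (p
^ n)`. Conditions of the form "component `n` lies in `K (p ^ n)`" define an ideal, here for `K j = J
^ ((a + 1) j)`, so the generators of `J` suffice in the induction step. -/
theorem δ𝔖_coeff_mem {a : ℕ} {s : 𝔖 p k r} (hs : s ∈ J𝔖 p k r ^ a) (n : ℕ) :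
    (δ𝔖 p k r s).coeff n ∈ J𝔖 p k r ^ (a * p ^ n) := by
  have h0 : ∀ b, (fun j => J𝔖 p k r ^ (b * j)) 0 = ⊤ := fun b => by simp
  have hmul : ∀ b i j, (fun j => J𝔖 p k r ^ (b * j)) i * (fun j => J𝔖 p k r ^ (b * j)) j ≤
      (fun j => J𝔖 p k r ^ (b * j)) (i + j) := fun b i j => by
    simp only [mul_add, pow_add, le_refl]
  induction a generalizing s n with
  | zero => simp
  | succ a ih =>
    rw [pow_succ] at hs
    revert n
    refine Submodule.mul_induction_on hs ?_ ?_
    · intro x hx y hy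
      refine Submodule.span_induction
        (p := fun y _ => ∀ n, (δ𝔖 p k r (x * y)).coeff n ∈ J𝔖 p k r ^ ((a + 1) * p ^ n))
        ?_ ?_ ?_ ?_ hy
      · rintro _ ⟨i, rfl⟩ n
        rw [map_mul, δ𝔖_X, coeff_mul_teichmuller, add_mul, one_mul, pow_add]
        exact Ideal.mul_mem_mul (ih hx n) (Ideal.pow_mem_pow (X_mem_J𝔖 p k r i) _)
      · intro n
        simp
      · intro y z _ _ hy hz n
        rw [mul_add, map_add]
        exact coeff_add_mem p (fun j => J𝔖 p k r ^ ((a + 1) * j)) (h0 (a + 1))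
           (hmul (a + 1)) _ _ hy hz n
      · intro c y _ hy n
        rw [smul_eq_mul, mul_left_comm, map_mul]
        exact coeff_mul_mem p (fun j => J𝔖 p k r ^ ((a + 1) * j)) (h0 (a + 1))
           (hmul (a + 1)) _ _ hy n
    · intro y z hy hz n
      rw [map_add]
      exact coeff_add_mem p (fun j => J𝔖 p k r ^ ((a + 1) * j)) (h0 (a + 1))
           (hmul (a + 1)) _ _ hy hz n

theorem constantCoeff_frob𝔖 (s : 𝔖 p k r) : MvPowerSeries.constantCoeff (frob𝔖 p k r s) =
    WittVector.frobenius (MvPowerSeries.constantCoeff s) := by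
  have h : frob𝔖 p k r (s - MvPowerSeries.C (MvPowerSeries.constantCoeff s)) ∈ J𝔖 p k r ^ 1 :=
    J𝔖_pow_le_comap p k r 1 (by rw [pow_one]; exact sub_C_mem_J𝔖 p k r s)
  rw [pow_one, mem_J𝔖_iff, map_sub, frob𝔖_C, map_sub, MvPowerSeries.constantCoeff_C,
    sub_eq_zero] at h
  exact h

/-- The first ghost component gives `E ^ p + p (δ E)₁ = σ(E)`. Comparing constant terms and dividing
by `p`, the constant term of `(δ E)₁` is `1 - p ^ (p - 1)`, a unit. -/
theorem isUnit_δ𝔖_coeff_one {E : 𝔖 p k r} (hE : MvPowerSeries.constantCoeff E = p) :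
    IsUnit ((δ𝔖 p k r E).coeff 1) := by
  have h := ghostComponent_δ𝔖 p k r E 1
  rw [ghostComponent_eq_sum, Finset.sum_range_succ, Finset.sum_range_one, δ𝔖_coeff_zero] at h
  simp only [pow_zero, one_mul, pow_one, Nat.sub_zero, Nat.sub_self, Function.iterate_one] at h
  have h1 := congrArg MvPowerSeries.constantCoeff h
  rw [constantCoeff_frob𝔖, map_add, map_mul, map_pow, map_natCast, hE, map_natCast] at h1
  have hp : (p : WittVector p k) ≠ 0 := (WittVector.irreducible p (k := k)).ne_zero
  have h2 : MvPowerSeries.constantCoeff ((δ𝔖 p k r E).coeff 1) =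
      1 - (p : WittVector p k) ^ (p - 1) := by
    refine mul_left_cancel₀ hp ?_
    rw [mul_sub, mul_one, mul_pow_sub_one (Fact.out : p.Prime).ne_zero]
    exact eq_sub_of_add_eq' h1
  rw [MvPowerSeries.isUnit_iff_constantCoeff, h2]
  have h3 : (p : WittVector p k) ^ (p - 1) ∈ maximalIdeal (WittVector p k) :=
    Ideal.pow_mem_of_mem _ ((mem_maximalIdeal _).2 (WittVector.irreducible p (k := k)).not_isUnit) _
      (Nat.sub_pos_of_lt (Fact.out : p.Prime).one_lt)
  exact isUnit_one_sub_self_of_mem_nonunits _ ((mem_maximalIdeal _).1 h3)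

section Hom

variable {p k r} {B : Type u} [CommRing B] [IsLocalRing B] (φ : 𝔖 p k r →+* B)

/-- The Frobenius of `W(k)` is bijective since `k` is perfect, and `δ` commutes with the Frobenius
lifts; so preimages of `w` yield preimages of its image. -/
theorem map_δ𝔖_C_mem_frobPerfect (w : WittVector p k) :
    WittVector.map φ (δ𝔖 p k r (MvPowerSeries.C w)) ∈ frobPerfect p B := by
  let F := WittVector.frobeniusEquiv p k
  refine ⟨fun n => WittVector.map φ (δ𝔖 p k r (MvPowerSeries.C (F.symm^[n] w))), rfl, fun n => ?_⟩
  rw [← map_frobenius, frobenius_δ𝔖, frob𝔖_C, Function.iterate_succ_apply']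
  congr 4
  exact F.apply_symm_apply _

variable (hφ : ∀ a, ∀ s ∈ J𝔖 p k r ^ a, φ s ∈ maximalIdeal B ^ a)

include hφ in
theorem map_δ𝔖_coeff_mem {a : ℕ} {s : 𝔖 p k r} (hs : s ∈ J𝔖 p k r ^ a) (n : ℕ) :
    (WittVector.map φ (δ𝔖 p k r s)).coeff n ∈ maximalIdeal B ^ (a * p ^ n) := by
  rw [WittVector.map_coeff]
  exact hφ _ _ (δ𝔖_coeff_mem p k r hs n)

include hφ in
-- Split off the constant term, which gives the Frobenius-perfect part. The remainder lies in `J`,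
-- so the components of its image lie in `𝔪 ^ (p ^ n)` and converge to zero.
theorem map_δ𝔖_mem_zinkRing (s : 𝔖 p k r) :
    WittVector.map φ (δ𝔖 p k r s) ∈ zinkRing p B := by
  refine ⟨_, map_δ𝔖_C_mem_frobPerfect φ (MvPowerSeries.constantCoeff s), ?_⟩
  rw [← map_sub, ← map_sub]
  have h := map_δ𝔖_coeff_mem φ hφ (a := 1) (by rw [pow_one]; exact sub_C_mem_J𝔖 p k r s)
  refine ⟨fun n => Ideal.pow_le_self (by simp [(Fact.out : p.Prime).ne_zero]) (h n),
    fun N => ⟨N, fun n hn => Ideal.pow_le_pow_right ?_ (h n)⟩⟩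
  rw [one_mul]
  exact hn.trans (Nat.lt_pow_self (Fact.out : p.Prime).one_lt).le

/-- The homomorphism `𝔖 → 𝕎(B)` induced by `δ`, for a homomorphism `𝔖 → B`. -/
noncomputable def zinkHom : 𝔖 p k r →+* zinkRing p B :=
  ((WittVector.map φ).comp (δ𝔖 p k r)).codRestrict _ fun s => map_δ𝔖_mem_zinkRing φ hφ s

theorem coe_zinkHom (s : 𝔖 p k r) :
    (zinkHom φ hφ s : WittVector p B) = WittVector.map φ (δ𝔖 p k r s) := rfl

theorem zinkHom_coeff_zero (s : 𝔖 p k r) :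
    (zinkHom φ hφ s : WittVector p B).coeff 0 = φ s := by
  rw [coe_zinkHom, WittVector.map_coeff, δ𝔖_coeff_zero]

theorem frobZink_zinkHom (s : 𝔖 p k r) :
    frobZink p (zinkHom φ hφ s) = zinkHom φ hφ (frob𝔖 p k r s) :=
  Subtype.ext (by
    rw [coe_zinkHom, ← frobenius_δ𝔖, map_frobenius]
    rfl)

theorem zinkHom_eq_zero {a : ℕ} (ha : maximalIdeal B ^ a = ⊥) {s : 𝔖 p k r}
    (hs : s ∈ J𝔖 p k r ^ a) : zinkHom φ hφ s = 0 := by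
  refine Subtype.ext ?_
  ext n
  have h := map_δ𝔖_coeff_mem φ hφ hs n
  have h1 := Ideal.pow_le_pow_right (I := maximalIdeal B)
    (Nat.le_mul_of_pos_right a (pow_pos (Fact.out : p.Prime).pos n)) h
  rw [ha, Submodule.mem_bot] at h1
  rw [coe_zinkHom, h1]
  exact (WittVector.zero_coeff p B n).symm

end Hom

end Delta

end LauFrames

namespace LauFrames

open IsLocalRing

/-! ### Thickenings of Dieudonné frames -/

section ZinkThickening

variable (p : ℕ) [Fact p.Prime] {A B : Type u} [CommRing A] [IsLocalRing A] [CommRing B]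
  [IsLocalRing B] [CharP (ResidueField A) p] [IsAdicComplete (maximalIdeal A) A]
  [PerfectRing (ResidueField A) p] [CharP (ResidueField B) p] [IsAdicComplete (maximalIdeal B) B]
  [PerfectRing (ResidueField B) p] (hp2 : p ≠ 2)

include hp2 in
theorem iterate_zinkShift_coeff {x : zinkRing p A}
    (hx : ∀ n, (x : WittVector p A).coeff n ∈ maximalIdeal A) (m n : ℕ) :
    (((zinkShift p)^[m] x : zinkRing p A) : WittVector p A).coeff n =
      (x : WittVector p A).coeff (n + m) := by
  induction m generalizing n with
  | zero => rfl
  | succ m ih =>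
    rw [Function.iterate_succ_apply', coe_zinkShift p hp2 (by rw [ih]; exact hx _),
      WittVector.shift_coeff, ih]
    congr 1
    omega

variable (φ : A →+* B) [IsLocalHom φ]

/-- The Frobenius kills the kernel because it raises the `𝔪`-adic order of Witt vectors with
components in `𝔪 ^ n` by at least one. The shift is elementwise nilpotent because elements of the
kernel lie in `Ŵ(𝔪)` and `𝔪` is nilpotent, so they have only finitely many nonzero components. -/
theorem isNilThickening_zinkData (hφ : Function.Surjective φ) {n : ℕ} (hn : n ≠ 0)
    (hA : maximalIdeal A ^ (n + 1) = ⊥) (hB : maximalIdeal B ^ n = ⊥)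
    (hker : RingHom.ker φ ≤ maximalIdeal A ^ n) (hI : RingHom.ker φ * RingHom.ker φ = ⊥) :
    IsNilThickening (zinkData p hp2 (RingHom.ker φ) hI) (zinkData p hp2 (⊥ : Ideal B) (Ideal.mul_bot _))
      (zinkMap p φ) := by
  have hcoeff : ∀ x, zinkMap p φ x = 0 → ∀ i, (x : WittVector p A).coeff i ∈ RingHom.ker φ := by
    intro x hx i
    have h := congrArg (fun z : zinkRing p B => (z : WittVector p B).coeff i) hx
    simp only [coe_zinkMap, WittVector.map_coeff, Subring.coe_zero] at h
    rw [WittVector.zero_coeff] at h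
    exact h
  refine ⟨zinkMap_surjective p φ hφ n hB, isWinHom_zinkMap p φ hp2 hI _ ?_, ?_, ?_, ?_⟩
  · exact le_rfl
  · intro x hx
    rw [mem_zinkData_I, coe_zinkMap, WittVector.map_coeff] at hx
    exact hx
  · intro x hx
    have h := frobenius_mem_powW p n _ ((mem_powW_iff p n _).2 fun i => hker (hcoeff x hx i)) hn
    rw [mem_powW_iff, hA] at h
    refine Subtype.ext ?_
    ext i
    rw [Subring.coe_zero, WittVector.zero_coeff]
    exact h i
  · intro x hx
    have hm : ∀ i, (x : WittVector p A).coeff i ∈ maximalIdeal A := fun i =>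
      Ideal.pow_le_self hn (hker (hcoeff x hx i))
    have h1 : (x : WittVector p A) ∈ hatW p A := by
      rw [← mem_zinkRing_toResidue_eq_zero_iff]
      refine ⟨x.2, ?_⟩
      rw [← mem_powW_one_iff, mem_powW_iff]
      simpa using hm
    obtain ⟨M, hM⟩ := h1.2 (n + 1)
    refine ⟨M, Subtype.ext ?_⟩
    ext i
    refine (iterate_zinkShift_coeff p hp2 hm M i).trans ?_
    rw [Subring.coe_zero, WittVector.zero_coeff]
    have h2 := hM (i + M) (Nat.le_add_left _ _)
    rwa [hA, Submodule.mem_bot] at h2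

end ZinkThickening

section Trunc

variable (R : Type u) [CommRing R] [IsLocalRing R]

instance isLocalHom_mk_truncRing (a : ℕ) [NeZero a] :
    IsLocalHom (Ideal.Quotient.mk (maximalIdeal R ^ a)) :=
  IsLocalHom.of_surjective _ Ideal.Quotient.mk_surjective

/-- The projection `R_b → R_a` for `a ≤ b`. -/
abbrev truncFactor {a b : ℕ} (hab : a ≤ b) : truncRing R b →+* truncRing R a :=
  Ideal.Quotient.factorPow (maximalIdeal R) hab

instance isLocalHom_truncFactor {a b : ℕ} [NeZero a] [NeZero b] (hab : a ≤ b) :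
    IsLocalHom (truncFactor R hab) :=
  IsLocalHom.of_surjective _ (Ideal.Quotient.factor_surjective _)

theorem ker_truncFactor {a b : ℕ} [NeZero b] (hab : a ≤ b) :
    RingHom.ker (truncFactor R hab) = maximalIdeal (truncRing R b) ^ a := by
  ext x
  obtain ⟨x, rfl⟩ := Ideal.Quotient.mk_surjective x
  rw [RingHom.mem_ker, maximalIdeal_truncRing, ← Ideal.map_pow, ← Ideal.mem_comap,
    Ideal.comap_map_mk (Ideal.pow_le_pow_right hab), ← Ideal.Quotient.eq_zero_iff_mem]
  rfl

theorem ker_truncFactor_succ_sq (n : ℕ) :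
    RingHom.ker (truncFactor R (Nat.le_succ (n + 1))) * RingHom.ker (truncFactor R (Nat.le_succ (n + 1)))
      = ⊥ := by
  rw [ker_truncFactor, ← pow_add, eq_bot_iff]
  refine (Ideal.pow_le_pow_right ?_).trans (maximalIdeal_truncRing_pow R (n + 1 + 1)).le
  omega

end Trunc

/-! ### The frames of a regular local ring -/

section Presentation

variable (p : ℕ) [Fact p.Prime] (k : Type u) [Field k] [CharP k p] [PerfectRing k p] (r : ℕ)
  (E : 𝔖 p k r) (hE : MvPowerSeries.constantCoeff E = p)

/-- The data of the frame `𝓑`. -/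
noncomputable def breuilData : WinData (𝔖 p k r) :=
  principalData (frob𝔖 p k r) E ⊥ (fun y hy => E_mul_eq_zero p k r E hE y hy)
    fun y hy => by rw [(Submodule.mem_bot _).1 hy, map_zero]

theorem frob𝔖trunc_mk (a : ℕ) (s : 𝔖 p k r) :
    frob𝔖trunc p k r a (Ideal.Quotient.mk _ s) = Ideal.Quotient.mk _ (frob𝔖 p k r s) := rfl

include hE in
theorem E_mul_mem_bot_trunc (a : ℕ) (y : 𝔖trunc p k r a)
    (hy : Ideal.Quotient.mk _ E * y ∈ (⊥ : Ideal (𝔖trunc p k r a))) :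
    y ∈ (⊥ : Ideal (𝔖trunc p k r a)) := by
  obtain ⟨y, rfl⟩ := Ideal.Quotient.mk_surjective y
  rw [Submodule.mem_bot, ← map_mul, Ideal.Quotient.eq_zero_iff_mem] at hy
  rw [Submodule.mem_bot, Ideal.Quotient.eq_zero_iff_mem]
  exact E_mul_mem_J𝔖_pow p k r E hE a y hy

/-- The data of the frame `𝓑_a`. -/
noncomputable def breuilTruncData (a : ℕ) : WinData (𝔖trunc p k r a) :=
  principalData (frob𝔖trunc p k r a) (Ideal.Quotient.mk _ E) ⊥ (E_mul_mem_bot_trunc p k r E hE a)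
    fun y hy => by rw [(Submodule.mem_bot _).1 hy, map_zero]

theorem isDataOf_breuilData : WinData.IsDataOf (𝓕 := breuilFrame p k r E hE)
    (breuilData p k r E hE) :=
  isDataOf_principalData _ _ _ _ _ _

theorem isDataOf_breuilTruncData (a : ℕ) [NeZero a] :
    WinData.IsDataOf (𝓕 := breuilFrameTrunc p k r E hE a) (breuilTruncData p k r E hE a) :=
  isDataOf_principalData _ _ _ _ _ _

/-- The projection `𝔖_b → 𝔖_a` for `a ≤ b`. -/
noncomputable abbrev 𝔖truncFactor {a b : ℕ} (hab : a ≤ b) : 𝔖trunc p k r b →+* 𝔖trunc p k r a :=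
  Ideal.Quotient.factorPow (J𝔖 p k r) hab

theorem mk_mem_ker_𝔖truncFactor {a b : ℕ} (hab : a ≤ b) (s : 𝔖 p k r) :
    Ideal.Quotient.mk _ s ∈ RingHom.ker (𝔖truncFactor p k r hab) ↔ s ∈ J𝔖 p k r ^ a := by
  rw [RingHom.mem_ker, ← Ideal.Quotient.eq_zero_iff_mem]
  rfl

include hE in
theorem E_mul_mem_ker_𝔖truncFactor {a b : ℕ} (hab : a ≤ b) (y : 𝔖trunc p k r b)
    (hy : Ideal.Quotient.mk _ E * y ∈ RingHom.ker (𝔖truncFactor p k r hab)) :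
    y ∈ RingHom.ker (𝔖truncFactor p k r hab) := by
  obtain ⟨y, rfl⟩ := Ideal.Quotient.mk_surjective y
  rw [← map_mul, mk_mem_ker_𝔖truncFactor] at hy
  rw [mk_mem_ker_𝔖truncFactor]
  exact E_mul_mem_J𝔖_pow p k r E hE a y hy

theorem frob𝔖_mem_J𝔖_pow {a : ℕ} {s : 𝔖 p k r} (hs : s ∈ J𝔖 p k r ^ a) :
    frob𝔖 p k r s ∈ J𝔖 p k r ^ (p * a) := by
  have h : J𝔖 p k r ≤ (J𝔖 p k r ^ p).comap (frob𝔖 p k r) := by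
    rw [J𝔖, Ideal.span_le]
    rintro _ ⟨i, rfl⟩
    rw [SetLike.mem_coe, Ideal.mem_comap, frob𝔖_X]
    exact Ideal.pow_mem_pow (X_mem_J𝔖 p k r i) p
  rw [pow_mul]
  have h1 := Ideal.mem_map_of_mem (frob𝔖 p k r) hs
  rw [Ideal.map_pow] at h1
  exact Ideal.pow_right_mono (Ideal.map_le_iff_le_comap.2 h) a h1

/-- The endomorphism `σ` maps `J ^ (n + 1)` into `J ^ (p (n + 1))`, and `p (n + 1) ≥ n + 2`. -/
theorem frob𝔖trunc_ker (n : ℕ) (y : 𝔖trunc p k r (n + 1 + 1))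
    (hy : y ∈ RingHom.ker (𝔖truncFactor p k r (Nat.le_succ (n + 1)))) :
    frob𝔖trunc p k r (n + 1 + 1) y = 0 := by
  obtain ⟨y, rfl⟩ := Ideal.Quotient.mk_surjective y
  rw [mk_mem_ker_𝔖truncFactor] at hy
  rw [frob𝔖trunc_mk, Ideal.Quotient.eq_zero_iff_mem]
  refine Ideal.pow_le_pow_right ?_ (frob𝔖_mem_J𝔖_pow p k r hy)
  have := (Fact.out : p.Prime).two_le
  nlinarith

/-- The data of the thickening `(𝔖_{n+2}, E 𝔖_{n+2} + J^{n+1}, σ, σ₁)` of `𝓑_{n+1}`. -/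
noncomputable def breuilThickData (n : ℕ) : WinData (𝔖trunc p k r (n + 1 + 1)) :=
  principalData (frob𝔖trunc p k r (n + 1 + 1)) (Ideal.Quotient.mk _ E)
    (RingHom.ker (𝔖truncFactor p k r (Nat.le_succ (n + 1))))
    (E_mul_mem_ker_𝔖truncFactor p k r E hE _) (frob𝔖trunc_ker p k r n)

theorem isNilThickening_breuilThickData (n : ℕ) :
    IsNilThickening (breuilThickData p k r E hE n) (breuilTruncData p k r E hE (n + 1))
      (𝔖truncFactor p k r (Nat.le_succ (n + 1))) := by
  refine isNilThickening_principalData (frob𝔖trunc p k r (n + 1 + 1)) (Ideal.Quotient.mk _ E)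
    (RingHom.ker (𝔖truncFactor p k r (Nat.le_succ (n + 1))))
    (E_mul_mem_ker_𝔖truncFactor p k r E hE _) (frob𝔖trunc_ker p k r n)
    (σ₀ := frob𝔖trunc p k r (n + 1)) (𝔖truncFactor p k r (Nat.le_succ (n + 1)))
    (Ideal.Quotient.factor_surjective (Ideal.pow_le_pow_right (Nat.le_succ (n + 1)))) ?_
    (fun x => Iff.rfl) (E_mul_mem_bot_trunc p k r E hE (n + 1))
    fun y hy => by rw [(Submodule.mem_bot _).1 hy, map_zero]
  intro x
  obtain ⟨x, rfl⟩ := Ideal.Quotient.mk_surjective x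
  rfl

end Presentation

end LauFrames

namespace LauFrames

open IsLocalRing

/-! ### The homomorphisms `ϰ` and `ϰ_a` of a presented ring -/

section Presentation

variable {p : ℕ} [Fact p.Prime] {k : Type u} [Field k] [CharP k p] [PerfectRing k p] {r : ℕ}
  {R : Type u} [CommRing R] [IsLocalRing R]

/-- A presentation of `R` as `𝔖 / E𝔖`, where the image of `J` is the maximal ideal. -/
structure IsPresentation (π : 𝔖 p k r →+* R) (E : 𝔖 p k r) : Prop where
  constantCoeff_eq : MvPowerSeries.constantCoeff E = p
  map_mem : ∀ a, ∀ s ∈ J𝔖 p k r ^ a, π s ∈ maximalIdeal R ^ a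
  exists_mem : ∀ a, ∀ y ∈ maximalIdeal R ^ a, ∃ s ∈ J𝔖 p k r ^ a, π s = y
  ker_eq : RingHom.ker π = Ideal.span {E}

namespace IsPresentation

variable {π : 𝔖 p k r →+* R} {E : 𝔖 p k r} (h : IsPresentation π E)

include h in
theorem map_E : π E = 0 := by
  rw [← RingHom.mem_ker, h.ker_eq]
  exact Ideal.mem_span_singleton_self E

/-- The homomorphism `ϰ`. -/
noncomputable def hom : 𝔖 p k r →+* zinkRing p R := zinkHom π h.map_mem

theorem hom_coeff_zero (s : 𝔖 p k r) : (h.hom s : WittVector p R).coeff 0 = π s :=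
  zinkHom_coeff_zero _ _ _

theorem hom_E_coeff_zero : (h.hom E : WittVector p R).coeff 0 = 0 := by
  rw [hom_coeff_zero, h.map_E]

include h in
theorem mk_map_mem (a : ℕ) [NeZero a] : ∀ b, ∀ s ∈ J𝔖 p k r ^ b,
    ((Ideal.Quotient.mk (maximalIdeal R ^ a)).comp π) s ∈ maximalIdeal (truncRing R a) ^ b :=
  fun b s hs => map_mem_maximalIdeal_pow_of_isLocalHom (Ideal.Quotient.mk (maximalIdeal R ^ a))
    (h.map_mem b s hs)

/-- The homomorphism `ϰ_a`. -/
noncomputable def homTrunc (a : ℕ) [NeZero a] : 𝔖trunc p k r a →+* zinkRing p (truncRing R a) :=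
  Ideal.Quotient.lift _ (zinkHom _ (h.mk_map_mem a)) fun s hs =>
    zinkHom_eq_zero _ _ (maximalIdeal_truncRing_pow R a) hs

theorem homTrunc_mk (a : ℕ) [NeZero a] (s : 𝔖 p k r) :
    h.homTrunc a (Ideal.Quotient.mk _ s) = zinkHom _ (h.mk_map_mem a) s := rfl

theorem zinkMap_hom (a : ℕ) [NeZero a] (s : 𝔖 p k r) :
    zinkMap p (Ideal.Quotient.mk (maximalIdeal R ^ a)) (h.hom s) =
      h.homTrunc a (Ideal.Quotient.mk _ s) := by
  refine Subtype.ext ?_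
  rw [coe_zinkMap, homTrunc_mk, coe_zinkHom, hom, coe_zinkHom]
  ext n
  simp

theorem zinkMap_homTrunc {a b : ℕ} [NeZero a] [NeZero b] (hab : a ≤ b) (x : 𝔖trunc p k r b) :
    zinkMap p (truncFactor R hab) (h.homTrunc b x) = h.homTrunc a (𝔖truncFactor p k r hab x) := by
  obtain ⟨s, rfl⟩ := Ideal.Quotient.mk_surjective x
  rw [← zinkMap_hom]
  refine Eq.trans ?_ (h.zinkMap_hom a s)
  refine Subtype.ext ?_
  ext n
  rfl

variable [CharP (ResidueField R) p] [IsAdicComplete (maximalIdeal R) R]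
  [PerfectRing (ResidueField R) p] (hp2 : p ≠ 2)

include hp2 in
-- Units of `𝕎(R)` are detected on the first component, which is here the image of the second
-- component of `δ(E)`.
theorem isUnit_zinkShift_hom : IsUnit (zinkShift p (h.hom E)) := by
  refine isUnit_of_isUnit_zinkCoeff p R _ ?_
  rw [zinkCoeff_apply, coe_zinkShift p hp2 (by rw [h.hom_E_coeff_zero]; exact zero_mem _),
    WittVector.shift_coeff, hom, coe_zinkHom, WittVector.map_coeff]
  exact (isUnit_δ𝔖_coeff_one p k r h.constantCoeff_eq).map π

/-- The unit `u` with `p u = ϰ(σ(E))`. -/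
noncomputable def unit : (zinkRing p R)ˣ := (h.isUnit_zinkShift_hom hp2).unit

theorem coe_unit : (h.unit hp2 : zinkRing p R) = zinkShift p (h.hom E) := IsUnit.unit_spec _

/-- The image of `u` in `𝕎(R_a)`. -/
noncomputable def unitTrunc (a : ℕ) [NeZero a] : (zinkRing p (truncRing R a))ˣ :=
  Units.map (zinkMap p (Ideal.Quotient.mk (maximalIdeal R ^ a))) (h.unit hp2)

theorem coe_unitTrunc (a : ℕ) [NeZero a] : (h.unitTrunc hp2 a : zinkRing p (truncRing R a)) =
    zinkMap p (Ideal.Quotient.mk (maximalIdeal R ^ a)) (h.unit hp2) := rfl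

theorem zinkShift_homTrunc_E (a : ℕ) [NeZero a] :
    zinkShift p (h.homTrunc a (Ideal.Quotient.mk _ E)) = h.unitTrunc hp2 a := by
  rw [← zinkMap_hom, coe_unitTrunc, coe_unit, zinkShift_zinkMap p _ hp2]
  rw [h.hom_E_coeff_zero]
  exact zero_mem _

theorem homTrunc_mk_coeff_zero (a : ℕ) [NeZero a] (s : 𝔖 p k r) :
    (h.homTrunc a (Ideal.Quotient.mk _ s) : WittVector p (truncRing R a)).coeff 0 =
      Ideal.Quotient.mk _ (π s) := zinkHom_coeff_zero _ (h.mk_map_mem a) s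

theorem frobZink_homTrunc (a : ℕ) [NeZero a] (x : 𝔖trunc p k r a) :
    frobZink p (h.homTrunc a x) = h.homTrunc a (frob𝔖trunc p k r a x) := by
  obtain ⟨s, rfl⟩ := Ideal.Quotient.mk_surjective x
  exact frobZink_zinkHom _ (h.mk_map_mem a) s

theorem isWinHom_hom : IsWinHom (breuilData p k r E h.constantCoeff_eq)
    (zinkData p hp2 (⊥ : Ideal R) (Ideal.mul_bot _)) h.hom (h.unit hp2) := by
  refine isWinHom_principalData _ _ _ _ _ _ _ _ (frobZink_zinkHom π h.map_mem) ?_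
    (h.coe_unit hp2).symm ?_
  · exact (mem_zinkData_I p hp2 _ _ _).2 h.hom_E_coeff_zero
  · intro x hx
    rw [(Submodule.mem_bot _).1 hx, map_zero]
    exact ⟨zero_mem _, WinData.τ_zero _⟩

theorem isWinHom_homTrunc (a : ℕ) [NeZero a] :
    IsWinHom (breuilTruncData p k r E h.constantCoeff_eq a)
      (zinkData p hp2 (⊥ : Ideal (truncRing R a)) (Ideal.mul_bot _)) (h.homTrunc a)
      (h.unitTrunc hp2 a) := by
  refine isWinHom_principalData _ _ _ _ _ _ _ _ (h.frobZink_homTrunc a) ?_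
    (h.zinkShift_homTrunc_E hp2 a) ?_
  · refine (mem_zinkData_I p hp2 _ _ _).2 ?_
    rw [homTrunc_mk_coeff_zero, h.map_E, map_zero]
    exact zero_mem _
  · intro x hx
    rw [(Submodule.mem_bot _).1 hx, map_zero]
    exact ⟨zero_mem _, WinData.τ_zero _⟩

/-- For `s ∈ J ^ (n + 1)` the components of `ϰ(s)` of index `m ≥ 1` lie in `𝔪 ^ ((n + 1) p ^ m)`,
which is zero in `R_{n+2}`. So `ϰ(s)` is a Teichmüller element and its shift vanishes, in accordance
with `σ₁ = 0` on the kernel in `𝔖_{n+2}`. -/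
theorem isWinHom_homThick (n : ℕ) :
    IsWinHom (breuilThickData p k r E h.constantCoeff_eq n)
      (zinkData p hp2 (RingHom.ker (truncFactor R (Nat.le_succ (n + 1))))
        (ker_truncFactor_succ_sq R n)) (h.homTrunc (n + 1 + 1)) (h.unitTrunc hp2 (n + 1 + 1)) := by
  refine isWinHom_principalData _ _ _ _ _ _ _ _ (h.frobZink_homTrunc (n + 1 + 1)) ?_
    (h.zinkShift_homTrunc_E hp2 (n + 1 + 1)) ?_
  · refine (mem_zinkData_I p hp2 _ _ _).2 ?_
    rw [homTrunc_mk_coeff_zero, h.map_E, map_zero]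
    exact zero_mem _
  · intro x hx
    obtain ⟨s, rfl⟩ := Ideal.Quotient.mk_surjective x
    rw [mk_mem_ker_𝔖truncFactor] at hx
    have h1 : (h.homTrunc (n + 1 + 1) (Ideal.Quotient.mk _ s) :
        WittVector p (truncRing R (n + 1 + 1))).coeff 0 ∈ maximalIdeal _ ^ (n + 1) := by
      rw [homTrunc_mk_coeff_zero]
      exact map_mem_maximalIdeal_pow_of_isLocalHom _ (h.map_mem _ _ hx)
    refine ⟨(mem_zinkData_I p hp2 _ _ _).2 ?_, Subtype.ext ?_⟩
    · rwa [ker_truncFactor]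
    · refine (coe_zinkShift p hp2 (Ideal.pow_le_self n.succ_ne_zero h1)).trans ?_
      ext m
      rw [WittVector.shift_coeff, Subring.coe_zero, WittVector.zero_coeff]
      have h2 := map_δ𝔖_coeff_mem _ (h.mk_map_mem (n + 1 + 1)) hx (1 + m)
      have h3 : n + 1 + 1 ≤ (n + 1) * p ^ (1 + m) := by
        have h4 : 1 < p ^ (1 + m) := Nat.one_lt_pow (by omega) (Fact.out : p.Prime).one_lt
        nlinarith
      have h5 := Ideal.pow_le_pow_right h3 h2
      rwa [maximalIdeal_truncRing_pow, Submodule.mem_bot] at h5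

include h in
-- Since `𝔪 ^ a = π(J ^ a)` and `ker π = E𝔖`, the preimage of `𝔪 ^ a` is `E𝔖 + J ^ a`; in other
-- words `𝔖_a / E𝔖_a = R_a`.
theorem mem_span_of_map_mem {a : ℕ} {s : 𝔖 p k r} (hs : π s ∈ maximalIdeal R ^ a) :
    ∃ y, s - E * y ∈ J𝔖 p k r ^ a := by
  obtain ⟨t, ht, hts⟩ := h.exists_mem a _ hs
  have h1 : s - t ∈ RingHom.ker π := by rw [RingHom.mem_ker, map_sub, hts, sub_self]
  rw [h.ker_eq, Ideal.mem_span_singleton] at h1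
  obtain ⟨y, hy⟩ := h1
  exact ⟨y, by rwa [← hy, sub_sub_cancel]⟩

theorem hom_reflect (s : 𝔖 p k r)
    (hs : h.hom s ∈ (zinkData p hp2 (⊥ : Ideal R) (Ideal.mul_bot _)).I) :
    s ∈ (breuilData p k r E h.constantCoeff_eq).I := by
  rw [mem_zinkData_I, hom_coeff_zero, Submodule.mem_bot, ← RingHom.mem_ker, h.ker_eq] at hs
  exact (le_sup_left : _ ≤ Ideal.span {E} ⊔ ⊥) hs

theorem homTrunc_reflect (a : ℕ) [NeZero a] (x : 𝔖trunc p k r a)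
    (hx : h.homTrunc a x ∈ (zinkData p hp2 (⊥ : Ideal (truncRing R a)) (Ideal.mul_bot _)).I) :
    x ∈ (breuilTruncData p k r E h.constantCoeff_eq a).I := by
  obtain ⟨s, rfl⟩ := Ideal.Quotient.mk_surjective x
  rw [mem_zinkData_I, homTrunc_mk_coeff_zero, Submodule.mem_bot,
    Ideal.Quotient.eq_zero_iff_mem] at hx
  obtain ⟨y, hy⟩ := h.mem_span_of_map_mem hx
  refine (mem_span_singleton_sup_iff _ _).2 ⟨Ideal.Quotient.mk _ y, ?_⟩
  rwa [← map_mul, ← map_sub, Submodule.mem_bot, Ideal.Quotient.eq_zero_iff_mem]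

theorem isThickeningSquare (n : ℕ) : IsThickeningSquare
    (breuilTruncData p k r E h.constantCoeff_eq (n + 1 + 1))
    (breuilThickData p k r E h.constantCoeff_eq n)
    (breuilTruncData p k r E h.constantCoeff_eq (n + 1))
    (zinkData p hp2 (⊥ : Ideal (truncRing R (n + 1 + 1))) (Ideal.mul_bot _))
    (zinkData p hp2 (RingHom.ker (truncFactor R (Nat.le_succ (n + 1))))
        (ker_truncFactor_succ_sq R n))
    (zinkData p hp2 (⊥ : Ideal (truncRing R (n + 1))) (Ideal.mul_bot _))
    (𝔖truncFactor p k r (Nat.le_succ (n + 1))) (zinkMap p (truncFactor R (Nat.le_succ (n + 1))))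
    (h.homTrunc (n + 1 + 1)) (h.homTrunc (n + 1)) (h.unitTrunc hp2 (n + 1 + 1))
    (h.unitTrunc hp2 (n + 1)) where
  nil := isNilThickening_breuilThickData p k r E h.constantCoeff_eq n
  nil' := isNilThickening_zinkData p hp2 _ (Ideal.Quotient.factor_surjective _) n.succ_ne_zero
    (maximalIdeal_truncRing_pow R _) (maximalIdeal_truncRing_pow R _) (ker_truncFactor R _).le _
  comm := h.zinkMap_homTrunc _
  map_u := by
    refine Subtype.ext ?_
    ext n
    rfl
  ext := principalData_extends _ _ _ _ _ _ _
  ext' := zinkData_extends p hp2 _ _ _ bot_le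
  hom := h.isWinHom_homThick hp2 n
  reflect := h.homTrunc_reflect hp2 _
  τ_ker x hx := principalData_τ_ker _ _ _ _ _ hx
  -- Modulo the smaller ideal only the first component of `y` matters. It lies in `𝔪 ^ (n + 1) / 𝔪 ^
  -- (n + 2)`, and every such class is the image of an element of `J ^ (n + 1)`.
  surj y hy := by
    rw [mem_zinkData_I] at hy
    obtain ⟨z, hz⟩ := Ideal.Quotient.mk_surjective ((y : WittVector p (truncRing R (n + 1 + 1))).coeff 0)
    have hzm : z ∈ maximalIdeal R ^ (n + 1) := by
      rw [← hz, RingHom.mem_ker] at hy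
      exact Ideal.Quotient.eq_zero_iff_mem.1 hy
    obtain ⟨s, hs, hsz⟩ := h.exists_mem _ _ hzm
    refine ⟨Ideal.Quotient.mk _ s, (mk_mem_ker_𝔖truncFactor p k r _ s).2 hs, ?_⟩
    rw [mem_zinkData_I, Submodule.mem_bot, ← zinkCoeff_apply, map_sub, zinkCoeff_apply,
      zinkCoeff_apply, homTrunc_mk_coeff_zero, hsz, hz, sub_self]

end IsPresentation

end Presentation

end LauFrames

namespace LauFrames

open IsLocalRing

/-! ### Bijective homomorphisms of frames -/

section Bijective

variable {S W : Type*} [CommRing S] [CommRing W] {D : WinData S} {D' : WinData W} {ϰ : S →+* W}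
  {u : Wˣ}

theorem IsWinHom.fullyFaithful_of_bijective (h : IsWinHom D D' ϰ u) (hb : Function.Bijective ϰ)
    (hr : ∀ x, ϰ x ∈ D'.I → x ∈ D.I) : FullyFaithful D D' ϰ u := by
  intro c d c' d' A B hA hB X' hX' hXA
  have hinj : ∀ {m n : Type} {Y Z : Matrix m n S}, Y.map ϰ = Z.map ϰ → Y = Z := fun hYZ =>
    Matrix.map_injective hb.1 hYZ
  obtain ⟨X, rfl⟩ := exists_matrix_map_eq hb.2 X'
  have hX : D.Adm X := fun i j => hr _ (hX' i j)
  refine ⟨X, ⟨hX, hinj ?_, rfl⟩, fun Y hY => hinj hY.2.2⟩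
  rw [bcMatrix, bcMatrix, Matrix.mul_assoc (B.map ϰ), h.sharp_map hX, ← Matrix.mul_assoc,
    ← Matrix.mul_assoc, ← Matrix.map_mul, ← Matrix.map_mul] at hXA
  obtain ⟨T, hT⟩ := (isUnit_twist (Fin c) (Fin d) u).exists_right_inv
  have h1 := congrArg (· * T) hXA
  simpa only [Matrix.mul_assoc, hT, Matrix.mul_one] using h1

theorem exists_bcMatrix_eq [IsLocalHom ϰ] (hs : Function.Surjective ϰ) (u : Wˣ) {c d : Type*}
    [Fintype c] [Fintype d] [DecidableEq c] [DecidableEq d] {A' : Matrix (c ⊕ d) (c ⊕ d) W}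
    (hA' : IsUnit A') : ∃ A : Matrix (c ⊕ d) (c ⊕ d) S, IsUnit A ∧ bcMatrix ϰ u A = A' := by
  obtain ⟨T, hT⟩ := (isUnit_twist c d u).exists_left_inv
  obtain ⟨A, hA⟩ := exists_matrix_map_eq hs (A' * T)
  refine ⟨A, isUnit_of_isUnit_map ϰ ?_, ?_⟩
  · rw [hA]
    exact hA'.mul (IsUnit.of_mul_eq_one _ hT)
  · rw [bcMatrix, hA, Matrix.mul_assoc, hT, Matrix.mul_one]

end Bijective

/-! ### The case `a = 1`, and full faithfulness at all finite levels -/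

namespace IsPresentation

variable {p : ℕ} [Fact p.Prime] {k : Type u} [Field k] [CharP k p] [PerfectRing k p] {r : ℕ}
  {R : Type u} [CommRing R] [IsLocalRing R] [CharP (ResidueField R) p]
  [IsAdicComplete (maximalIdeal R) R] [PerfectRing (ResidueField R) p]
  {π : 𝔖 p k r →+* R} {E : 𝔖 p k r} (h : IsPresentation π E)

omit [CharP (ResidueField R) p] [IsAdicComplete (maximalIdeal R) R]
  [PerfectRing (ResidueField R) p] in
theorem homTrunc_one_C (s : 𝔖 p k r) : h.homTrunc 1 (Ideal.Quotient.mk _ s) =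
    h.homTrunc 1 (Ideal.Quotient.mk _ (MvPowerSeries.C (MvPowerSeries.constantCoeff s))) := by
  congr 1
  rw [Ideal.Quotient.eq, pow_one]
  exact sub_C_mem_J𝔖 p k r s

/-- The homomorphism `W(k) → W(k')` induced by `ϰ`, where `k'` is the residue field of `R / 𝔪`. -/
noncomputable def residueHom :
    WittVector p k →+* WittVector p (ResidueField (truncRing R 1)) :=
  (toResidue p).comp ((zinkRing p (truncRing R 1)).subtype.comp
    ((h.homTrunc 1).comp ((Ideal.Quotient.mk _).comp MvPowerSeries.C)))

omit [CharP (ResidueField R) p] [IsAdicComplete (maximalIdeal R) R]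
  [PerfectRing (ResidueField R) p] in
theorem toResidue_homTrunc_one (s : 𝔖 p k r) :
    toResidue p (h.homTrunc 1 (Ideal.Quotient.mk _ s) : WittVector p (truncRing R 1)) =
      h.residueHom (MvPowerSeries.constantCoeff s) := by
  rw [homTrunc_one_C]
  rfl

/-- A nonzero element of `W(k)` is a unit times a power of `p`, and powers of `p` are nonzero in the
target. -/
theorem residueHom_injective : Function.Injective h.residueHom := by
  rw [injective_iff_map_eq_zero]
  intro c hc
  by_contra hc0
  obtain ⟨n, b, rfl⟩ := WittVector.exists_eq_pow_p_mul' c hc0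
  rw [map_mul, map_pow, map_natCast] at hc
  have h1 : (p : WittVector p (ResidueField (truncRing R 1))) ^ n ≠ 0 :=
    pow_ne_zero _ (WittVector.irreducible p).ne_zero
  exact (b.isUnit.map h.residueHom).ne_zero ((mul_eq_zero.1 hc).resolve_left h1)

/-- By `p`-adic completeness it suffices to argue modulo `p`, where the map is `k → k'`; this is
surjective because `π` is. -/
theorem residueHom_surjective : Function.Surjective h.residueHom := by
  have hmap : (Ideal.span {(p : WittVector p k)}).map h.residueHom =
      Ideal.span {(p : WittVector p (ResidueField (truncRing R 1)))} := by
    rw [Ideal.map_span, Set.image_singleton, map_natCast]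
  have : IsHausdorff ((Ideal.span {(p : WittVector p k)}).map h.residueHom)
      (WittVector p (ResidueField (truncRing R 1))) := by
    rw [hmap]; infer_instance
  refine surjective_of_mk_map_comp_surjective (I := Ideal.span {(p : WittVector p k)}) _ fun y => ?_
  obtain ⟨y, rfl⟩ := Ideal.Quotient.mk_surjective y
  obtain ⟨t, ht⟩ := residue_surjective (y.coeff 0)
  obtain ⟨t, rfl⟩ := Ideal.Quotient.mk_surjective t
  obtain ⟨s, -, rfl⟩ := h.exists_mem 0 t (by simp)
  refine ⟨MvPowerSeries.constantCoeff s, ?_⟩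
  rw [RingHom.comp_apply, Ideal.Quotient.eq, hmap, WittVector.mem_span_p_iff_coeff_zero_eq_zero,
    ← toResidue_homTrunc_one, ← WittVector.constantCoeff_apply, map_sub,
    WittVector.constantCoeff_apply, WittVector.constantCoeff_apply, toResidue,
    WittVector.map_coeff, homTrunc_mk_coeff_zero, ht, sub_self]

/-- The maximal ideal of `R_1` is zero, hence so is `Ŵ(𝔪)`, and `𝕎(R_1)` is identified with the Witt
vectors of the residue field. On the other side `𝔖 / J = W(k)`. -/
theorem homTrunc_one_bijective : Function.Bijective (h.homTrunc 1) := by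
  constructor
  · rw [injective_iff_map_eq_zero]
    intro x hx
    obtain ⟨s, rfl⟩ := Ideal.Quotient.mk_surjective x
    have h1 := h.toResidue_homTrunc_one s
    rw [hx, Subring.coe_zero, map_zero] at h1
    rw [Ideal.Quotient.eq_zero_iff_mem, pow_one, mem_J𝔖_iff]
    exact h.residueHom_injective (h1.symm.trans (map_zero _).symm)
  · rintro (y : zinkRing p (truncRing R 1))
    obtain ⟨c, hc⟩ := h.residueHom_surjective (toResidue p (y : WittVector p (truncRing R 1)))
    refine ⟨Ideal.Quotient.mk _ (MvPowerSeries.C c), Subtype.ext (sub_eq_zero.1 ?_)⟩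
    let x : zinkRing p (truncRing R 1) := h.homTrunc 1 (Ideal.Quotient.mk _ (MvPowerSeries.C c))
    have hx : toResidue p ((x : WittVector p (truncRing R 1)) - (y : WittVector p (truncRing R 1))) = 0 := by
      rw [map_sub, toResidue_homTrunc_one, MvPowerSeries.constantCoeff_C, hc, sub_self]
    have h1 := ((mem_zinkRing_toResidue_eq_zero_iff p _).1 ⟨sub_mem x.2 y.2, hx⟩).1
    change (x : WittVector p (truncRing R 1)) - (y : WittVector p (truncRing R 1)) = 0
    ext n
    have h2 := h1 n
    rw [← pow_one (maximalIdeal (truncRing R 1)), maximalIdeal_truncRing_pow,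
      Submodule.mem_bot] at h2
    rw [h2, WittVector.zero_coeff]

variable (hp2 : p ≠ 2)

theorem fullyFaithful_homTrunc_succ (n : ℕ) :
    FullyFaithful (breuilTruncData p k r E h.constantCoeff_eq (n + 1))
      (zinkData p hp2 (⊥ : Ideal (truncRing R (n + 1))) (Ideal.mul_bot _)) (h.homTrunc (n + 1))
      (h.unitTrunc hp2 (n + 1)) := by
  induction n with
  | zero =>
    exact (h.isWinHom_homTrunc hp2 1).fullyFaithful_of_bijective h.homTrunc_one_bijective
      (h.homTrunc_reflect hp2 1)
  | succ n ih => exact (h.isThickeningSquare hp2 n).fullyFaithful ih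

end IsPresentation

end LauFrames

namespace LauFrames

open IsLocalRing

/-! ### Passage to the limit -/

section Limits

theorem exists_mk_eq {A : Type*} [CommRing A] (I : Ideal A) [IsAdicComplete I A]
    (x : ∀ n, A ⧸ I ^ (n + 1))
    (hx : ∀ n, Ideal.Quotient.factorPow I (show n + 1 ≤ n + 1 + 1 from Nat.le_succ (n + 1))
      (x (n + 1)) = x n) :
    ∃ a, ∀ n, Ideal.Quotient.mk (I ^ (n + 1)) a = x n := by
  choose f hf using fun n => Ideal.Quotient.mk_surjective (x n)
  have hstep : ∀ n, f (n + 1) - f n ∈ I ^ (n + 1) := by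
    intro n
    rw [← Ideal.Quotient.eq, hf, ← hx, ← hf]
    rfl
  have hmono : ∀ m n, m ≤ n → f n - f m ∈ I ^ (m + 1) := by
    intro m n hmn
    induction n, hmn using Nat.le_induction with
    | base => simp
    | succ n hmn ih =>
      rw [← sub_add_sub_cancel (f (n + 1)) (f n) (f m)]
      exact add_mem (Ideal.pow_le_pow_right (by omega) (hstep n)) ih
  obtain ⟨a, ha⟩ := IsPrecomplete.prec (I := I) inferInstance (f := f) (by
    intro m n hmn
    rw [SModEq.comm, SModEq.sub_mem, smul_eq_mul, Ideal.mul_top]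
    exact Ideal.pow_le_pow_right m.le_succ (hmono m n hmn))
  refine ⟨a, fun n => ?_⟩
  have h1 := ha (n + 1)
  rw [SModEq.comm, SModEq.sub_mem, smul_eq_mul, Ideal.mul_top] at h1
  rw [← hf, Ideal.Quotient.eq, ← sub_add_sub_cancel a (f (n + 1)) (f n)]
  exact add_mem h1 (hstep n)

theorem exists_matrix_mk_eq {A l m : Type*} [CommRing A] (I : Ideal A) [IsAdicComplete I A]
    (X : ∀ n, Matrix l m (A ⧸ I ^ (n + 1)))
    (hX : ∀ n, (X (n + 1)).map
      (Ideal.Quotient.factorPow I (show n + 1 ≤ n + 1 + 1 from Nat.le_succ (n + 1))) = X n) :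
    ∃ Y : Matrix l m A, ∀ n, Y.map (Ideal.Quotient.mk (I ^ (n + 1))) = X n := by
  choose Y hY using fun i j => exists_mk_eq I (fun n => X n i j) fun n =>
    congrFun (congrFun (hX n) i) j
  exact ⟨Matrix.of Y, fun n => Matrix.ext fun i j => hY i j n⟩

theorem eq_of_mk_eq {A : Type*} [CommRing A] (I : Ideal A) [IsHausdorff I A] {a b : A}
    (hab : ∀ n, Ideal.Quotient.mk (I ^ (n + 1)) a = Ideal.Quotient.mk (I ^ (n + 1)) b) : a = b := by
  refine sub_eq_zero.1 (IsHausdorff.haus (I := I) inferInstance _ fun n => ?_)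
  rw [SModEq.zero, smul_eq_mul, Ideal.mul_top]
  exact Ideal.pow_le_pow_right n.le_succ (Ideal.Quotient.eq.1 (hab n))

variable (p : ℕ) [Fact p.Prime] {R : Type u} [CommRing R] [IsLocalRing R]
  [CharP (ResidueField R) p] [IsAdicComplete (maximalIdeal R) R] [PerfectRing (ResidueField R) p]

/-- Subtract a Frobenius-perfect `z` with the same residue. At each finite level the difference lies
in `𝕎` with residue zero, hence in `Ŵ(𝔪)`; so almost all of its components lie in any given power of
`𝔪`. -/
theorem mem_zinkRing_of_forall {x : WittVector p R}
    (hx : ∀ n, WittVector.map (Ideal.Quotient.mk (maximalIdeal R ^ (n + 1))) x ∈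
      zinkRing p (truncRing R (n + 1))) : x ∈ zinkRing p R := by
  obtain ⟨z, hz, hzx⟩ := exists_frobPerfect_lift p (toResidue p x)
  have h1 : toResidue p (x - z) = 0 := by rw [map_sub, hzx, sub_self]
  refine ⟨z, hz, fun i => ?_, fun N => ?_⟩
  · have h2 := (mem_powW_one_iff p _).2 h1
    rw [mem_powW_iff, pow_one] at h2
    exact h2 i
  · have h2 := ((mem_zinkRing_toResidue_eq_zero_iff p
      (WittVector.map (Ideal.Quotient.mk (maximalIdeal R ^ (N + 1))) (x - z))).1 ⟨by
        rw [map_sub]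
        exact sub_mem (hx N) (frobPerfect_le_zinkRing p (map_mem_frobPerfect p _ hz)), by
        rw [toResidue_map, h1, map_zero]⟩).2 (N + 1)
    obtain ⟨M, hM⟩ := h2
    refine ⟨M, fun i hi => Ideal.pow_le_pow_right N.le_succ ?_⟩
    have h3 := hM i hi
    rwa [maximalIdeal_truncRing_pow, Submodule.mem_bot, WittVector.map_coeff,
      Ideal.Quotient.eq_zero_iff_mem] at h3

theorem zinkRing_eq_of_forall {x y : zinkRing p R}
    (hxy : ∀ n, zinkMap p (Ideal.Quotient.mk (maximalIdeal R ^ (n + 1))) x =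
      zinkMap p (Ideal.Quotient.mk (maximalIdeal R ^ (n + 1))) y) : x = y := by
  refine Subtype.ext ?_
  ext i
  refine eq_of_mk_eq (maximalIdeal R) fun n => ?_
  have h := congrArg (fun z : zinkRing p (truncRing R (n + 1)) =>
    (z : WittVector p (truncRing R (n + 1))).coeff i) (hxy n)
  simpa only [coe_zinkMap, WittVector.map_coeff] using h

theorem exists_zinkMap_eq (x : ∀ n, zinkRing p (truncRing R (n + 1)))
    (hx : ∀ n, zinkMap p (truncFactor R (Nat.le_succ (n + 1))) (x (n + 1)) = x n) :
    ∃ y : zinkRing p R, ∀ n, zinkMap p (Ideal.Quotient.mk (maximalIdeal R ^ (n + 1))) y = x n := by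
  choose y hy using fun i => exists_mk_eq (maximalIdeal R)
    (fun n => (x n : WittVector p (truncRing R (n + 1))).coeff i) fun n => by
      have h := congrArg (fun z : zinkRing p (truncRing R (n + 1)) =>
        (z : WittVector p (truncRing R (n + 1))).coeff i) (hx n)
      simpa only [coe_zinkMap, WittVector.map_coeff] using h
  have hmap : ∀ n, WittVector.map (Ideal.Quotient.mk (maximalIdeal R ^ (n + 1)))
      (WittVector.mk p y) = x n := by
    intro n
    ext i
    rw [WittVector.map_coeff, WittVector.coeff_mk, hy]
  refine ⟨⟨WittVector.mk p y, mem_zinkRing_of_forall p fun n => ?_⟩, fun n => Subtype.ext (hmap n)⟩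
  rw [hmap]
  exact (x n).2

theorem exists_matrix_zinkMap_eq {l m : Type*}
    (X : ∀ n, Matrix l m (zinkRing p (truncRing R (n + 1))))
    (hX : ∀ n, (X (n + 1)).map (zinkMap p (truncFactor R (Nat.le_succ (n + 1)))) = X n) :
    ∃ Y : Matrix l m (zinkRing p R),
      ∀ n, Y.map (zinkMap p (Ideal.Quotient.mk (maximalIdeal R ^ (n + 1)))) = X n := by
  choose Y hY using fun i j => exists_zinkMap_eq p (fun n => X n i j) fun n =>
    congrFun (congrFun (hX n) i) j
  exact ⟨Matrix.of Y, fun n => Matrix.ext fun i j => hY i j n⟩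

end Limits

theorem IsWinHom.sharp_map_one {S S₀ : Type*} [CommRing S] [CommRing S₀] {D : WinData S}
    {D₀ : WinData S₀} {q : S →+* S₀} (h : IsWinHom D D₀ q 1) {c d c' d' : Type*} [Fintype c]
    [Fintype d] [Fintype c'] [Fintype d'] [DecidableEq c] [DecidableEq d] [DecidableEq c']
    [DecidableEq d'] {X : Matrix (c ⊕ d) (c' ⊕ d') S} (hX : D.Adm X) :
    (D.sharp X).map q = D₀.sharp (X.map q) := by
  have h1 := h.sharp_map hX
  rw [twist_one, twist_one, Matrix.one_mul, Matrix.mul_one] at h1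
  exact h1.symm

/-! ### Full faithfulness and essential surjectivity of `ϰ`, and essential surjectivity of `ϰ_a` -/

namespace IsPresentation

variable {p : ℕ} [Fact p.Prime] {k : Type u} [Field k] [CharP k p] [PerfectRing k p] {r : ℕ}
  {R : Type u} [CommRing R] [IsLocalRing R] [CharP (ResidueField R) p]
  [IsAdicComplete (maximalIdeal R) R] [PerfectRing (ResidueField R) p]
  {π : 𝔖 p k r →+* R} {E : 𝔖 p k r} (h : IsPresentation π E) (hp2 : p ≠ 2)

omit [CharP (ResidueField R) p] [IsAdicComplete (maximalIdeal R) R]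
  [PerfectRing (ResidueField R) p] [IsLocalRing R] [CommRing R] in
theorem isWinHom_mk (E : 𝔖 p k r) (hE : MvPowerSeries.constantCoeff E = p) (a : ℕ) :
    IsWinHom (breuilData p k r E hE) (breuilTruncData p k r E hE a)
      (Ideal.Quotient.mk (J𝔖 p k r ^ a)) 1 := by
  refine isWinHom_principalData _ _ _ _ _ _ _ _ (fun x => rfl) ?_ ?_ ?_
  · exact (le_sup_left : _ ≤ Ideal.span {Ideal.Quotient.mk (J𝔖 p k r ^ a) E} ⊔ ⊥)
      (Ideal.mem_span_singleton_self _)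
  · rw [Units.val_one, ← map_one (frob𝔖trunc p k r a)]
    refine principalData_τ _ _ _ _ _ ?_
    rw [mul_one, sub_self]
    exact zero_mem _
  · intro x hx
    rw [(Submodule.mem_bot _).1 hx, map_zero]
    exact ⟨zero_mem _, WinData.τ_zero _⟩

theorem isWinHom_zinkMap_mk (a : ℕ) [NeZero a] :
    IsWinHom (zinkData p hp2 (⊥ : Ideal R) (Ideal.mul_bot _))
      (zinkData p hp2 (⊥ : Ideal (truncRing R a)) (Ideal.mul_bot _))
      (zinkMap p (Ideal.Quotient.mk (maximalIdeal R ^ a))) 1 :=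
  isWinHom_zinkMap p _ hp2 _ _ bot_le

/-- The unique solutions over the rings `𝔖_{n+1}` form a compatible system, whose limit over `𝔖` is
the solution. All required identities and the uniqueness are checked at finite levels. -/
theorem fullyFaithful_hom : FullyFaithful (breuilData p k r E h.constantCoeff_eq)
    (zinkData p hp2 (⊥ : Ideal R) (Ideal.mul_bot _)) h.hom (h.unit hp2) := by
  intro c d c' d' A B hA hB X' hX' hXA
  let q := fun n : ℕ => Ideal.Quotient.mk (J𝔖 p k r ^ (n + 1))
  let q' := fun n : ℕ => zinkMap p (Ideal.Quotient.mk (maximalIdeal R ^ (n + 1)))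
  have hbc : ∀ n {c d : ℕ} (A : Matrix (Fin c ⊕ Fin d) (Fin c ⊕ Fin d) (𝔖 p k r)),
      (bcMatrix h.hom (h.unit hp2) A).map (q' n) =
        bcMatrix (h.homTrunc (n + 1)) (h.unitTrunc hp2 (n + 1)) (A.map (q n)) :=
    fun n c d A => bcMatrix_map (h.zinkMap_hom (n + 1)) rfl A
  have hX'n : ∀ n, (zinkData p hp2 (⊥ : Ideal (truncRing R (n + 1))) (Ideal.mul_bot _)).Adm
      (X'.map (q' n)) := fun n => (isWinHom_zinkMap_mk hp2 (n + 1)).adm hX'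
  have hex : ∀ n, _ := fun n => h.fullyFaithful_homTrunc_succ hp2 n c d c' d' (A.map (q n))
    (B.map (q n)) (isUnit_map_matrix _ hA) (isUnit_map_matrix _ hB) (X'.map (q' n)) (hX'n n) (by
      rw [← hbc, ← hbc, ← (isWinHom_zinkMap_mk hp2 (n + 1)).sharp_map_one hX', ← Matrix.map_mul,
        ← Matrix.map_mul, hXA])
  choose X hX huniq using hex
  -- The reduction of the solution at the next level solves the same problem, so uniqueness
  -- identifies it with the solution at this level.
  have hcompat : ∀ n, (X (n + 1)).map (𝔖truncFactor p k r (Nat.le_succ (n + 1))) = X n := by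
    intro n
    have hF := (isNilThickening_breuilThickData p k r E h.constantCoeff_eq n)
    have hext := (h.isThickeningSquare hp2 n).ext
    have hadm := hext.I_le
    have hXt : (breuilThickData p k r E h.constantCoeff_eq n).Adm (X (n + 1)) :=
      fun i j => hadm ((hX (n + 1)).1 i j)
    refine huniq n _ ⟨hF.hom.adm hXt, ?_, ?_⟩
    · rw [← hF.hom.sharp_map_one hXt, hext.sharp_eq (hX (n + 1)).1]
      have h1 := congrArg (fun M => M.map (𝔖truncFactor p k r (Nat.le_succ (n + 1))))
        (hX (n + 1)).2.1
      simp only [Matrix.map_mul] at h1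
      exact h1
    · have h1 := congrArg (fun M => M.map (zinkMap p (truncFactor R (Nat.le_succ (n + 1)))))
        (hX (n + 1)).2.2
      refine Eq.trans ?_ (h1.trans ?_)
      · ext1 i j
        exact (h.zinkMap_homTrunc (Nat.le_succ (n + 1)) _).symm
      · ext1 i j
        refine Subtype.ext ?_
        ext m
        rfl
  obtain ⟨Y, hYX⟩ := exists_matrix_mk_eq (J𝔖 p k r) X hcompat
  have hYX' : Y.map h.hom = X' := by
    ext1 i j
    refine zinkRing_eq_of_forall p fun n => ?_
    have h1 := congrFun (congrFun (hX n).2.2 i) j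
    rw [← hYX n] at h1
    exact (h.zinkMap_hom (n + 1) _).trans h1
  have hYa : (breuilData p k r E h.constantCoeff_eq).Adm Y := fun i j => by
    refine h.hom_reflect hp2 _ ?_
    rw [← hYX'] at hX'
    exact hX' i j
  refine ⟨Y, ⟨hYa, ?_, hYX'⟩, ?_⟩
  · ext1 i j
    refine eq_of_mk_eq (J𝔖 p k r) fun n => ?_
    have h1 := (hX n).2.1
    rw [← hYX n, ← (isWinHom_mk E h.constantCoeff_eq (n + 1)).sharp_map_one hYa, ← Matrix.map_mul,
      ← Matrix.map_mul] at h1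
    exact congrFun (congrFun h1 i) j
  · rintro Z ⟨hZ, hZA, hZX⟩
    ext1 i j
    refine eq_of_mk_eq (J𝔖 p k r) fun n => ?_
    have h1 : Z.map (q n) = Y.map (q n) := by
      refine (huniq n (Z.map (q n))
        ⟨(isWinHom_mk E h.constantCoeff_eq (n + 1)).adm hZ, ?_, ?_⟩).trans (hYX n).symm
      · rw [← (isWinHom_mk E h.constantCoeff_eq (n + 1)).sharp_map_one hZ, ← Matrix.map_mul,
          ← Matrix.map_mul, hZA]
      · rw [← hZX]
        ext1 i j
        exact (h.zinkMap_hom (n + 1) _).symm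
    exact congrFun (congrFun h1 i) j

/-- A matrix over `𝔖_{n+1}` and an isomorphism between its base change and the matrix `A'`. -/
structure ApproxLift {c d : ℕ} (A' : Matrix (Fin c ⊕ Fin d) (Fin c ⊕ Fin d) (zinkRing p R))
    (n : ℕ) where
  A : Matrix (Fin c ⊕ Fin d) (Fin c ⊕ Fin d) (𝔖trunc p k r (n + 1))
  X : Matrix (Fin c ⊕ Fin d) (Fin c ⊕ Fin d) (zinkRing p (truncRing R (n + 1)))
  isUnit_A : IsUnit A
  isUnit_X : IsUnit X
  adm : (zinkData p hp2 (⊥ : Ideal (truncRing R (n + 1))) (Ideal.mul_bot _)).Adm X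
  comm : X * bcMatrix (h.homTrunc (n + 1)) (h.unitTrunc hp2 (n + 1)) A =
    A'.map (zinkMap p (Ideal.Quotient.mk (maximalIdeal R ^ (n + 1)))) *
      (zinkData p hp2 (⊥ : Ideal (truncRing R (n + 1))) (Ideal.mul_bot _)).sharp X

theorem nonempty_approxLift_zero {c d : ℕ}
    {A' : Matrix (Fin c ⊕ Fin d) (Fin c ⊕ Fin d) (zinkRing p R)} (hA' : IsUnit A') :
    Nonempty (h.ApproxLift hp2 A' 0) := by
  have hb := h.homTrunc_one_bijective
  have : IsLocalHom (h.homTrunc 1) := IsLocalHom.of_surjective _ hb.2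
  obtain ⟨A, hA, hAA'⟩ := exists_bcMatrix_eq hb.2 (h.unitTrunc hp2 1)
    (isUnit_map_matrix (zinkMap p (Ideal.Quotient.mk (maximalIdeal R ^ 1))) hA')
  refine ⟨⟨A, 1, hA, isUnit_one, WinData.adm_one _, ?_⟩⟩
  rw [WinData.sharp_one, Matrix.mul_one, Matrix.one_mul]
  exact hAA'

/-- Both the matrix and the isomorphism are lifted strictly, not merely up to isomorphism, so that a
sequence of choices has a limit. -/
theorem exists_approxLift_succ {c d : ℕ}
    {A' : Matrix (Fin c ⊕ Fin d) (Fin c ⊕ Fin d) (zinkRing p R)} (n : ℕ)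
    (x : h.ApproxLift hp2 A' n) : ∃ y : h.ApproxLift hp2 A' (n + 1),
      y.A.map (𝔖truncFactor p k r (Nat.le_succ (n + 1))) = x.A ∧
      y.X.map (zinkMap p (truncFactor R (Nat.le_succ (n + 1)))) = x.X := by
  have : IsLocalHom (𝔖truncFactor p k r (Nat.le_succ (n + 1))) :=
    IsLocalHom.of_surjective _ (Ideal.Quotient.factor_surjective
      (Ideal.pow_le_pow_right (Nat.le_succ (n + 1))))
  obtain ⟨A, X, hA, hX, hXa, hXA, hAx, hXx⟩ := (h.isThickeningSquare hp2 n).exists_lift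
    (zinkData_I_le p hp2 _ _)
    (A'.map (zinkMap p (Ideal.Quotient.mk (maximalIdeal R ^ (n + 1 + 1))))) x.A x.isUnit_A x.X
    x.isUnit_X x.adm (x.comm.trans (by
      congr 1))
  exact ⟨⟨A, X, hA, hX, hXa, hXA⟩, hAx, hXx⟩

theorem essentiallySurjective_hom : EssentiallySurjective
    (zinkData p hp2 (⊥ : Ideal R) (Ideal.mul_bot _)) h.hom (h.unit hp2) := by
  intro c d A' hA'
  choose next hnextA hnextX using fun n => h.exists_approxLift_succ hp2 (A' := A') n
  obtain ⟨x₀⟩ := h.nonempty_approxLift_zero hp2 hA'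
  let x : ∀ n, h.ApproxLift hp2 A' n := fun n => Nat.rec x₀ (fun n x => next n x) n
  obtain ⟨A, hA⟩ := exists_matrix_mk_eq (J𝔖 p k r) (fun n => (x n).A) fun n => hnextA n (x n)
  obtain ⟨X, hX⟩ := exists_matrix_zinkMap_eq p (fun n => (x n).X) fun n => hnextX n (x n)
  have hXa : (zinkData p hp2 (⊥ : Ideal R) (Ideal.mul_bot _)).Adm X := by
    intro i j
    rw [mem_zinkData_I, Submodule.mem_bot]
    refine eq_of_mk_eq (maximalIdeal R) fun n => ?_
    have h1 := (x n).adm i j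
    rw [← hX n, mem_zinkData_I, Submodule.mem_bot] at h1
    rw [map_zero]
    exact h1
  refine ⟨A, X, ?_, ?_, hXa, ?_⟩
  -- Units are detected at the lowest level, because the projection is a surjective homomorphism
  -- from a local ring onto a nonzero ring.
  · have : IsLocalHom (Ideal.Quotient.mk (J𝔖 p k r ^ (0 + 1))) :=
      IsLocalHom.of_surjective _ Ideal.Quotient.mk_surjective
    refine isUnit_of_isUnit_map (Ideal.Quotient.mk (J𝔖 p k r ^ (0 + 1))) ?_
    rw [hA]
    exact (x 0).isUnit_A
  · refine isUnit_of_isUnit_map (zinkMap p (Ideal.Quotient.mk (maximalIdeal R ^ (0 + 1)))) ?_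
    rw [hX]
    exact (x 0).isUnit_X
  · ext1 i j
    refine zinkRing_eq_of_forall p fun n => ?_
    have h1 := (x n).comm
    rw [← hX n, ← hA n, ← bcMatrix_map (h.zinkMap_hom (n + 1)) rfl,
      ← (isWinHom_zinkMap_mk hp2 (n + 1)).sharp_map_one hXa, ← Matrix.map_mul,
      ← Matrix.map_mul] at h1
    exact congrFun (congrFun h1 i) j

/-- As `𝕎(R) → 𝕎(R_a)` is surjective and local, an invertible matrix over `𝕎(R_a)` lifts to an
invertible one over `𝕎(R)`; a solution over `R` is then reduced. -/
theorem essentiallySurjective_homTrunc (a : ℕ) [NeZero a] : EssentiallySurjective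
    (zinkData p hp2 (⊥ : Ideal (truncRing R a)) (Ideal.mul_bot _)) (h.homTrunc a)
    (h.unitTrunc hp2 a) := by
  intro c d A' hA'
  obtain ⟨B', rfl⟩ := exists_matrix_map_eq (zinkMap_surjective p
    (Ideal.Quotient.mk (maximalIdeal R ^ a)) Ideal.Quotient.mk_surjective a
    (maximalIdeal_truncRing_pow R a)) A'
  obtain ⟨A, X, hA, hX, hXa, hXA⟩ := h.essentiallySurjective_hom hp2 c d B'
    (isUnit_of_isUnit_map _ hA')
  refine ⟨A.map (Ideal.Quotient.mk (J𝔖 p k r ^ a)), X.map (zinkMap p (Ideal.Quotient.mk _)),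
    isUnit_map_matrix _ hA, isUnit_map_matrix _ hX, (isWinHom_zinkMap_mk hp2 a).adm hXa, ?_⟩
  rw [← bcMatrix_map (h.zinkMap_hom a) rfl, ← (isWinHom_zinkMap_mk hp2 a).sharp_map_one hXa,
    ← Matrix.map_mul, ← Matrix.map_mul, hXA]

theorem fullyFaithful_homTrunc (a : ℕ) [NeZero a] :
    FullyFaithful (breuilTruncData p k r E h.constantCoeff_eq a)
      (zinkData p hp2 (⊥ : Ideal (truncRing R a)) (Ideal.mul_bot _)) (h.homTrunc a)
      (h.unitTrunc hp2 a) := by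
  obtain ⟨n, rfl⟩ := Nat.exists_eq_succ_of_ne_zero (NeZero.ne a)
  exact h.fullyFaithful_homTrunc_succ hp2 n

end IsPresentation

end LauFrames

/-! ### The homomorphisms of frames and the theorem -/

namespace LauFrames

open IsLocalRing

/-- The homomorphism of frames with given underlying data. -/
def FrameHom.ofIsWinHom {p : ℕ} {𝓕 𝓕' : Frame.{u} p} {D : WinData 𝓕.S} {D' : WinData 𝓕'.S}
    (hD : D.IsDataOf) (hD' : D'.IsDataOf) {ϰ : 𝓕.S →+* 𝓕'.S} {u : 𝓕'.Sˣ}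
    (h : IsWinHom D D' ϰ u) : FrameHom 𝓕 𝓕' where
  toRingHom := ϰ
  u := u
  map_I a ha := by
    rw [← hD'.I_eq]
    exact h.map_I a (hD.mem ha)
  map_σ a := by
    rw [← hD'.σ_eq, ← hD.σ_eq]
    exact h.map_σ a
  map_σ₁ a := by
    rw [← hD'.τ_eq, h.map_τ _ (hD.mem a.2), hD.τ_eq _ a.2]

namespace IsPresentation

variable {p : ℕ} [Fact p.Prime] {k : Type u} [Field k] [CharP k p] [PerfectRing k p] {r : ℕ}
  {R : Type u} [CommRing R] [IsLocalRing R] [CharP (ResidueField R) p]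
  [IsAdicComplete (maximalIdeal R) R] [PerfectRing (ResidueField R) p]
  {π : 𝔖 p k r →+* R} {E : 𝔖 p k r} (h : IsPresentation π E) (hp2 : p ≠ 2)

/-- The homomorphism of frames `ϰ : 𝓑 → 𝓓_R`. -/
noncomputable def frameHom :
    FrameHom (breuilFrame p k r E h.constantCoeff_eq) (dieudonneFrame p R hp2) :=
  FrameHom.ofIsWinHom (isDataOf_breuilData p k r E h.constantCoeff_eq)
    (isDataOf_dieudonneData p hp2) (h.isWinHom_hom hp2)

/-- The homomorphism of frames `ϰ_a : 𝓑_a → 𝓓_{R_a}`. -/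
noncomputable def frameHomTrunc (a : ℕ) [NeZero a] :
    FrameHom (breuilFrameTrunc p k r E h.constantCoeff_eq a)
      (dieudonneFrame p (truncRing R a) hp2) :=
  FrameHom.ofIsWinHom (isDataOf_breuilTruncData p k r E h.constantCoeff_eq a)
    (isDataOf_dieudonneData p hp2) (h.isWinHom_homTrunc hp2 a)

theorem isCrystalline_frameHom : IsCrystalline (h.frameHom hp2) := by
  have h1 : IsLocalRing (breuilFrame p k r E h.constantCoeff_eq).S :=
    inferInstanceAs (IsLocalRing (𝔖 p k r))
  have h2 : IsLocalRing (dieudonneFrame p R hp2).S := isLocalRing_zinkRing p R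
  exact isCrystalline_of_matrices (isDataOf_breuilData p k r E h.constantCoeff_eq)
    (isDataOf_dieudonneData p hp2) (h.isWinHom_hom hp2) (h.fullyFaithful_hom hp2)
    (h.essentiallySurjective_hom hp2)

theorem isCrystalline_frameHomTrunc (a : ℕ) [NeZero a] :
    IsCrystalline (h.frameHomTrunc hp2 a) := by
  have h1 : IsLocalRing (breuilFrameTrunc p k r E h.constantCoeff_eq a).S :=
    inferInstanceAs (IsLocalRing (𝔖trunc p k r a))
  have h2 : IsLocalRing (dieudonneFrame p (truncRing R a) hp2).S :=
    isLocalRing_zinkRing p (truncRing R a)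
  exact isCrystalline_of_matrices (isDataOf_breuilTruncData p k r E h.constantCoeff_eq a)
    (isDataOf_dieudonneData p hp2) (h.isWinHom_homTrunc hp2 a) (h.fullyFaithful_homTrunc hp2 a)
    (h.essentiallySurjective_homTrunc hp2 a)

theorem natCast_mul_unit :
    (p : zinkRing p R) * h.unit hp2 = h.hom (frob𝔖 p k r E) := by
  rw [mul_comm]
  exact (h.isWinHom_hom hp2).map_θ.symm

end IsPresentation

theorem isPresentation_of_regular {p : ℕ} [Fact p.Prime] {k : Type u} [Field k] [CharP k p]
    [PerfectRing k p] {r : ℕ} {R : Type u} [CommRing R] [IsLocalRing R]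
    {π : 𝔖 p k r →+* R} {E : 𝔖 p k r} (hr : (r : WithBot ℕ∞) ≤ ringKrullDim R)
    (hπX : Ideal.span (Set.range fun i => π (MvPowerSeries.X i)) = maximalIdeal R)
    (hπ : Function.Surjective π) (hE : MvPowerSeries.constantCoeff E = (p : WittVector p k))
    (hπE : π E = 0) : IsPresentation π E where
  constantCoeff_eq := hE
  map_mem _ _ hs := map_mem_maximalIdeal_pow hπX hs
  exists_mem a _ hy := exists_mem_J𝔖_pow hπX hπ a hy
  ker_eq := ker_π hπX hr hπ hE hπE

end LauFrames

theorem mainTheorem3 (p : ℕ) [Fact p.Prime] (hp2 : p ≠ 2)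
    (R : Type u) [CommRing R] [IsRegularLocalRing R]
    [IsAdicComplete (IsLocalRing.maximalIdeal R) R]
    [CharP (IsLocalRing.ResidueField R) p] [PerfectRing (IsLocalRing.ResidueField R) p]
    (r : ℕ) (hr : ringKrullDim R = r)
    (π : LauFrames.𝔖 p (IsLocalRing.ResidueField R) r →+* R)
    (hπX : Ideal.span (Set.range fun i => π (MvPowerSeries.X i)) = IsLocalRing.maximalIdeal R)
    (hπ : Function.Surjective ((IsLocalRing.residue R).comp π)) :
    Function.Surjective π ∧
    (∃ E : LauFrames.𝔖 p (IsLocalRing.ResidueField R) r,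
      MvPowerSeries.constantCoeff E = (p : WittVector p (IsLocalRing.ResidueField R)) ∧
        π E = 0) ∧
    ∀ (E : LauFrames.𝔖 p (IsLocalRing.ResidueField R) r)
      (hE : MvPowerSeries.constantCoeff E = (p : WittVector p (IsLocalRing.ResidueField R))),
      π E = 0 →
      RingHom.ker π = Ideal.span {E} ∧
      ∃ ϰ : LauFrames.FrameHom
          (LauFrames.breuilFrame p (IsLocalRing.ResidueField R) r E hE)
          (LauFrames.dieudonneFrame p R hp2),
        (∀ s : LauFrames.𝔖 p (IsLocalRing.ResidueField R) r,
          LauFrames.toWitt p R hp2 (ϰ.toRingHom s) =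
            WittVector.map π (LauFrames.δ𝔖 p (IsLocalRing.ResidueField R) r s)) ∧
        (p : (LauFrames.dieudonneFrame p R hp2).S) * ϰ.u =
          ϰ.toRingHom (LauFrames.frob𝔖 p (IsLocalRing.ResidueField R) r E) ∧
        LauFrames.IsCrystalline ϰ ∧
        ∀ (a : ℕ) [NeZero a],
          ∃ ϰa : LauFrames.FrameHom
              (LauFrames.breuilFrameTrunc p (IsLocalRing.ResidueField R) r E hE a)
              (LauFrames.dieudonneFrame p (LauFrames.truncRing R a) hp2),
            (∀ s : LauFrames.𝔖 p (IsLocalRing.ResidueField R) r,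
              LauFrames.toWitt p (LauFrames.truncRing R a) hp2
                  (ϰa.toRingHom (Ideal.Quotient.mk
                    (LauFrames.J𝔖 p (IsLocalRing.ResidueField R) r ^ a) s)) =
                WittVector.map (Ideal.Quotient.mk (IsLocalRing.maximalIdeal R ^ a))
                  (LauFrames.toWitt p R hp2 (ϰ.toRingHom s))) ∧
            LauFrames.toWitt p (LauFrames.truncRing R a) hp2 ϰa.u =
              WittVector.map (Ideal.Quotient.mk (IsLocalRing.maximalIdeal R ^ a))
                (LauFrames.toWitt p R hp2 ϰ.u) ∧
            LauFrames.IsCrystalline ϰa := by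
  have hπs : Function.Surjective π := LauFrames.surjective_π hπX hπ
  refine ⟨hπs, LauFrames.exists_E hπX hπs, fun E hE hπE => ?_⟩
  have h : LauFrames.IsPresentation π E :=
    LauFrames.isPresentation_of_regular hr.ge hπX hπs hE hπE
  refine ⟨h.ker_eq, h.frameHom hp2, fun s => rfl, h.natCast_mul_unit hp2,
    h.isCrystalline_frameHom hp2, fun a _ => ⟨h.frameHomTrunc hp2 a, fun s => ?_, rfl,
      h.isCrystalline_frameHomTrunc hp2 a⟩⟩
  exact (congrArg Subtype.val (h.zinkMap_hom a s)).symm
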